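/- List the nontrivial zeros of the Riemann zeta function, counted with multiplicity, in pairs $\rho=\tfrac12\pm i\tau_k$ ($k=1,2,\dots$) with $\operatorname{Re}\tau_k>0$ (the Riemann Hypothesis is not assumed, so $\tau_k$ may be non-real). Powers are taken on their principal branch. The series $\mathcal Z(\sigma)=\sum_{k\ge1}\tau_k^{-2\sigma}$ converges absolutely for $\operatorname{Re}\sigma>\tfrac12$ and continues to a meromorphic function $\mathcal Z$ on $\mathbb C$. The series $\mathbf Z(s)=\sum_{k\ge1}(\tfrac12+2k)^{-s}$ converges absolutely for $\operatorname{Re}s>1$ and continues to a meromorphic function $\mathbf Z$ on $\mathbb C$, given for all $s\ne1$ by $$\mathbf Z(s)=2^s\Bigl[\tfrac12\bigl((1-2^{-s})\zeta(s)+\beta(s)\bigr)-1\Bigr],$$ where $\beta(s)=L(\chi_4,s)$ is the (entire) Dirichlet beta function, i.e. the continuation of $\sum_{k\ge1}(-1)^{k+1}(2k-1)^{-s}$. Moreover: (ZC) There is $\varepsilon_0>0$ such that for every $\varepsilon\in(0,\varepsilon_0)$ and both choices of sign, for all $\sigma$ with $\operatorname{Re}\sigma<\tfrac12$ the integral $$\int_0^{e^{\pm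 i\varepsilon}\infty}t^{-2\sigma}\,\frac{\zeta'}{\zeta}\bigl(\tfrac12+t\bigr)\,dt$$ along the ray $t=re^{\pm i\varepsilon}$, $r>0$, converges absolutely and, if $\cos\pi\sigma\ne0$, $$\mathcal Z(\sigma)=\frac{-\mathbf Z(2\sigma)+2^{2\sigma}e^{\mp2\pi i\sigma}}{2\cos\pi\sigma}+\frac{\sin\pi\sigma}{\pi}\int_0^{e^{\pm i\varepsilon}\infty}t^{-2\sigma}\,\frac{\zeta'}{\zeta}\bigl(\tfrac12+t\bigr)\,dt .$$ (ZR1) For all $\sigma$ with $\operatorname{Re}\sigma<\tfrac12$, the principal value at $t=\tfrac12$ of $\int_0^\infty t^{-2\sigma}\frac{\zeta'}{\zeta}(\tfrac12+t)\,dt$ exists (the integral over $\{t>0,\ |t-\tfrac12|\ge\delta\}$ converges absolutely for each $\delta>0$ and has a limit as $\delta\to0^+$) and, if $\cos\pi\sigma\ne0$, $$\mathcal Z(\sigma)=\frac{-\mathbf Z(2\sigma)+2^{2\sigma}\cos2\pi\sigma}{2\cos\pi\sigma}+\frac{\sin\pi\sigma}{\pi}\;\mathrm{p.v.}\!\!\int_0^\infty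 t^{-2\sigma}\,\frac{\zeta'}{\zeta}\bigl(\tfrac12+t\bigr)\,dt .$$ (ZR2) The integral $$\int_0^\infty t^{-2\sigma}\Bigl[\frac{\zeta'}{\zeta}\bigl(\tfrac12+t\bigr)+\frac1{t-\frac12}\Bigr]dt$$ converges absolutely if and only if $0<\operatorname{Re}\sigma<\tfrac12$, and in that strip $$\mathcal Z(\sigma)=-\frac{\mathbf Z(2\sigma)}{2\cos\pi\sigma}+\frac{\sin\pi\sigma}{\pi}\int_0^\infty t^{-2\sigma}\Bigl[\frac{\zeta'}{\zeta}\bigl(\tfrac12+t\bigr)+\frac1{t-\frac12}\Bigr]dt .$$ -/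

import Mathlib

open MeasureTheory Filter Topology

noncomputable section

/-- The numbers `τ` with `Re τ > 0` for which `1/2 + iτ` is a zero of the Riemann zeta function.
Since `Im (1/2 + iτ) = Re τ > 0`, these zeros are nontrivial, and `1/2 ± iτ` runs through
all the pairs `{ρ, 1 - ρ}` of nontrivial zeros. No Riemann Hypothesis is assumed:
`τ` may be non-real. -/
def zetaZeroParam : Set ℂ :=
  {τ : ℂ | 0 < τ.re ∧ riemannZeta (1 / 2 + Complex.I * τ) = 0}

/-- The multiplicity of `1/2 + iτ` as a zero of the Riemann zeta function. -/
def zetaZeroMult (τ : ℂ) : ℕ :=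
  analyticOrderNatAt riemannZeta (1 / 2 + Complex.I * τ)

/-- The general term of the Dirichlet series `∑ₖ τₖ ^ (-2σ)`; the terms that belong to a
multiple zero are collected into one. -/
def zeroSeriesTerm (τ : zetaZeroParam) (σ : ℂ) : ℂ :=
  (zetaZeroMult τ : ℂ) * (τ : ℂ) ^ (-2 * σ)

/-- The general term of `∑_{k ≥ 1} (1/2 + 2k) ^ (-s)`, indexed by `k - 1 = 0, 1, 2, …`. -/
def shadowSeriesTerm (k : ℕ) (s : ℂ) : ℂ :=
  (1 / 2 + 2 * ((k : ℂ) + 1)) ^ (-s)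

/-- `F` is the meromorphic continuation to `ℂ` of the series `∑ᵢ a i s`, which converges
(absolutely) for `Re s > c`. The normal form fixes the values of `F` at removable singularities
and poles, so that `F` is unique. -/
def IsMeromorphicContinuation {ι : Type*} (a : ι → ℂ → ℂ) (c : ℝ) (F : ℂ → ℂ) : Prop :=
  MeromorphicNFOn F Set.univ ∧ ∀ s : ℂ, c < s.re → HasSum (fun i => a i s) (F s)

/-- The nontrivial Dirichlet character modulo 4, with complex values. -/
def chiFour : DirichletCharacter ℂ 4 :=
  ZMod.χ₄.ringHomComp (Int.castRingHom ℂ)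

/-- The Dirichlet beta function `β(s) = L(χ₄, s)` (an entire function). -/
def dirichletBeta (s : ℂ) : ℂ :=
  DirichletCharacter.LFunction chiFour s

/-- The function `t ↦ t ^ (-2σ) (ζ'/ζ)(1/2 + t)`. -/
def mellinIntegrand (σ t : ℂ) : ℂ :=
  t ^ (-2 * σ) * (deriv riemannZeta (1 / 2 + t) / riemannZeta (1 / 2 + t))

/-- The function `t ↦ t ^ (-2σ) [(ζ'/ζ)(1/2 + t) + 1/(t - 1/2)]`. -/
def regularMellinIntegrand (σ t : ℂ) : ℂ :=
  t ^ (-2 * σ) *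
    (deriv riemannZeta (1 / 2 + t) / riemannZeta (1 / 2 + t) + 1 / (t - 1 / 2))

/-- The pull-back of the differential `f(t) dt` to `(0, ∞)` along the ray `t = r e^{iθ}`, so that
`∫_0^{e^{iθ}∞} f(t) dt = ∫_0^∞ rayPullback f θ r dr`. -/
def rayPullback (f : ℂ → ℂ) (θ : ℝ) (r : ℝ) : ℂ :=
  f (r * Complex.exp (θ * Complex.I)) * Complex.exp (θ * Complex.I)

/-- The principal value at the point `c` of `∫_0^∞ f(t) dt` converges, with the value `P`. -/
def HasPrincipalValue (f : ℝ → ℂ) (c : ℝ) (P : ℂ) : Prop :=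
  (∀ δ : ℝ, 0 < δ → IntegrableOn f (Set.Ioi 0 \ Set.Ioo (c - δ) (c + δ))) ∧
    Tendsto (fun δ : ℝ => ∫ t in Set.Ioi 0 \ Set.Ioo (c - δ) (c + δ), f t) (𝓝[>] 0) (𝓝 P)

end

/-! The function `xiCentered`, that is ξ(1/2 + t), is entire, even and of order at most one, and its
zeros are exactly the points ±iτ. Its second logarithmic derivative is therefore an absolutely
convergent sum over the zeros, -(ξ'/ξ)'(1/2 + t) = ∑ m(τ) [(t - iτ)⁻² + (t + iτ)⁻²]
(`hasSum_xi_summand`). No Hadamard product is used: after division by the zeros in a disc of radius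
R, Borel–Carathéodory bounds the error by O(R^(p-2)) for any p > 1, and the same division bounds the
number of zeros (`sum_order_le_and_norm_deriv_logDeriv_add_sum_le`).

On the other hand ξ(1/2 + t) is, up to an exponential factor, the product of Γ(5/4 + t/2) and of (s
- 1)ζ(s) at s = 1/2 + t, and the Gamma factor contributes ∑ (t + 1/2 + 2k)⁻², k ≥ 1. Integration
against t^(1-2σ) over (0, ∞), for 1/2 < Re σ < 1, turns each (t + w)⁻² into a fixed multiple of
w^(-2σ). A pair ±iτ gives 2 cos(πσ) τ^(-2σ), the Gamma factor gives the shadow series at 2σ, and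
there remains the Mellin transform of the derivative of the regularised ζ'/ζ
(`zeroSeries_eq_stripFormula`). That transform is holomorphic in 0 < Re σ < 1, so it carries the
zero series across Re σ = 1/2. Integration by parts in 0 < Re σ < 1/2 then gives the formula with
the regularised integrand.

To continue further left, the path is turned to a ray of small angle, on which ζ'/ζ has no pole
(`integral_rayPullback_eq`). There the polar term 1/(t - 1/2) can be split off, its Mellin transform
is explicit, and what remains decays exponentially, hence is holomorphic for all Re σ < 1/2
(`zetaLogDerivMellin_eq`, `differentiableAt_reducedIntegral`). The rays of angle ±ε differ from the
principal value by half a residue, with opposite signs. The expressions agree on overlaps and glue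
to one meromorphic function, `superzeta`.

Absolute convergence fails outside the strip because the regularised ζ'/ζ does not vanish at t = 0
(`zetaLogDeriv_zero_ne_zero`) and has modulus at least 1/(2t) for large t. -/

/-! ### Splitting off zeros of an entire function. -/

theorem Differentiable.analyticOrderAt_ne_top_of_ne_zero {F : ℂ → ℂ} (hF : Differentiable ℂ F)
    {x : ℂ} (hx : F x ≠ 0) (u : ℂ) : analyticOrderAt F u ≠ ⊤ := by
  intro h
  rw [analyticOrderAt_eq_top] at h
  have hA : AnalyticOnNhd ℂ F Set.univ := fun z _ => hF.analyticAt z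
  have := hA.eq_of_eventuallyEq (analyticOnNhd_const (v := (0 : ℂ))) (z₀ := u) h
  exact hx (congrFun this x)

theorem Differentiable.exists_eq_pow_mul {F : ℂ → ℂ} (hF : Differentiable ℂ F)
    {x : ℂ} (hx : F x ≠ 0) (u : ℂ) :
    ∃ G : ℂ → ℂ, Differentiable ℂ G ∧
      (∀ z, F z = (z - u) ^ analyticOrderNatAt F u * G z) ∧ G u ≠ 0 := by
  have hA := hF.analyticAt u
  obtain ⟨g, hg, hgu, hFg⟩ :=
    hA.analyticOrderAt_ne_top.1 (hF.analyticOrderAt_ne_top_of_ne_zero hx u)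
  set n := analyticOrderNatAt F u
  have hupd : ∀ᶠ z in 𝓝 u, Function.update (fun z => F z / (z - u) ^ n) u (g u) z = g z := by
    filter_upwards [hFg] with z hz
    rcases eq_or_ne z u with rfl | hzu
    · simp
    · rw [Function.update_of_ne hzu, hz, smul_eq_mul, mul_div_cancel_left₀]
      exact pow_ne_zero _ (sub_ne_zero.2 hzu)
  refine ⟨Function.update (fun z => F z / (z - u) ^ n) u (g u), fun z => ?_, fun z => ?_, ?_⟩
  · rcases eq_or_ne z u with rfl | hzu
    · exact (hg.differentiableAt.congr_of_eventuallyEq hupd)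
    · have : DifferentiableAt ℂ (fun z => F z / (z - u) ^ n) z :=
        (hF z).div (by fun_prop) (pow_ne_zero _ (sub_ne_zero.2 hzu))
      refine this.congr_of_eventuallyEq ?_
      filter_upwards [isOpen_ne.mem_nhds hzu] with w hw
      exact Function.update_of_ne hw _ _
  · rcases eq_or_ne z u with rfl | hzu
    · simpa using hFg.self_of_nhds
    · rw [Function.update_of_ne hzu, mul_div_cancel₀]
      exact pow_ne_zero _ (sub_ne_zero.2 hzu)
  · simpa using hgu

theorem Differentiable.exists_eq_prod_pow_mul {F : ℂ → ℂ} (hF : Differentiable ℂ F)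
    {x : ℂ} (hx : F x ≠ 0) (S : Finset ℂ) :
    ∃ G : ℂ → ℂ, Differentiable ℂ G ∧
      (∀ z, F z = (∏ u ∈ S, (z - u) ^ analyticOrderNatAt F u) * G z) ∧ ∀ u ∈ S, G u ≠ 0 := by
  classical
  induction S using Finset.induction_on with
  | empty => exact ⟨F, hF, by simp, by simp⟩
  | insert a S ha ih =>
    obtain ⟨G, hG, hFG, hGS⟩ := ih
    have hGx : G x ≠ 0 := fun h => hx (by rw [hFG, h, mul_zero])
    obtain ⟨K, hK, hGK, hKa⟩ := hG.exists_eq_pow_mul hGx a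
    have hord : analyticOrderNatAt F a = analyticOrderNatAt G a := by
      have hP : Differentiable ℂ fun z : ℂ => ∏ u ∈ S, (z - u) ^ analyticOrderNatAt F u := by
        fun_prop
      have h1 : F = (fun z : ℂ => ∏ u ∈ S, (z - u) ^ analyticOrderNatAt F u) * G := by
        ext z; exact hFG z
      have h0 : analyticOrderAt (fun z : ℂ => ∏ u ∈ S, (z - u) ^ analyticOrderNatAt F u) a = 0 := by
        rw [(hP.analyticAt a).analyticOrderAt_eq_zero]
        refine Finset.prod_ne_zero_iff.2 fun u hu => pow_ne_zero _ (sub_ne_zero.2 ?_)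
        rintro rfl
        exact ha hu
      have : analyticOrderAt F a = analyticOrderAt G a := by
        conv_lhs => rw [h1]
        rw [analyticOrderAt_mul (hP.analyticAt a) (hG.analyticAt a), h0, zero_add]
      simp [analyticOrderNatAt, this]
    refine ⟨K, hK, fun z => ?_, fun u hu => ?_⟩
    · rw [Finset.prod_insert ha, hFG, hGK, hord]; ring
    · rcases Finset.mem_insert.1 hu with rfl | hu
      · exact hKa
      · intro h
        exact hGS u hu (by rw [hGK, h, mul_zero])

/-! ### Approximate partial fractions and zero counting. -/

/-- A zero-free analytic function on a disc, bounded by `e^L` times its value at the centre, has a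
logarithm whose second derivative is `O(L / R ^ 2)` well inside of the disc. -/
theorem norm_deriv_logDeriv_le_of_ne_zero {B : ℂ → ℂ} {R L : ℝ} (hR : 0 < R) (hL : 0 < L)
    (hB : DifferentiableOn ℂ B (Metric.ball 0 R)) (h0 : ∀ z ∈ Metric.ball (0 : ℂ) R, B z ≠ 0)
    (hbd : ∀ z ∈ Metric.ball (0 : ℂ) R, ‖B z‖ ≤ ‖B 0‖ * Real.exp L) {t : ℂ} (ht : ‖t‖ ≤ R / 4) :
    ‖deriv (logDeriv B) t‖ ≤ 64 * L / R ^ 2 := by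
  have h00 : (0 : ℂ) ∈ Metric.ball (0 : ℂ) R := Metric.mem_ball_self hR
  have hB0 := h0 0 h00
  have hB' : DifferentiableOn ℂ (deriv B) (Metric.ball 0 R) := hB.deriv Metric.isOpen_ball
  have hq : DifferentiableOn ℂ (logDeriv B) (Metric.ball 0 R) := hB'.div hB h0
  -- `h` is the logarithm of `B z / B 0` that vanishes at 0, obtained as a primitive of `logDeriv
  -- B`.
  obtain ⟨h, hh0, hh⟩ := hq.isExactOn_ball.with_val_at 0 0
  have hhd : DifferentiableOn ℂ h (Metric.ball 0 R) := fun z hz =>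
    (hh z hz).differentiableAt.differentiableWithinAt
  have hexp : ∀ z ∈ Metric.ball (0 : ℂ) R, B z = B 0 * Complex.exp (h z) := by
    have hder : ∀ z ∈ Metric.ball (0 : ℂ) R,
        HasDerivAt (fun z => B z * Complex.exp (-h z)) 0 z := by
      intro z hz
      have h1 : HasDerivAt B (deriv B z) z :=
        ((hB z hz).differentiableAt (Metric.isOpen_ball.mem_nhds hz)).hasDerivAt
      have h2 := h1.mul (hh z hz).neg.cexp
      have h3 : deriv B z * Complex.exp (-h z) +
          B z * (Complex.exp (-h z) * -logDeriv B z) = 0 := by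
        have := h0 z hz
        simp only [logDeriv_apply]
        field_simp
        ring
      exact h2.congr_deriv h3
    intro z hz
    have := (convex_ball (0 : ℂ) R).is_const_of_fderivWithin_eq_zero (𝕜 := ℂ)
      (f := fun z => B z * Complex.exp (-h z))
      (fun z hz => (hder z hz).differentiableAt.differentiableWithinAt)
      (fun z hz => by
        have := (hder z hz).hasFDerivAt.hasFDerivWithinAt (s := Metric.ball 0 R)
        rw [this.fderivWithin (Metric.isOpen_ball.uniqueDiffWithinAt hz)]
        ext; simp) hz h00
    simp only [hh0, neg_zero, Complex.exp_zero, mul_one] at this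
    rw [← this, mul_assoc, ← Complex.exp_add]
    simp
  have hre : Set.MapsTo h (Metric.ball 0 R) {z | z.re ≤ L} := by
    intro z hz
    have h1 := hbd z hz
    rw [hexp z hz, norm_mul, Complex.norm_exp] at h1
    exact Real.exp_le_exp.1 (le_of_mul_le_mul_left h1 (norm_pos_iff.2 hB0))
  -- Borel–Carathéodory turns Re h ≤ L into |h| ≤ 2L|z|/(R - |z|), which is at most 2L for |z| ≤
  -- R/2.
  have hbc : ∀ z : ℂ, ‖z‖ ≤ R / 2 → ‖h z‖ ≤ 2 * L := by
    intro z hz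
    have hz' : z ∈ Metric.ball (0 : ℂ) R := by simp; linarith
    refine (Complex.borelCaratheodory_zero hL hhd hre hR hz' hh0).trans ?_
    rw [div_le_iff₀ (by linarith)]
    nlinarith
  have hsub : ∀ z ∈ Metric.closedBall t (R / 4), ‖z‖ ≤ R / 2 := by
    intro z hz
    have h1 : ‖z - t‖ ≤ R / 4 := by simpa [dist_eq_norm] using hz
    calc ‖z‖ = ‖(z - t) + t‖ := by ring_nf
      _ ≤ ‖z - t‖ + ‖t‖ := norm_add_le _ _
      _ ≤ R / 2 := by linarith
  have hdc : DiffContOnCl ℂ h (Metric.ball t (R / 4)) := by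
    apply DifferentiableOn.diffContOnCl
    refine hhd.mono fun z hz => ?_
    have := hsub z (Metric.closure_ball_subset_closedBall hz)
    simp; linarith
  -- Cauchy's estimate with radius R/4: 2! · 2L / (R/4)² = 64 L / R².
  have hC := Complex.norm_iteratedDeriv_le_of_forall_mem_sphere_norm_le 2 (by positivity) hdc
    (C := 2 * L) (fun z hz => hbc z (hsub z (Metric.sphere_subset_closedBall hz)))
  have htR : t ∈ Metric.ball (0 : ℂ) R := by simp; linarith
  have heq : iteratedDeriv 2 h t = deriv (logDeriv B) t := by
    rw [iteratedDeriv_succ, iteratedDeriv_one]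
    apply Filter.EventuallyEq.deriv_eq
    filter_upwards [Metric.isOpen_ball.mem_nhds htR] with z hz
    exact (hh z hz).deriv
  rw [← heq]
  refine hC.trans (le_of_eq ?_)
  simp [Nat.factorial]
  field_simp
  ring

/-- **Approximate partial fractions**: an entire function that is bounded by `e ^ L` times its value
at the origin on the disc of radius `4 R` has at most `L` zeros in the disc of radius `R`, and
these zeros determine its second logarithmic derivative up to `O(L / R ^ 2)`. -/
theorem sum_order_le_and_norm_deriv_logDeriv_add_sum_le {f : ℂ → ℂ}
    (hf : Differentiable ℂ f) (h0 : f 0 ≠ 0) {R L : ℝ} (hR : 0 < R) (hL : 0 < L)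
    (hbd : ∀ z : ℂ, ‖z‖ ≤ 4 * R → ‖f z‖ ≤ ‖f 0‖ * Real.exp L) {S : Finset ℂ}
    (hS : ∀ z, z ∈ S ↔ ‖z‖ ≤ R ∧ f z = 0) :
    (∑ u ∈ S, (analyticOrderNatAt f u : ℝ) ≤ L) ∧
    ∀ t : ℂ, ‖t‖ ≤ R / 4 → f t ≠ 0 →
      ‖deriv (logDeriv f) t + ∑ u ∈ S, (analyticOrderNatAt f u : ℂ) / (t - u) ^ 2‖
        ≤ 64 * L / R ^ 2 := by
  obtain ⟨g, hg, hfg, hgS⟩ := hf.exists_eq_prod_pow_mul h0 S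
  set m := fun u => analyticOrderNatAt f u with hm
  have hS0 : ∀ u ∈ S, u ≠ 0 := by
    rintro u hu rfl
    exact h0 ((hS 0).1 hu).2
  -- With this constant, `c * g` is `f` divided by ∏ (1 - z/u)^m(u), so its value at 0 is still `f
  -- 0`.
  set c : ℂ := ∏ u ∈ S, (-u) ^ m u with hc
  have hc0 : c ≠ 0 := Finset.prod_ne_zero_iff.2 fun u hu => pow_ne_zero _ (neg_ne_zero.2 (hS0 u hu))
  have hB : Differentiable ℂ fun z => c * g z := hg.const_mul c
  have hf0 : f 0 = c * g 0 := by rw [hfg 0]; simp [hc, hm]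
  have hgne : ∀ z : ℂ, ‖z‖ ≤ R → g z ≠ 0 := by
    intro z hz hgz
    have : z ∈ S := (hS z).2 ⟨hz, by rw [hfg, hgz, mul_zero]⟩
    exact hgS z this hgz
  -- If |z| = 4R and |u| ≤ R, then |z - u| ≥ 3R ≥ 3|u|: every factor 1 - z/u has modulus at least 3.
  -- The maximum principle carries the bound inside.
  have hsphere : ∀ z : ℂ, ‖z‖ = 4 * R →
      ‖c * g z‖ ≤ ‖f 0‖ * Real.exp L / 3 ^ (∑ u ∈ S, m u) := by
    intro z hz
    have h1 := hbd z hz.le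
    rw [hfg, norm_mul] at h1
    rw [le_div_iff₀ (by positivity), norm_mul]
    have h2 : ‖c‖ * 3 ^ (∑ u ∈ S, m u) ≤ ‖∏ u ∈ S, (z - u) ^ m u‖ := by
      rw [hc, norm_prod, norm_prod, ← Finset.prod_pow_eq_pow_sum, ← Finset.prod_mul_distrib]
      apply Finset.prod_le_prod
      · intro i _; positivity
      · intro u hu
        rw [norm_pow, norm_pow, ← mul_pow, norm_neg]
        apply pow_le_pow_left₀ (by positivity)
        have := norm_sub_norm_le z u
        have := ((hS u).1 hu).1
        linarith
    calc ‖c‖ * ‖g z‖ * 3 ^ (∑ u ∈ S, m u) = (‖c‖ * 3 ^ (∑ u ∈ S, m u)) * ‖g z‖ := by ring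
      _ ≤ _ := mul_le_mul_of_nonneg_right h2 (norm_nonneg _)
      _ ≤ _ := h1
  have hball : ∀ z : ℂ, ‖z‖ ≤ 4 * R →
      ‖c * g z‖ ≤ ‖f 0‖ * Real.exp L / 3 ^ (∑ u ∈ S, m u) := by
    intro z hz
    refine Complex.norm_le_of_forall_mem_frontier_norm_le (U := Metric.ball (0 : ℂ) (4 * R))
      Metric.isBounded_ball hB.diffContOnCl (f := fun z => c * g z) ?_ ?_
    · intro w hw
      rw [frontier_ball _ (by positivity)] at hw
      exact hsphere w (by simpa using hw)
    · rw [closure_ball _ (by positivity)]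
      simpa using hz
  -- Jensen-type count: at the centre the bound reads 3^n ≤ e^L, where n counts the zeros with
  -- multiplicity; since e < 3, this gives n ≤ L.
  have hpow : (3 : ℝ) ^ (∑ u ∈ S, m u) ≤ Real.exp L := by
    have h1 := hball 0 (by simp; positivity)
    rw [← hf0, le_div_iff₀ (by positivity)] at h1
    exact le_of_mul_le_mul_left h1 (norm_pos_iff.2 h0)
  refine ⟨?_, fun t ht hft => ?_⟩
  · have h1 : Real.exp (∑ u ∈ S, (m u : ℝ)) ≤ 3 ^ (∑ u ∈ S, m u) := by
      rw [← Nat.cast_sum, ← mul_one ((∑ u ∈ S, m u : ℕ) : ℝ), Real.exp_nat_mul]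
      exact pow_le_pow_left₀ (Real.exp_pos 1).le (Real.exp_one_lt_d9.le.trans (by norm_num)) _
    exact Real.exp_le_exp.1 (h1.trans hpow)
  · have hbd' : ∀ z ∈ Metric.ball (0 : ℂ) R, ‖c * g z‖ ≤ ‖c * g 0‖ * Real.exp L := by
      intro z hz
      have hz' : ‖z‖ < R := by simpa using hz
      refine (hball z (by linarith)).trans ?_
      rw [← hf0]
      exact div_le_self (by positivity) (one_le_pow₀ (by norm_num))
    have hmain := norm_deriv_logDeriv_le_of_ne_zero hR hL hB.differentiableOn
      (fun z hz => mul_ne_zero hc0 (hgne z (by simpa using (Metric.mem_ball.1 hz).le))) hbd' ht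
    have htu : ∀ u ∈ S, t - u ≠ 0 := by
      intro u hu h
      rw [sub_eq_zero] at h
      exact hft (h ▸ ((hS u).1 hu).2)
    have hlog : logDeriv f =ᶠ[𝓝 t] fun z =>
        (∑ u ∈ S, (m u : ℂ) / (z - u)) + logDeriv (fun z => c * g z) z := by
      have : ∀ᶠ z in 𝓝 t, f z ≠ 0 := hf.continuous.continuousAt.eventually_ne hft
      filter_upwards [this] with z hz
      have hzu : ∀ u ∈ S, z - u ≠ 0 := by
        intro u hu h
        rw [sub_eq_zero] at h
        exact hz (h ▸ ((hS u).1 hu).2)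
      have hfe : f = fun z => (∏ u ∈ S, (z - u) ^ m u) * g z := funext hfg
      have hgz : g z ≠ 0 := fun h => hz (by rw [hfg, h, mul_zero])
      rw [logDeriv_const_mul z c hc0]
      conv_lhs => rw [hfe]
      rw [logDeriv_mul z (Finset.prod_ne_zero_iff.2 fun u hu => pow_ne_zero _ (hzu u hu)) hgz
        (by fun_prop) (hg z), logDeriv_prod (f := fun u z => (z - u) ^ m u)
        (fun u hu => pow_ne_zero _ (hzu u hu)) (by fun_prop)]
      congr 1
      refine Finset.sum_congr rfl fun u hu => ?_
      rw [logDeriv_fun_pow (by fun_prop)]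
      simp [logDeriv_apply, div_eq_mul_inv]
    have hgt : g t ≠ 0 := fun h => hft (by rw [hfg, h, mul_zero])
    have hd1 : ∀ u ∈ S, HasDerivAt (fun z => (m u : ℂ) / (z - u)) (-((m u : ℂ) / (t - u) ^ 2)) t := by
      intro u hu
      have := (hasDerivAt_const t (m u : ℂ)).div ((hasDerivAt_id t).sub_const u) (htu u hu)
      exact this.congr_deriv (by simp [neg_div])
    have hd2 : DifferentiableAt ℂ (logDeriv fun z => c * g z) t := by
      have : AnalyticAt ℂ (fun z => c * g z) t := hB.analyticAt t
      exact (this.deriv.div this (mul_ne_zero hc0 hgt)).differentiableAt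
    have : deriv (logDeriv f) t =
        (∑ u ∈ S, -((m u : ℂ) / (t - u) ^ 2)) + deriv (logDeriv fun z => c * g z) t := by
      rw [hlog.deriv_eq]
      exact ((HasDerivAt.fun_sum hd1).add hd2.hasDerivAt).deriv
    rw [this, Finset.sum_neg_distrib]
    convert hmain using 2
    ring

/-- A weighted family of positive numbers with counting function `O(R ^ q)` has convergence exponent
at most `q`. -/
theorem summable_mul_rpow_neg_of_count_le {ι : Type*} {r : ι → ℝ} {m : ι → ℕ} {c C p q : ℝ}
    (hc : 0 < c) (hcr : ∀ i, c ≤ r i) (hp : 0 ≤ p) (hqp : q < p) (hC : 0 ≤ C)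
    (hcount : ∀ R : ℝ, 1 ≤ R → ∀ F : Finset ι, (∀ i ∈ F, r i ≤ R) →
      ∑ i ∈ F, (m i : ℝ) ≤ C * R ^ q) :
    Summable fun i => (m i : ℝ) * r i ^ (-p) := by
  classical
  -- The term c^(-p) serves the indices with r ≤ 1, the term 2^p the dyadic shells 2^k < r ≤
  -- 2^(k+1).
  set A : ℝ := c ^ (-p) + 2 ^ p with hA
  have hA0 : 0 ≤ A := by positivity
  have hrpos : ∀ i, 0 < r i := fun i => hc.trans_le (hcr i)
  have hex : ∀ i, ∃ j : ℕ, r i ≤ 2 ^ j := fun i => by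
    obtain ⟨j, hj⟩ := pow_unbounded_of_one_lt (r i) (one_lt_two (α := ℝ))
    exact ⟨j, hj.le⟩
  let J : ι → ℕ := fun i => Nat.find (hex i)
  have hJ : ∀ i, r i ≤ 2 ^ J i := fun i => Nat.find_spec (hex i)
  have hbd : ∀ i, r i ^ (-p) ≤ A * ((2 : ℝ) ^ (-p)) ^ J i := by
    intro i
    rcases Nat.eq_zero_or_pos (J i) with h0 | hpos
    · rw [h0, pow_zero, mul_one]
      have : r i ^ (-p) ≤ c ^ (-p) := Real.rpow_le_rpow_of_nonpos hc (hcr i) (by linarith)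
      have : (0 : ℝ) ≤ 2 ^ p := by positivity
      linarith
    · obtain ⟨k, hk⟩ : ∃ k, J i = k + 1 := ⟨J i - 1, by omega⟩
      have h1 : ¬ r i ≤ 2 ^ k := Nat.find_min (hex i) (by show k < J i; omega)
      have h2 : r i ^ (-p) ≤ ((2 : ℝ) ^ k) ^ (-p) :=
        Real.rpow_le_rpow_of_nonpos (by positivity) (not_le.1 h1).le (by linarith)
      have h3 : ((2 : ℝ) ^ k) ^ (-p) = 2 ^ p * ((2 : ℝ) ^ (-p)) ^ J i := by
        rw [hk, pow_succ, ← Real.rpow_natCast, ← Real.rpow_natCast, ← Real.rpow_mul (by norm_num),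
          ← Real.rpow_mul (by norm_num), mul_comm (k : ℝ) (-p), mul_left_comm,
          ← Real.rpow_add (by norm_num)]
        simp
      rw [h3] at h2
      refine h2.trans (mul_le_mul_of_nonneg_right ?_ (by positivity))
      have : (0 : ℝ) ≤ c ^ (-p) := by positivity
      linarith
  -- Shell `j` contributes at most a constant times 2^(jq) · 2^(-jp) = x ^ j, a convergent geometric
  -- series.
  set x : ℝ := 2 ^ (q - p) with hx
  have hx0 : 0 ≤ x := by positivity
  have hx1 : x < 1 := Real.rpow_lt_one_of_one_lt_of_neg (by norm_num) (by linarith)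
  refine summable_of_sum_le (c := A * C * (1 - x)⁻¹) (fun i => by have := hrpos i; positivity)
    fun F => ?_
  set N := F.sup J + 1
  calc ∑ i ∈ F, (m i : ℝ) * r i ^ (-p)
      ≤ ∑ i ∈ F, ∑ j ∈ Finset.range N, if J i = j then A * ((m i : ℝ) * ((2 : ℝ) ^ (-p)) ^ j)
          else 0 := by
        refine Finset.sum_le_sum fun i hi => ?_
        have hmem : J i ∈ Finset.range N :=
          Finset.mem_range.2 (Nat.lt_succ_of_le (Finset.le_sup (f := J) hi))
        rw [Finset.sum_ite_eq, if_pos hmem]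
        calc (m i : ℝ) * r i ^ (-p) ≤ m i * (A * ((2 : ℝ) ^ (-p)) ^ J i) := by
              gcongr; exact hbd i
          _ = _ := by ring
    _ = ∑ j ∈ Finset.range N, A * ((2 : ℝ) ^ (-p)) ^ j * ∑ i ∈ F with J i = j, (m i : ℝ) := by
        rw [Finset.sum_comm]
        refine Finset.sum_congr rfl fun j _ => ?_
        rw [Finset.sum_filter, Finset.mul_sum]
        refine Finset.sum_congr rfl fun i _ => ?_
        split_ifs <;> ring
    _ ≤ ∑ j ∈ Finset.range N, A * C * x ^ j := by
        refine Finset.sum_le_sum fun j _ => ?_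
        have h1 := hcount (2 ^ j) (one_le_pow₀ (by norm_num)) {i ∈ F | J i = j} (fun i hi => by
          rw [← (Finset.mem_filter.1 hi).2]; exact hJ i)
        have h2 : x ^ j = ((2 : ℝ) ^ (-p)) ^ j * ((2 : ℝ) ^ j) ^ q := by
          rw [hx, ← Real.rpow_natCast, ← Real.rpow_natCast, ← Real.rpow_natCast,
            ← Real.rpow_mul (by norm_num), ← Real.rpow_mul (by norm_num),
            ← Real.rpow_mul (by norm_num), ← Real.rpow_add (by norm_num)]
          ring_nf
        calc A * ((2 : ℝ) ^ (-p)) ^ j * ∑ i ∈ F with J i = j, (m i : ℝ)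
            ≤ A * ((2 : ℝ) ^ (-p)) ^ j * (C * ((2 : ℝ) ^ j) ^ q) := by gcongr
          _ = A * C * x ^ j := by rw [h2]; ring
    _ = A * C * ∑ j ∈ Finset.range N, x ^ j := by rw [Finset.mul_sum]
    _ ≤ A * C * (1 - x)⁻¹ := by
        gcongr
        exact (Summable.sum_le_tsum _ (fun _ _ => by positivity)
          (summable_geometric_of_lt_one hx0 hx1)).trans (tsum_geometric_of_lt_one hx0 hx1).le

/-! ### Growth of (s - 1)ζ(s) in Re s ≥ 1/2 and its zero-freeness on the positive axis. -/

/-- The fractional part of `x`, restricted to `x > 1`. -/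
noncomputable def fractIoi (x : ℝ) : ℂ := (Set.Ioi (1 : ℝ)).indicator (fun x => ((Int.fract x : ℝ) : ℂ)) x

theorem measurable_fractIoi : Measurable fractIoi :=
  (Complex.measurable_ofReal.comp measurable_fract).indicator measurableSet_Ioi

theorem norm_fractIoi_le (x : ℝ) : ‖fractIoi x‖ ≤ 1 := by
  unfold fractIoi
  by_cases hx : x ∈ Set.Ioi (1 : ℝ)
  · rw [Set.indicator_of_mem hx, Complex.norm_real, Real.norm_of_nonneg (Int.fract_nonneg x)]
    exact (Int.fract_lt_one x).le
  · rw [Set.indicator_of_notMem hx]; simp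

theorem locallyIntegrableOn_fractIoi : LocallyIntegrableOn fractIoi (Set.Ioi 0) := by
  refine LocallyIntegrable.locallyIntegrableOn ?_ _
  exact (locallyIntegrable_const (1 : ℝ)).mono measurable_fractIoi.aestronglyMeasurable
    (Eventually.of_forall fun x => by simpa using norm_fractIoi_le x)

theorem isBigO_fractIoi_atTop : fractIoi =O[atTop] fun x : ℝ => x ^ (-(0 : ℝ)) := by
  refine Asymptotics.IsBigO.of_bound 1 (Eventually.of_forall fun x => ?_)
  simpa using norm_fractIoi_le x

/-- Since the function vanishes on (0, 1], the exponent `b` is arbitrary; the Mellin transform then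
needs only Re s < 0. -/
theorem isBigO_fractIoi_zero (b : ℝ) : fractIoi =O[𝓝[>] 0] fun x : ℝ => x ^ (-b) := by
  refine Asymptotics.IsBigO.of_bound 1 ?_
  filter_upwards [nhdsWithin_le_nhds (Iio_mem_nhds (zero_lt_one' ℝ))] with x hx
  have : fractIoi x = 0 := Set.indicator_of_notMem (by simpa using (Set.mem_Iio.1 hx).le) _
  rw [this]; simp

theorem mellinConvergent_fractIoi {s : ℂ} (hs : s.re < 0) : MellinConvergent fractIoi s :=
  mellinConvergent_of_isBigO_rpow locallyIntegrableOn_fractIoi isBigO_fractIoi_atTop hs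
    (isBigO_fractIoi_zero (s.re - 1)) (by linarith)

theorem differentiableAt_mellin_fractIoi {s : ℂ} (hs : s.re < 0) :
    DifferentiableAt ℂ (mellin fractIoi) s :=
  mellin_differentiableAt_of_isBigO_rpow locallyIntegrableOn_fractIoi isBigO_fractIoi_atTop hs
    (isBigO_fractIoi_zero (s.re - 1)) (by linarith)

theorem mellin_fractIoi_eq (s : ℂ) :
    mellin fractIoi s = ∫ t in Set.Ioi (1 : ℝ), (t : ℂ) ^ (s - 1) * ((Int.fract t : ℝ) : ℂ) := by
  rw [mellin, ← integral_indicator measurableSet_Ioi, ← integral_indicator measurableSet_Ioi]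
  congr 1
  ext t
  by_cases ht : t ∈ Set.Ioi (1 : ℝ)
  · rw [Set.indicator_of_mem ht, Set.indicator_of_mem (by
      exact Set.mem_Ioi.2 (zero_lt_one.trans ht)), fractIoi, Set.indicator_of_mem ht, smul_eq_mul]
  · rw [Set.indicator_of_notMem ht]
    by_cases h0 : t ∈ Set.Ioi (0 : ℝ)
    · rw [Set.indicator_of_mem h0, fractIoi, Set.indicator_of_notMem ht, smul_zero]
    · rw [Set.indicator_of_notMem h0]

/-- Abel summation: ζ(s) = s ∫₁^∞ ⌊t⌋ t^(-s-1) dt, with ⌊t⌋ = t - {t}. -/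
theorem riemannZeta_eq_sub_mellin_fractIoi {s : ℂ} (hs : 1 < s.re) :
    riemannZeta s = s / (s - 1) - s * mellin fractIoi (-s) := by
  have h1 := LSeries_eq_mul_integral_of_nonneg (fun _ => 1) (r := 1) zero_le_one hs
    (by simpa using Asymptotics.isBigO_refl _ _) (fun _ => zero_le_one)
  have h2 : LSeries (fun _ : ℕ => ((1 : ℝ) : ℂ)) s = riemannZeta s := by
    rw [← LSeries_one_eq_riemannZeta hs]
    congr 1
  have hs1 : s - 1 ≠ 0 := fun h => by
    have := congrArg Complex.re h
    simp at this; linarith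
  have h3 : IntegrableOn (fun t : ℝ => (t : ℂ) ^ (-s)) (Set.Ioi 1) :=
    integrableOn_Ioi_cpow_of_lt (by simpa using hs) zero_lt_one
  have h4 : IntegrableOn (fun t : ℝ => (t : ℂ) ^ (-s - 1) * ((Int.fract t : ℝ) : ℂ)) (Set.Ioi 1) := by
    have h5 : IntegrableOn (fun t : ℝ => (t : ℂ) ^ (-s - 1) • fractIoi t) (Set.Ioi 1) :=
      (mellinConvergent_fractIoi (s := -s) (by simp; linarith)).mono_set
        (Set.Ioi_subset_Ioi zero_le_one)
    refine h5.congr_fun (fun t ht => ?_) measurableSet_Ioi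
    simp only [fractIoi, Set.indicator_of_mem ht, smul_eq_mul]
  have h6 : (∫ t in Set.Ioi (1 : ℝ), (t : ℂ) ^ (-s)) = 1 / (s - 1) := by
    rw [integral_Ioi_cpow_of_lt (by simpa using hs) zero_lt_one]
    have : -s + 1 = -(s - 1) := by ring
    rw [this, Complex.ofReal_one, Complex.one_cpow]
    field_simp
  rw [← h2, h1, mellin_fractIoi_eq]
  have h7 : (∫ t in Set.Ioi (1 : ℝ), (∑ k ∈ Finset.Icc 1 ⌊t⌋₊, ((1 : ℝ) : ℂ)) * (t : ℂ) ^ (-(s + 1)))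
      = ∫ t in Set.Ioi (1 : ℝ), ((t : ℂ) ^ (-s) - (t : ℂ) ^ (-s - 1) * ((Int.fract t : ℝ) : ℂ)) := by
    refine setIntegral_congr_fun measurableSet_Ioi fun t ht => ?_
    have ht0 : (0 : ℝ) < t := zero_lt_one.trans ht
    have h8 : ((⌊t⌋₊ : ℝ) : ℂ) = t - ((Int.fract t : ℝ) : ℂ) := by
      rw [natCast_floor_eq_intCast_floor ht0.le, ← Complex.ofReal_sub, Int.self_sub_fract]
    have h9 : (t : ℂ) ^ (-s) = t * (t : ℂ) ^ (-s - 1) := by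
      rw [Complex.cpow_sub _ _ (by exact_mod_cast ht0.ne'), Complex.cpow_one]
      have : (t : ℂ) ≠ 0 := by exact_mod_cast ht0.ne'
      field_simp
    simp only [Complex.ofReal_one, Finset.sum_const, Nat.card_Icc, Nat.add_sub_cancel, nsmul_eq_mul,
      mul_one]
    have h10 : ((⌊t⌋₊ : ℕ) : ℂ) = ((⌊t⌋₊ : ℝ) : ℂ) := by simp
    rw [h10, h8, h9, show -(s + 1) = -s - 1 by ring]
    ring
  rw [h7, integral_sub h3 h4, h6]
  ring

/-- The integral representation of `(s - 1) ζ(s)` in the half-plane `Re s > 0`. -/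
theorem riemannZeta₁_eq_mellin_fractIoi {s : ℂ} (hs : 0 < s.re) :
    riemannZeta₁ s = s - s * (s - 1) * mellin fractIoi (-s) := by
  have hU : IsOpen {s : ℂ | 0 < s.re} := isOpen_lt continuous_const Complex.continuous_re
  have hT : DifferentiableOn ℂ (fun s => mellin fractIoi (-s)) {s : ℂ | 0 < s.re} := by
    intro z hz
    exact ((differentiableAt_mellin_fractIoi (s := -z) (by simpa using hz)).comp z
      differentiableAt_id.neg).differentiableWithinAt
  have hf : AnalyticOnNhd ℂ riemannZeta₁ {s : ℂ | 0 < s.re} := fun z _ =>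
    differentiable_riemannZeta₁.analyticAt z
  have hg : AnalyticOnNhd ℂ (fun s => s - s * (s - 1) * mellin fractIoi (-s))
      {s : ℂ | 0 < s.re} := by
    apply DifferentiableOn.analyticOnNhd _ hU
    fun_prop
  have hpc : IsPreconnected {s : ℂ | 0 < s.re} := (convex_halfSpace_re_gt 0).isPreconnected
  refine hf.eqOn_of_preconnected_of_eventuallyEq hg hpc (z₀ := 2) (by simp) ?_ hs
  have : {s : ℂ | 1 < s.re} ∈ 𝓝 (2 : ℂ) :=
    (isOpen_lt continuous_const Complex.continuous_re).mem_nhds (by simp)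
  filter_upwards [this] with z hz
  have hz1 : z ≠ 1 := by rintro rfl; simp at hz
  have h1 := riemannZeta_eq_sub_mellin_fractIoi hz
  rw [riemannZeta_eq_inv_sub_mul hz1] at h1
  have := sub_ne_zero.2 hz1
  field_simp at h1
  linear_combination h1

/-- Growth is polynomial because the fractional-part integral is at most ∫₁^∞ t^(-3/2) dt = 2. Thus
the Gamma factor alone decides the order of ξ. -/
theorem norm_riemannZeta₁_le {s : ℂ} (hs : 1 / 2 ≤ s.re) :
    ‖riemannZeta₁ s‖ ≤ ‖s‖ + 2 * ‖s‖ * ‖s - 1‖ := by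
  have hT : ‖mellin fractIoi (-s)‖ ≤ 2 := by
    rw [mellin_fractIoi_eq]
    have h1 : IntegrableOn (fun t : ℝ => t ^ (-(3 / 2) : ℝ)) (Set.Ioi 1) :=
      integrableOn_Ioi_rpow_of_lt (by norm_num) zero_lt_one
    refine (norm_integral_le_of_norm_le h1 ?_).trans ?_
    · rw [ae_restrict_iff' measurableSet_Ioi]
      refine Eventually.of_forall fun t ht => ?_
      have ht1 : (1 : ℝ) < t := ht
      rw [norm_mul, Complex.norm_cpow_eq_rpow_re_of_pos (zero_lt_one.trans ht1), Complex.norm_real,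
        Real.norm_of_nonneg (Int.fract_nonneg t)]
      calc t ^ (-s - 1).re * Int.fract t ≤ t ^ (-s - 1).re * 1 := by
            gcongr
            exact (Int.fract_lt_one t).le
        _ ≤ t ^ (-(3 / 2) : ℝ) := by
            rw [mul_one]
            refine Real.rpow_le_rpow_of_exponent_le ht1.le ?_
            simp; linarith
    · rw [integral_Ioi_rpow_of_lt (by norm_num) zero_lt_one]
      norm_num
  rw [riemannZeta₁_eq_mellin_fractIoi (by linarith)]
  refine (norm_sub_le _ _).trans ?_
  rw [norm_mul, norm_mul]
  nlinarith [mul_nonneg (norm_nonneg s) (norm_nonneg (s - 1))]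

/-- For 0 < x < 1 the integral representation reads x + x(1 - x) ∫₁^∞ t^(-x-1) {t} dt, which is
positive. -/
theorem riemannZeta₁_ofReal_ne_zero {x : ℝ} (hx : 0 < x) : riemannZeta₁ x ≠ 0 := by
  rcases le_or_gt 1 x with h1 | h1
  · rcases h1.eq_or_lt with rfl | h1
    · simp
    · have hx1 : (x : ℂ) ≠ 1 := by exact_mod_cast h1.ne'
      have := riemannZeta_ne_zero_of_one_le_re (s := x) (by simpa using h1.le)
      rw [riemannZeta_eq_inv_sub_mul hx1] at this
      exact right_ne_zero_of_mul this
  · have hT : mellin fractIoi (-(x : ℂ)) =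
        ((∫ t in Set.Ioi (1 : ℝ), t ^ (-x - 1) * Int.fract t : ℝ) : ℂ) := by
      rw [mellin_fractIoi_eq, ← integral_complex_ofReal]
      refine setIntegral_congr_fun measurableSet_Ioi fun t ht => ?_
      have ht0 : (0 : ℝ) < t := zero_lt_one.trans ht
      rw [Complex.ofReal_mul, Complex.ofReal_cpow ht0.le]
      push_cast
      rfl
    have hT0 : 0 ≤ ∫ t in Set.Ioi (1 : ℝ), t ^ (-x - 1) * Int.fract t := by
      refine setIntegral_nonneg measurableSet_Ioi fun t ht => ?_
      have ht0 : (0 : ℝ) < t := zero_lt_one.trans ht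
      exact mul_nonneg (Real.rpow_nonneg ht0.le _) (Int.fract_nonneg t)
    rw [riemannZeta₁_eq_mellin_fractIoi (by simpa using hx), hT]
    norm_cast
    have := mul_nonneg (mul_nonneg hx.le (sub_nonneg.2 h1.le)) hT0
    intro h
    nlinarith

/-! ### The function ξ: location of its zeros and its order. -/

/-- Riemann's entire function `ξ(s) = s (s - 1) Λ(s)`, up to a factor `1/2`. -/
noncomputable def riemannXi (s : ℂ) : ℂ := s * (s - 1) * completedRiemannZeta₀ s + 1

theorem differentiable_riemannXi : Differentiable ℂ riemannXi := by
  have := differentiable_completedZeta₀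
  unfold riemannXi
  fun_prop

theorem riemannXi_one_sub (s : ℂ) : riemannXi (1 - s) = riemannXi s := by
  rw [riemannXi, riemannXi, completedRiemannZeta₀_one_sub]; ring

theorem riemannXi_eq_mul_completedRiemannZeta {s : ℂ} (h0 : s ≠ 0) (h1 : s ≠ 1) :
    riemannXi s = s * (s - 1) * completedRiemannZeta s := by
  rw [riemannXi, completedRiemannZeta_eq]
  have := sub_ne_zero.2 h1
  have : 1 - s ≠ 0 := sub_ne_zero.2 h1.symm
  field_simp
  ring

theorem riemannXi_eq_mul_Gammaℝ_mul_riemannZeta {s : ℂ} (h0 : s ≠ 0) (h1 : s ≠ 1)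
    (hG : s.Gammaℝ ≠ 0) : riemannXi s = s * (s - 1) * s.Gammaℝ * riemannZeta s := by
  rw [riemannXi_eq_mul_completedRiemannZeta h0 h1, riemannZeta_def_of_ne_zero h0]
  field_simp

theorem riemannXi_eq_of_re_pos {s : ℂ} (hs : 0 < s.re) :
    riemannXi s = s * riemannZeta₁ s * s.Gammaℝ := by
  rcases eq_or_ne s 1 with rfl | h1
  · simp [riemannXi]
  · have h0 : s ≠ 0 := by rintro rfl; simp at hs
    rw [riemannXi_eq_mul_Gammaℝ_mul_riemannZeta h0 h1 (Complex.Gammaℝ_ne_zero_of_re_pos hs),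
      riemannZeta_eq_inv_sub_mul h1]
    have := sub_ne_zero.2 h1
    field_simp

theorem riemannZeta₁_ne_zero_of_one_le_re {s : ℂ} (hs : 1 ≤ s.re) : riemannZeta₁ s ≠ 0 := by
  rcases eq_or_ne s 1 with rfl | h1
  · simp
  · have := riemannZeta_ne_zero_of_one_le_re hs
    rw [riemannZeta_eq_inv_sub_mul h1] at this
    exact right_ne_zero_of_mul this

theorem riemannXi_ne_zero_of_one_le_re {s : ℂ} (hs : 1 ≤ s.re) : riemannXi s ≠ 0 := by
  have h0 : s ≠ 0 := by rintro rfl; simp at hs; linarith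
  rw [riemannXi_eq_of_re_pos (by linarith)]
  exact mul_ne_zero (mul_ne_zero h0 (riemannZeta₁_ne_zero_of_one_le_re hs))
    (Complex.Gammaℝ_ne_zero_of_re_pos (by linarith))

theorem re_mem_Ioo_of_riemannXi_eq_zero {s : ℂ} (hs : riemannXi s = 0) : 0 < s.re ∧ s.re < 1 := by
  constructor
  · by_contra h
    refine riemannXi_ne_zero_of_one_le_re (s := 1 - s) ?_ (by rw [riemannXi_one_sub, hs])
    simp; linarith
  · by_contra h
    exact riemannXi_ne_zero_of_one_le_re (not_lt.1 h) hs

theorem im_ne_zero_of_riemannXi_eq_zero {s : ℂ} (hs : riemannXi s = 0) : s.im ≠ 0 := by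
  intro him
  have hre := (re_mem_Ioo_of_riemannXi_eq_zero hs).1
  have h1 : s = (s.re : ℂ) := by apply Complex.ext <;> simp [him]
  have h0 : s ≠ 0 := by rintro rfl; simp at hre
  rw [riemannXi_eq_of_re_pos hre] at hs
  refine mul_ne_zero (mul_ne_zero h0 ?_) (Complex.Gammaℝ_ne_zero_of_re_pos hre) hs
  rw [h1]
  exact riemannZeta₁_ofReal_ne_zero hre

/-- The zeros of `ξ` stay away from the real axis. -/
theorem exists_le_abs_im_of_riemannXi_eq_zero :
    ∃ δ : ℝ, 0 < δ ∧ ∀ s : ℂ, riemannXi s = 0 → δ ≤ |s.im| := by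
  -- Zeros have 0 < Re s < 1, so those with |Im s| ≤ 1 form a compact set, on which |Im s| attains a
  -- positive minimum.
  let K : Set ℂ := {s | riemannXi s = 0} ∩ (Set.Icc 0 1 ×ℂ Set.Icc (-1) 1)
  have hK : IsCompact K := by
    refine IsCompact.inter_left (isCompact_Icc.reProdIm isCompact_Icc) ?_
    exact isClosed_eq differentiable_riemannXi.continuous continuous_const
  rcases K.eq_empty_or_nonempty with hE | hne
  · refine ⟨1, one_pos, fun s hs => ?_⟩
    by_contra! h
    have : s ∈ K := by
      have h1 := re_mem_Ioo_of_riemannXi_eq_zero hs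
      have h2 := abs_lt.1 h
      exact ⟨hs, Complex.mem_reProdIm.2 ⟨⟨h1.1.le, h1.2.le⟩, ⟨h2.1.le, h2.2.le⟩⟩⟩
    rw [hE] at this
    exact this
  · obtain ⟨s₀, hs₀, hmin⟩ := hK.exists_isMinOn hne
      (f := fun s => |s.im|) (by fun_prop)
    refine ⟨|s₀.im|, abs_pos.2 (im_ne_zero_of_riemannXi_eq_zero hs₀.1), fun s hs => ?_⟩
    by_cases h : |s.im| ≤ 1
    · have h1 := re_mem_Ioo_of_riemannXi_eq_zero hs
      have h2 := abs_le.1 h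
      exact hmin ⟨hs, Complex.mem_reProdIm.2 ⟨⟨h1.1.le, h1.2.le⟩, ⟨h2.1, h2.2⟩⟩⟩
    · have h3 := (Complex.mem_reProdIm.1 hs₀.2).2
      have : |s₀.im| ≤ 1 := abs_le.2 ⟨h3.1, h3.2⟩
      linarith

theorem Complex.norm_Gamma_le_Gamma_re {s : ℂ} (hs : 0 < s.re) :
    ‖Complex.Gamma s‖ ≤ Real.Gamma s.re := by
  rw [Complex.Gamma_eq_integral hs, Real.Gamma_eq_integral hs, Complex.GammaIntegral]
  refine norm_integral_le_of_norm_le (Real.GammaIntegral_convergent hs) ?_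
  rw [ae_restrict_iff' measurableSet_Ioi]
  refine Eventually.of_forall fun x hx => le_of_eq ?_
  rw [norm_mul, Complex.norm_cpow_eq_rpow_re_of_pos hx, Complex.norm_real,
    Real.norm_of_nonneg (Real.exp_pos _).le]
  simp

/-- A crude Stirling bound from n! ≤ n^n; the shift by 2 puts the argument where Γ is increasing. -/
theorem Real.Gamma_add_two_le_exp {x : ℝ} (hx : 0 ≤ x) :
    Real.Gamma (x + 2) ≤ Real.exp ((x + 2) * Real.log (x + 2)) := by
  have h1 : Real.Gamma (x + 2) ≤ Real.Gamma ((⌈x⌉₊ + 1 : ℕ) + 1) := by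
    refine Real.Gamma_strictMonoOn_Ici.monotoneOn (Set.mem_Ici.2 (by linarith))
      (Set.mem_Ici.2 ?_) ?_
    · push_cast; have : (0 : ℝ) ≤ ⌈x⌉₊ := by positivity
      linarith
    · push_cast; linarith [Nat.le_ceil x]
  rw [Real.Gamma_nat_eq_factorial] at h1
  refine h1.trans ?_
  have h2 : ((⌈x⌉₊ + 1).factorial : ℝ) ≤ ((⌈x⌉₊ + 1 : ℕ) : ℝ) ^ (⌈x⌉₊ + 1) := by
    exact_mod_cast Nat.factorial_le_pow _
  refine h2.trans ?_
  have h3 : ((⌈x⌉₊ + 1 : ℕ) : ℝ) ≤ x + 2 := by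
    push_cast; linarith [Nat.ceil_lt_add_one hx]
  have h4 : (1 : ℝ) ≤ x + 2 := by linarith
  calc ((⌈x⌉₊ + 1 : ℕ) : ℝ) ^ (⌈x⌉₊ + 1) ≤ (x + 2) ^ (⌈x⌉₊ + 1) := by gcongr
    _ = (x + 2) ^ ((⌈x⌉₊ + 1 : ℕ) : ℝ) := (Real.rpow_natCast _ _).symm
    _ ≤ (x + 2) ^ (x + 2) := Real.rpow_le_rpow_of_exponent_le h4 h3
    _ = _ := by rw [Real.rpow_def_of_pos (by linarith), mul_comm]

theorem norm_Gammaℝ_le {s : ℂ} (hs : 1 / 2 ≤ s.re) {X : ℝ} (hX : 1 ≤ X) (hsX : s.re ≤ X) :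
    ‖s.Gammaℝ‖ ≤ 4 * Real.exp (3 * X * Real.log (3 * X)) := by
  set x := s.re / 2 with hx
  have hx4 : 1 / 4 ≤ x := by rw [hx]; linarith
  have hre : (s / 2).re = x := by simp [hx]
  have h1 : ‖s.Gammaℝ‖ ≤ Real.Gamma x := by
    rw [Complex.Gammaℝ_def, norm_mul,
      Complex.norm_cpow_eq_rpow_re_of_pos Real.pi_pos]
    have h2 := Complex.norm_Gamma_le_Gamma_re (s := s / 2) (by rw [hre]; linarith)
    rw [hre] at h2
    have h3 : Real.pi ^ (-s / 2).re ≤ 1 := by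
      refine Real.rpow_le_one_of_one_le_of_nonpos (by linarith [Real.pi_gt_three]) ?_
      have : (-s / 2).re = -x := by simp [hx]; ring
      rw [this]; linarith
    calc _ ≤ 1 * Real.Gamma x := mul_le_mul h3 h2 (norm_nonneg _) zero_le_one
      _ = _ := one_mul _
  have h2 : Real.Gamma (x + 2) = (x + 1) * (x * Real.Gamma x) := by
    rw [← Real.Gamma_add_one (by linarith), ← Real.Gamma_add_one (by linarith)]
    ring_nf
  have hG : 0 < Real.Gamma x := Real.Gamma_pos_of_pos (by linarith)
  -- The constant 4 comes from x(x + 1) ≥ x ≥ 1/4.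
  have h3 : Real.Gamma x ≤ 4 * Real.Gamma (x + 2) := by
    rw [h2]
    nlinarith [mul_nonneg (mul_nonneg (sub_nonneg.2 hx4) (by linarith : (0 : ℝ) ≤ x)) hG.le]
  have h4 : x + 2 ≤ 3 * X := by rw [hx]; linarith
  have h5 : (x + 2) * Real.log (x + 2) ≤ 3 * X * Real.log (3 * X) :=
    mul_le_mul h4 (Real.log_le_log (by linarith) h4) (Real.log_nonneg (by linarith)) (by linarith)
  calc ‖s.Gammaℝ‖ ≤ 4 * Real.Gamma (x + 2) := h1.trans h3
    _ ≤ 4 * Real.exp ((x + 2) * Real.log (x + 2)) := by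
        gcongr; exact Real.Gamma_add_two_le_exp (by linarith)
    _ ≤ _ := by gcongr

/-- `ξ` has order at most one. -/
theorem exists_norm_riemannXi_le {p : ℝ} (hp : 1 < p) :
    ∃ C : ℝ, 0 < C ∧ ∀ t : ℂ, ‖riemannXi (1 / 2 + t)‖ ≤ Real.exp (C * (1 + ‖t‖) ^ p) := by
  -- 15 = 12 + 3: the numerical factor 12 is at most e^12, and X³ ≤ e^(3X). The last term comes from
  -- log y ≤ y^(p-1)/(p-1) at y = 3X in the Gamma bound.
  set C : ℝ := 15 + 3 * (3 ^ (p - 1) / (p - 1)) with hC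
  have hp0 : 0 < p - 1 := by linarith
  have hC0 : 0 < C := by positivity
  have key : ∀ t : ℂ, 0 ≤ t.re → ‖riemannXi (1 / 2 + t)‖ ≤ Real.exp (C * (1 + ‖t‖) ^ p) := by
    intro t ht
    set X := 1 + ‖t‖
    have hX1 : 1 ≤ X := by simp [X]
    have hhalf : ‖(1 / 2 : ℂ)‖ = 1 / 2 := by norm_num
    have hs : ‖1 / 2 + t‖ ≤ X := by
      refine (norm_add_le _ _).trans ?_
      rw [hhalf]; simp only [X]; linarith
    have hs1 : ‖1 / 2 + t - 1‖ ≤ X := by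
      rw [show 1 / 2 + t - 1 = t - 1 / 2 by ring]
      refine (norm_sub_le _ _).trans ?_
      rw [hhalf]; simp only [X]; linarith
    have hre : 1 / 2 ≤ (1 / 2 + t).re := by
      simp; linarith
    have hz := norm_riemannZeta₁_le hre
    have hG := norm_Gammaℝ_le hre hX1 ((Complex.re_le_norm _).trans hs)
    have hz' : ‖riemannZeta₁ (1 / 2 + t)‖ ≤ 3 * X ^ 2 := by
      refine hz.trans ?_
      have : ‖1 / 2 + t‖ * ‖1 / 2 + t - 1‖ ≤ X * X :=
        mul_le_mul hs hs1 (norm_nonneg _) (by linarith)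
      nlinarith
    rw [riemannXi_eq_of_re_pos (by linarith), norm_mul, norm_mul]
    have hX0 : 0 < X := by linarith
    have hXp : X ≤ X ^ p := by
      conv_lhs => rw [← Real.rpow_one X]
      exact Real.rpow_le_rpow_of_exponent_le hX1 hp.le
    have hlog : 3 * X * Real.log (3 * X) ≤ 3 * (3 ^ (p - 1) / (p - 1)) * X ^ p := by
      have h1 := Real.log_le_rpow_div (x := 3 * X) (by linarith) hp0
      have h2 : X ^ p = X * X ^ (p - 1) := by
        rw [← Real.rpow_one_add' hX0.le (by linarith)]; congr 1; ring
      calc 3 * X * Real.log (3 * X) ≤ 3 * X * ((3 * X) ^ (p - 1) / (p - 1)) := by gcongr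
        _ = _ := by rw [h2, Real.mul_rpow (by norm_num) hX0.le]; ring
    have he12 : (12 : ℝ) ≤ Real.exp 12 := by linarith [Real.add_one_le_exp (12 : ℝ)]
    have heX : X ^ 3 ≤ Real.exp (3 * X) := by
      have : X ≤ Real.exp X := by linarith [Real.add_one_le_exp X]
      calc X ^ 3 ≤ Real.exp X ^ 3 := by gcongr
        _ = _ := by rw [← Real.exp_nat_mul]; norm_num
    calc ‖1 / 2 + t‖ * ‖riemannZeta₁ (1 / 2 + t)‖ * ‖(1 / 2 + t).Gammaℝ‖
        ≤ X * (3 * X ^ 2) * (4 * Real.exp (3 * X * Real.log (3 * X))) := by gcongr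
      _ = 12 * X ^ 3 * Real.exp (3 * X * Real.log (3 * X)) := by ring
      _ ≤ Real.exp 12 * Real.exp (3 * X) * Real.exp (3 * (3 ^ (p - 1) / (p - 1)) * X ^ p) := by
          gcongr
      _ = Real.exp (12 + 3 * X + 3 * (3 ^ (p - 1) / (p - 1)) * X ^ p) := by
          rw [Real.exp_add, Real.exp_add]
      _ ≤ _ := by
          rw [Real.exp_le_exp, hC, add_mul]
          linarith
  refine ⟨C, hC0, fun t => ?_⟩
  rcases le_total 0 t.re with h | h
  · exact key t h
  -- The functional equation covers the other half-plane.
  · have := key (-t) (by simpa using h)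
    rwa [norm_neg, ← riemannXi_one_sub, show 1 - (1 / 2 + -t) = 1 / 2 + t by ring] at this

/-! ### The zeros ±iτ and the partial fraction expansion of (ξ'/ξ)'. -/

/-- `ξ` centred at the symmetry point `1/2`. -/
noncomputable def xiCentered (t : ℂ) : ℂ := riemannXi (1 / 2 + t)

theorem differentiable_xiCentered : Differentiable ℂ xiCentered :=
  differentiable_riemannXi.comp (by fun_prop : Differentiable ℂ fun t : ℂ => 1 / 2 + t)

theorem xiCentered_neg (t : ℂ) : xiCentered (-t) = xiCentered t := by
  rw [xiCentered, ← riemannXi_one_sub, xiCentered]; congr 1; ring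

theorem xiCentered_ofReal_ne_zero (x : ℝ) : xiCentered x ≠ 0 := fun h =>
  im_ne_zero_of_riemannXi_eq_zero h (by simp)

theorem xiCentered_zero_ne_zero : xiCentered 0 ≠ 0 := by
  simpa using xiCentered_ofReal_ne_zero 0

theorem riemannXi_eventuallyEq_of_im_ne_zero {s : ℂ} (hs : s.im ≠ 0) :
    riemannXi =ᶠ[𝓝 s] (fun s => s * (s - 1) * s.Gammaℝ) * riemannZeta := by
  have hU : {s : ℂ | s.im ≠ 0} ∈ 𝓝 s :=
    (isOpen_ne_fun Complex.continuous_im continuous_const).mem_nhds hs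
  filter_upwards [hU] with z hz
  refine riemannXi_eq_mul_Gammaℝ_mul_riemannZeta ?_ ?_ ?_
  · rintro rfl; simp at hz
  · rintro rfl; simp at hz
  · intro h
    obtain ⟨n, rfl⟩ := Complex.Gammaℝ_eq_zero_iff.1 h
    simp at hz

/-- Off the real axis s(s - 1)Gammaℝ(s) is analytic without zeros, so ξ and ζ have the same
multiplicities there. -/
theorem analyticOrderAt_riemannXi_of_im_ne_zero {s : ℂ} (hs : s.im ≠ 0) :
    analyticOrderAt riemannXi s = analyticOrderAt riemannZeta s := by
  have h0 : s ≠ 0 := by rintro rfl; simp at hs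
  have h1 : s ≠ 1 := by rintro rfl; simp at hs
  have hG : s.Gammaℝ ≠ 0 := by
    intro h
    obtain ⟨n, rfl⟩ := Complex.Gammaℝ_eq_zero_iff.1 h
    simp at hs
  have hGA : AnalyticAt ℂ Complex.Gammaℝ s := by
    have := (Complex.differentiable_Gammaℝ_inv.analyticAt s).inv (inv_ne_zero hG)
    have e : Complex.Gammaℝ = (fun s : ℂ => s.Gammaℝ⁻¹)⁻¹ := by ext z; simp
    rwa [e]
  have hA : AnalyticAt ℂ (fun s : ℂ => s * (s - 1) * s.Gammaℝ) s := by fun_prop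
  have hZ : AnalyticAt ℂ riemannZeta s := analyticOn_riemannZeta s h1
  rw [analyticOrderAt_congr (riemannXi_eventuallyEq_of_im_ne_zero hs), analyticOrderAt_mul hA hZ,
    hA.analyticOrderAt_eq_zero.2 (mul_ne_zero (mul_ne_zero h0 (sub_ne_zero.2 h1)) hG), zero_add]

theorem riemannXi_eq_zero_iff_of_im_ne_zero {s : ℂ} (hs : s.im ≠ 0) :
    riemannXi s = 0 ↔ riemannZeta s = 0 := by
  have h0 : s ≠ 0 := by rintro rfl; simp at hs
  have h1 : s ≠ 1 := by rintro rfl; simp at hs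
  have hG : s.Gammaℝ ≠ 0 := by
    intro h
    obtain ⟨n, rfl⟩ := Complex.Gammaℝ_eq_zero_iff.1 h
    simp at hs
  rw [riemannXi_eq_mul_Gammaℝ_mul_riemannZeta h0 h1 hG]
  simp [h0, sub_ne_zero.2 h1, hG]

theorem mem_zetaZeroParam_iff {τ : ℂ} :
    τ ∈ zetaZeroParam ↔ 0 < τ.re ∧ xiCentered (Complex.I * τ) = 0 := by
  refine and_congr_right fun h => ?_
  rw [xiCentered, riemannXi_eq_zero_iff_of_im_ne_zero]
  simpa using h.ne'

theorem xiCentered_I_mul (τ : zetaZeroParam) : xiCentered (Complex.I * τ) = 0 :=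
  (mem_zetaZeroParam_iff.1 τ.2).2

theorem re_pos_of_zetaZeroParam (τ : zetaZeroParam) : 0 < (τ : ℂ).re := τ.2.1

theorem ne_zero_of_zetaZeroParam (τ : zetaZeroParam) : (τ : ℂ) ≠ 0 := by
  intro h
  have := re_pos_of_zetaZeroParam τ
  simp [h] at this

theorem abs_im_lt_of_zetaZeroParam (τ : zetaZeroParam) : |(τ : ℂ).im| < 1 / 2 := by
  have := re_mem_Ioo_of_riemannXi_eq_zero (xiCentered_I_mul τ)
  simp at this
  rw [abs_lt]
  constructor <;> linarith

theorem analyticOrderNatAt_xiCentered_I_mul (τ : zetaZeroParam) :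
    analyticOrderNatAt xiCentered (Complex.I * τ) = zetaZeroMult τ := by
  have h1 : xiCentered = riemannXi ∘ fun t => 1 / 2 + t := rfl
  have hd : deriv (fun t : ℂ => 1 / 2 + t) (Complex.I * τ) ≠ 0 := by simp
  rw [analyticOrderNatAt, h1, analyticOrderAt_comp_of_deriv_ne_zero (by fun_prop) hd,
    analyticOrderAt_riemannXi_of_im_ne_zero]
  · rfl
  · simpa using (re_pos_of_zetaZeroParam τ).ne'

theorem analyticOrderNatAt_xiCentered_neg (z : ℂ) :
    analyticOrderNatAt xiCentered (-z) = analyticOrderNatAt xiCentered z := by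
  have h1 : xiCentered = xiCentered ∘ fun t => -t := by
    ext t; simp [xiCentered_neg]
  have hd : deriv (fun t : ℂ => -t) z ≠ 0 := by simp
  conv_rhs => rw [h1]
  rw [analyticOrderNatAt, analyticOrderNatAt, analyticOrderAt_comp_of_deriv_ne_zero (by fun_prop) hd]

/-- The numbers `τ` lie in a sector that is strictly smaller than the right half-plane, away
from the origin. -/
theorem exists_mul_norm_le_re_of_zetaZeroParam :
    ∃ δ κ : ℝ, 0 < δ ∧ 0 < κ ∧ ∀ τ : zetaZeroParam, δ ≤ (τ : ℂ).re ∧ κ * ‖(τ : ℂ)‖ ≤ (τ : ℂ).re := by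
  obtain ⟨δ, hδ, h⟩ := exists_le_abs_im_of_riemannXi_eq_zero
  -- From |Im τ| < 1/2 and Re τ ≥ δ: |τ| ≤ Re τ + 1/2 ≤ (1 + 1/(2δ)) Re τ.
  refine ⟨δ, (1 + 1 / (2 * δ))⁻¹, hδ, by positivity, fun τ => ?_⟩
  have hre := re_pos_of_zetaZeroParam τ
  have h1 : δ ≤ (τ : ℂ).re := by
    have := h _ (xiCentered_I_mul τ)
    simpa [abs_of_pos hre] using this
  refine ⟨h1, ?_⟩
  rw [inv_mul_le_iff₀ (by positivity)]
  have h2 := Complex.norm_le_abs_re_add_abs_im (τ : ℂ)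
  have h3 := abs_im_lt_of_zetaZeroParam τ
  rw [abs_of_pos hre] at h2
  have h4 : 1 / 2 ≤ 1 / (2 * δ) * (τ : ℂ).re := by
    rw [div_mul_eq_mul_div, one_mul, div_le_div_iff₀ (by norm_num) (by positivity)]
    linarith
  linarith

theorem finite_zetaZeroParam_norm_le (R : ℝ) : {τ : zetaZeroParam | ‖(τ : ℂ)‖ ≤ R}.Finite := by
  have h := (isCompact_closedBall (1 / 2 : ℂ) R).inter_riemannZetaZeros_finite
  refine Set.Finite.of_finite_image (f := fun τ : zetaZeroParam => 1 / 2 + Complex.I * (τ : ℂ))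
    (h.subset ?_) ?_
  · rintro _ ⟨τ, hτ, rfl⟩
    refine ⟨?_, τ.2.2⟩
    simpa using hτ
  · intro a _ b _ hab
    have : Complex.I * (a : ℂ) = Complex.I * b := add_left_cancel hab
    exact Subtype.ext (mul_left_cancel₀ Complex.I_ne_zero this)

/-- The finite set of the `τ` of modulus at most `R`. -/
noncomputable def zetaZeroParamFinset (R : ℝ) : Finset zetaZeroParam :=
  (finite_zetaZeroParam_norm_le R).toFinset

theorem mem_zetaZeroParamFinset {R : ℝ} {τ : zetaZeroParam} :
    τ ∈ zetaZeroParamFinset R ↔ ‖(τ : ℂ)‖ ≤ R := by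
  simp [zetaZeroParamFinset]

open Classical in
/-- The zeros of `ξ(1/2 + t)` of modulus at most `R`. -/
noncomputable def xiZeroFinset (R : ℝ) : Finset ℂ :=
  (zetaZeroParamFinset R).image (fun τ : zetaZeroParam => Complex.I * (τ : ℂ)) ∪
    (zetaZeroParamFinset R).image (fun τ : zetaZeroParam => -(Complex.I * (τ : ℂ)))

theorem mem_xiZeroFinset {R : ℝ} {z : ℂ} :
    z ∈ xiZeroFinset R ↔ ‖z‖ ≤ R ∧ xiCentered z = 0 := by
  classical
  simp only [xiZeroFinset, Finset.mem_union, Finset.mem_image, mem_zetaZeroParamFinset]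
  constructor
  · rintro (⟨τ, hτ, rfl⟩ | ⟨τ, hτ, rfl⟩)
    · exact ⟨by simpa using hτ, xiCentered_I_mul τ⟩
    · exact ⟨by simpa using hτ, by rw [xiCentered_neg, xiCentered_I_mul τ]⟩
  · rintro ⟨hz, h0⟩
    have him : z.im ≠ 0 := by
      have := im_ne_zero_of_riemannXi_eq_zero h0
      simpa using this
    -- A zero z below the real axis is -iτ with τ = iz; one above is iτ with τ = -iz.
    rcases him.lt_or_gt with h | h
    · right
      refine ⟨⟨Complex.I * z, mem_zetaZeroParam_iff.2 ⟨by simpa using h, ?_⟩⟩, by simpa using hz, ?_⟩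
      · rw [← mul_assoc, Complex.I_mul_I, neg_one_mul, xiCentered_neg, h0]
      · simp [← mul_assoc]
    · left
      refine ⟨⟨-(Complex.I * z), mem_zetaZeroParam_iff.2 ⟨by simpa using h, ?_⟩⟩,
        by simpa using hz, ?_⟩
      · rw [mul_neg, ← mul_assoc, Complex.I_mul_I, neg_one_mul, neg_neg, h0]
      · simp [← mul_assoc]

theorem sum_xiZeroFinset {M : Type*} [AddCommMonoid M] (R : ℝ) (g : ℂ → M) :
    ∑ z ∈ xiZeroFinset R, g z =
      ∑ τ ∈ zetaZeroParamFinset R, (g (Complex.I * τ) + g (-(Complex.I * τ))) := by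
  classical
  have hinj : Function.Injective fun τ : zetaZeroParam => Complex.I * (τ : ℂ) := fun a b hab =>
    Subtype.ext (mul_left_cancel₀ Complex.I_ne_zero hab)
  rw [xiZeroFinset, Finset.sum_union, Finset.sum_image hinj.injOn,
    Finset.sum_image (f := g) (g := fun τ : zetaZeroParam => -(Complex.I * (τ : ℂ)))
      (fun a _ b _ hab => hinj (neg_injective hab)), Finset.sum_add_distrib]
  rw [Finset.disjoint_left]
  intro z h1 h2
  obtain ⟨a, -, rfl⟩ := Finset.mem_image.1 h1
  obtain ⟨b, -, hb⟩ := Finset.mem_image.1 h2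
  have ha := re_pos_of_zetaZeroParam a
  have hb' := re_pos_of_zetaZeroParam b
  have := congrArg Complex.im hb
  simp at this
  linarith

theorem exists_norm_xiCentered_le {p : ℝ} (hp : 1 < p) :
    ∃ C : ℝ, 0 < C ∧ ∀ R : ℝ, 1 ≤ R → ∀ z : ℂ, ‖z‖ ≤ 4 * R →
      ‖xiCentered z‖ ≤ ‖xiCentered 0‖ * Real.exp (C * R ^ p) := by
  obtain ⟨C, hC, h⟩ := exists_norm_riemannXi_le hp
  have h0 := norm_pos_iff.2 xiCentered_zero_ne_zero
  set l := Real.log ‖xiCentered 0‖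
  -- 5^p arises from 1 + 4R ≤ 5R; |l| pays for normalising by the value at 0.
  refine ⟨C * 5 ^ p + |l|, by positivity, fun R hR z hz => ?_⟩
  have h1 : (1 + ‖z‖) ^ p ≤ 5 ^ p * R ^ p := by
    rw [← Real.mul_rpow (by norm_num) (by linarith)]
    exact Real.rpow_le_rpow (by positivity) (by linarith) (by linarith)
  have h2 : (1 : ℝ) ≤ R ^ p := Real.one_le_rpow hR (by linarith)
  calc ‖xiCentered z‖ ≤ Real.exp (C * (1 + ‖z‖) ^ p) := h z
    _ ≤ Real.exp (l + (C * 5 ^ p + |l|) * R ^ p) := by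
        rw [Real.exp_le_exp]
        have h3 : C * (1 + ‖z‖) ^ p ≤ C * (5 ^ p * R ^ p) := by gcongr
        have h4 : -l ≤ |l| := neg_le_abs l
        nlinarith [abs_nonneg l]
    _ = _ := by rw [Real.exp_add, Real.exp_log h0]

/-- The approximate partial fractions with L = C R^p. The error R^(p-2) tends to 0 as soon as p < 2,
which is where order one enters. -/
theorem exists_sum_zetaZeroMult_le {p : ℝ} (hp : 1 < p) :
    ∃ C : ℝ, 0 < C ∧ ∀ R : ℝ, 1 ≤ R →
      (∑ τ ∈ zetaZeroParamFinset R, (zetaZeroMult τ : ℝ) ≤ C * R ^ p) ∧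
      ∀ t : ℂ, ‖t‖ ≤ R / 4 → xiCentered t ≠ 0 →
        ‖deriv (logDeriv xiCentered) t + ∑ τ ∈ zetaZeroParamFinset R, (zetaZeroMult τ : ℂ) *
          (1 / (t - Complex.I * τ) ^ 2 + 1 / (t + Complex.I * τ) ^ 2)‖ ≤ C * R ^ (p - 2) := by
  obtain ⟨C, hC, h⟩ := exists_norm_xiCentered_le hp
  refine ⟨64 * C, by positivity, fun R hR => ?_⟩
  have hR0 : 0 < R := by linarith
  obtain ⟨h1, h2⟩ := sum_order_le_and_norm_deriv_logDeriv_add_sum_le differentiable_xiCentered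
    xiCentered_zero_ne_zero hR0 (L := C * R ^ p) (by positivity) (h R hR)
    (fun z => mem_xiZeroFinset)
  rw [sum_xiZeroFinset] at h1
  have hRp : 0 ≤ C * R ^ p := by positivity
  constructor
  · calc ∑ τ ∈ zetaZeroParamFinset R, (zetaZeroMult τ : ℝ)
        ≤ ∑ τ ∈ zetaZeroParamFinset R, ((analyticOrderNatAt xiCentered (Complex.I * τ) : ℝ) +
            (analyticOrderNatAt xiCentered (-(Complex.I * τ)) : ℝ)) := by
          refine Finset.sum_le_sum fun τ _ => ?_
          rw [analyticOrderNatAt_xiCentered_I_mul]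
          exact le_add_of_nonneg_right (Nat.cast_nonneg _)
      _ ≤ C * R ^ p := h1
      _ ≤ _ := by linarith
  · intro t ht hft
    have h3 := h2 t ht hft
    rw [sum_xiZeroFinset] at h3
    convert h3 using 2
    · congr 1
      refine Finset.sum_congr rfl fun τ _ => ?_
      rw [analyticOrderNatAt_xiCentered_neg, analyticOrderNatAt_xiCentered_I_mul, sub_neg_eq_add]
      ring
    · rw [Real.rpow_sub hR0, Real.rpow_ofNat]
      ring

theorem summable_zetaZeroMult_mul_norm_rpow {p : ℝ} (hp : 1 < p) :
    Summable fun τ : zetaZeroParam => (zetaZeroMult τ : ℝ) * ‖(τ : ℂ)‖ ^ (-p) := by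
  obtain ⟨q, hq1, hqp⟩ := exists_between hp
  obtain ⟨C, hC, h⟩ := exists_sum_zetaZeroMult_le hq1
  obtain ⟨δ, κ, hδ, -, hδκ⟩ := exists_mul_norm_le_re_of_zetaZeroParam
  refine summable_mul_rpow_neg_of_count_le hδ
    (fun τ => (hδκ τ).1.trans (Complex.re_le_norm _)) (by linarith) hqp hC.le fun R hR F hF => ?_
  refine le_trans (Finset.sum_le_sum_of_subset_of_nonneg (fun τ hτ => ?_)
    fun _ _ _ => Nat.cast_nonneg _) (h R hR).1
  exact mem_zetaZeroParamFinset.2 (hF τ hτ)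

/-- The points ±iτ stay in a sector about the imaginary axis, so |t ± iτ| ≥ κ|τ|. With t ≤ |t ± iτ|
+ |τ| this gives t + |τ| ≤ (1 + 2/κ)|t ± iτ|. -/
theorem exists_mul_add_norm_le_norm_add_I_mul :
    ∃ κ : ℝ, 0 < κ ∧ ∀ τ : zetaZeroParam, ∀ t : ℝ, 0 ≤ t →
      κ * (t + ‖(τ : ℂ)‖) ≤ ‖t - Complex.I * τ‖ ∧ κ * (t + ‖(τ : ℂ)‖) ≤ ‖t + Complex.I * τ‖ := by
  obtain ⟨δ, κ, hδ, hκ, h⟩ := exists_mul_norm_le_re_of_zetaZeroParam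
  refine ⟨(1 + 2 / κ)⁻¹, by positivity, fun τ t ht => ?_⟩
  have key : ∀ w : ℂ, ‖w‖ = ‖(τ : ℂ)‖ → |w.im| = (τ : ℂ).re →
      (1 + 2 / κ)⁻¹ * (t + ‖(τ : ℂ)‖) ≤ ‖t + w‖ := by
    intro w hw hwi
    rw [inv_mul_le_iff₀ (by positivity)]
    have h1 : κ * ‖(τ : ℂ)‖ ≤ ‖t + w‖ := by
      refine (h τ).2.trans ?_
      rw [← hwi]
      simpa using Complex.abs_im_le_norm (t + w)
    have h2 : t ≤ ‖t + w‖ + ‖(τ : ℂ)‖ := by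
      have := norm_sub_le ((t : ℂ) + w) w
      rw [add_sub_cancel_right, Complex.norm_real, Real.norm_of_nonneg ht, hw] at this
      exact this
    have h3 : ‖(τ : ℂ)‖ ≤ ‖t + w‖ / κ := by rw [le_div_iff₀ hκ]; linarith
    calc t + ‖(τ : ℂ)‖ ≤ ‖t + w‖ + 2 * (‖t + w‖ / κ) := by linarith
      _ = _ := by ring
  have hre := abs_of_pos (re_pos_of_zetaZeroParam τ)
  constructor
  · rw [sub_eq_add_neg]
    exact key _ (by simp) (by simpa using hre)
  · exact key _ (by simp) (by simpa using hre)

theorem exists_norm_xi_summand_le :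
    ∃ K : ℝ, 0 < K ∧ ∀ τ : zetaZeroParam, ∀ t : ℝ, 0 ≤ t →
      ‖1 / (t - Complex.I * τ) ^ 2‖ ≤ K / (t + ‖(τ : ℂ)‖) ^ 2 ∧
      ‖1 / (t + Complex.I * τ) ^ 2‖ ≤ K / (t + ‖(τ : ℂ)‖) ^ 2 := by
  obtain ⟨κ, hκ, h⟩ := exists_mul_add_norm_le_norm_add_I_mul
  refine ⟨1 / κ ^ 2, by positivity, fun τ t ht => ?_⟩
  have hτ : 0 < ‖(τ : ℂ)‖ := norm_pos_iff.2 (ne_zero_of_zetaZeroParam τ)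
  have key : ∀ w : ℂ, κ * (t + ‖(τ : ℂ)‖) ≤ ‖w‖ →
      ‖1 / w ^ 2‖ ≤ 1 / κ ^ 2 / (t + ‖(τ : ℂ)‖) ^ 2 := by
    intro w hw
    rw [norm_div, norm_one, norm_pow, div_div, ← mul_pow]
    gcongr
  exact ⟨key _ (h τ t ht).1, key _ (h τ t ht).2⟩

/-- The partial fraction expansion of `(ξ'/ξ)'` at non-negative real `t`. -/
theorem hasSum_xi_summand {t : ℝ} (ht : 0 ≤ t) :
    HasSum (fun τ : zetaZeroParam => (zetaZeroMult τ : ℂ) *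
      (1 / (t - Complex.I * τ) ^ 2 + 1 / (t + Complex.I * τ) ^ 2))
      (-deriv (logDeriv xiCentered) t) := by
  obtain ⟨K, hK, hKb⟩ := exists_norm_xi_summand_le
  have hsum : Summable fun τ : zetaZeroParam => (zetaZeroMult τ : ℂ) *
      (1 / (t - Complex.I * τ) ^ 2 + 1 / (t + Complex.I * τ) ^ 2) := by
    refine Summable.of_norm_bounded
      ((summable_zetaZeroMult_mul_norm_rpow one_lt_two).mul_left (2 * K)) fun τ => ?_
    have hτ : 0 < ‖(τ : ℂ)‖ := norm_pos_iff.2 (ne_zero_of_zetaZeroParam τ)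
    have h1 : K / (t + ‖(τ : ℂ)‖) ^ 2 ≤ K * ‖(τ : ℂ)‖ ^ (-2 : ℝ) := by
      rw [Real.rpow_neg hτ.le, Real.rpow_ofNat, ← div_eq_mul_inv]
      gcongr
      linarith
    rw [norm_mul, Complex.norm_natCast]
    calc _ ≤ (zetaZeroMult τ : ℝ) * (K * ‖(τ : ℂ)‖ ^ (-2 : ℝ) + K * ‖(τ : ℂ)‖ ^ (-2 : ℝ)) := by
          gcongr
          exact (norm_add_le _ _).trans (add_le_add ((hKb τ t ht).1.trans h1)
            ((hKb τ t ht).2.trans h1))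
      _ = _ := by ring
  have hT : Tendsto (fun n : ℕ => zetaZeroParamFinset n) atTop atTop := by
    refine tendsto_atTop_finset_of_monotone (fun a b hab τ hτ => ?_) fun τ => ?_
    · rw [mem_zetaZeroParamFinset] at hτ ⊢
      exact hτ.trans (by exact_mod_cast hab)
    · obtain ⟨n, hn⟩ := exists_nat_ge ‖(τ : ℂ)‖
      exact ⟨n, mem_zetaZeroParamFinset.2 hn⟩
  have hlim := hsum.hasSum.comp hT
  -- With p = 3/2 the error over the zeros of modulus at most n is O(n^(-1/2)), which identifies the
  -- limit of the partial sums.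
  obtain ⟨C, hC, h⟩ := exists_sum_zetaZeroMult_le (p := 3 / 2) (by norm_num)
  have hzero : Tendsto (fun n : ℕ => deriv (logDeriv xiCentered) t +
      ∑ τ ∈ zetaZeroParamFinset n, (zetaZeroMult τ : ℂ) *
        (1 / (t - Complex.I * τ) ^ 2 + 1 / (t + Complex.I * τ) ^ 2)) atTop (𝓝 0) := by
    have h0 : Tendsto (fun n : ℕ => C * (n : ℝ) ^ (3 / 2 - 2 : ℝ)) atTop (𝓝 0) := by
      have := (tendsto_rpow_neg_atTop (y := 1 / 2) (by norm_num)).comp tendsto_natCast_atTop_atTop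
      have h2 := this.const_mul C
      rw [mul_zero] at h2
      refine h2.congr fun n => ?_
      norm_num
    refine squeeze_zero_norm' ?_ h0
    obtain ⟨n₀, hn₀⟩ := exists_nat_ge (4 * t + 1)
    filter_upwards [eventually_ge_atTop n₀] with n hn
    have hn' : 4 * t + 1 ≤ n := hn₀.trans (by exact_mod_cast hn)
    refine (h n (by linarith)).2 t ?_ (xiCentered_ofReal_ne_zero t)
    rw [Complex.norm_real, Real.norm_of_nonneg ht]
    linarith
  have h2 := (hlim.const_add (deriv (logDeriv xiCentered) t))
  have h3 := tendsto_nhds_unique h2 hzero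
  rw [← eq_neg_of_add_eq_zero_right h3]
  exact hsum.hasSum

/-! ### Mellin transforms of 1/(t + w) and 1/(t + w)². -/

/-- The distance from w₀ to the cut bounds |t + w₀| below, and the triangle inequality adds growth
in t. The bound must be uniform near w₀ to justify differentiation under the integral. -/
theorem exists_ball_mul_one_add_le_norm_add {w₀ : ℂ} (hw : w₀ ∈ Complex.slitPlane) :
    ∃ c : ℝ, 0 < c ∧ ∀ w ∈ Metric.ball w₀ c, ∀ t : ℝ, 0 ≤ t → c * (1 + t) ≤ ‖t + w‖ := by
  obtain ⟨d, hd, hball⟩ := Metric.isOpen_iff.1 Complex.isOpen_slitPlane w₀ hw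
  have h0 : ∀ t : ℝ, 0 ≤ t → d ≤ ‖t + w₀‖ := by
    intro t ht
    by_contra! h
    have hmem : (-t : ℂ) ∈ Metric.ball w₀ d := by
      rw [Metric.mem_ball, dist_eq_norm, ← norm_neg]
      rwa [show -((-t : ℂ) - w₀) = t + w₀ by ring]
    have := hball hmem
    rw [Complex.mem_slitPlane_iff] at this
    simp at this
    linarith
  set b : ℝ := (1 + (‖w₀‖ + 1) / d)⁻¹ with hb
  have hb0 : 0 < b := by positivity
  have h1 : ∀ t : ℝ, 0 ≤ t → b * (1 + t) ≤ ‖t + w₀‖ := by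
    intro t ht
    rw [hb, inv_mul_le_iff₀ (by positivity)]
    have h2 : t ≤ ‖t + w₀‖ + ‖w₀‖ := by
      have := norm_sub_le ((t : ℂ) + w₀) w₀
      rwa [add_sub_cancel_right, Complex.norm_real, Real.norm_of_nonneg ht] at this
    have h3 : 1 ≤ ‖t + w₀‖ / d := by rw [le_div_iff₀ hd, one_mul]; exact h0 t ht
    have h4 : (‖w₀‖ + 1) * 1 ≤ (‖w₀‖ + 1) * (‖t + w₀‖ / d) := by gcongr
    calc 1 + t ≤ ‖t + w₀‖ + (‖w₀‖ + 1) * (‖t + w₀‖ / d) := by linarith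
      _ = _ := by ring
  refine ⟨b / 2, by positivity, fun w hwb t ht => ?_⟩
  have h2 : ‖w₀ - w‖ < b / 2 := by rwa [← dist_eq_norm, dist_comm]
  have h3 : ‖t + w₀‖ ≤ ‖t + w‖ + ‖w₀ - w‖ := by
    refine le_trans (le_of_eq ?_) (norm_add_le _ _)
    congr 1; ring
  have := h1 t ht
  nlinarith

theorem integrableOn_rpow_mul_one_add_pow_inv {x : ℝ} {n : ℕ} (hx : 0 < x) (hxn : x < n) :
    IntegrableOn (fun t : ℝ => t ^ (x - 1) * ((1 + t) ^ n)⁻¹) (Set.Ioi 0) := by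
  have hcont : ContinuousOn (fun t : ℝ => ((1 + t) ^ n)⁻¹) (Set.Ioi 0) := by
    refine ContinuousOn.inv₀ (by fun_prop) fun t ht => ?_
    have : (0 : ℝ) < t := ht
    positivity
  refine mellin_convergent_of_isBigO_scalar (a := n) (b := 0)
    (hcont.locallyIntegrableOn measurableSet_Ioi) ?_ hxn ?_ hx
  · refine Asymptotics.IsBigO.of_bound 1 ?_
    filter_upwards [eventually_gt_atTop 0] with t ht
    rw [one_mul, Real.norm_of_nonneg (by positivity), Real.norm_of_nonneg (by positivity),
      Real.rpow_neg ht.le, Real.rpow_natCast]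
    gcongr
    linarith
  · refine Asymptotics.IsBigO.of_bound 1 ?_
    filter_upwards [self_mem_nhdsWithin] with t ht
    have ht0 : (0 : ℝ) < t := ht
    rw [Real.norm_of_nonneg (by positivity)]
    simp only [neg_zero, Real.rpow_zero, norm_one, mul_one]
    exact inv_le_one_of_one_le₀ (one_le_pow₀ (by linarith))

theorem norm_cpow_div_add_pow_le {a w : ℂ} {c : ℝ} {n : ℕ} (hc : 0 < c) {t : ℝ} (ht : 0 < t)
    (h : c * (1 + t) ≤ ‖t + w‖) :
    ‖(t : ℂ) ^ (a - 1) / (t + w) ^ n‖ ≤ (c ^ n)⁻¹ * (t ^ (a.re - 1) * ((1 + t) ^ n)⁻¹) := by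
  rw [norm_div, norm_pow, Complex.norm_cpow_eq_rpow_re_of_pos ht]
  have : (c * (1 + t)) ^ n ≤ ‖t + w‖ ^ n := by gcongr
  calc t ^ (a - 1).re / ‖t + w‖ ^ n ≤ t ^ (a - 1).re / (c * (1 + t)) ^ n := by gcongr
    _ = _ := by rw [mul_pow]; simp; field_simp

theorem add_ne_zero_of_mem_slitPlane {w : ℂ} (hw : w ∈ Complex.slitPlane) {t : ℝ} (ht : 0 ≤ t) :
    (t : ℂ) + w ≠ 0 := by
  obtain ⟨c, hc, h⟩ := exists_ball_mul_one_add_le_norm_add hw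
  have := h w (Metric.mem_ball_self hc) t ht
  rw [← norm_pos_iff]
  exact lt_of_lt_of_le (by positivity) this

theorem continuousOn_cpow_div_add_pow {a w : ℂ} (n : ℕ) (hw : w ∈ Complex.slitPlane) :
    ContinuousOn (fun t : ℝ => (t : ℂ) ^ (a - 1) / (t + w) ^ n) (Set.Ioi 0) := by
  intro t ht
  have h1 : ContinuousAt (fun t : ℝ => (t : ℂ) ^ (a - 1)) t :=
    Complex.continuousAt_ofReal_cpow_const _ _ (Or.inr (ne_of_gt ht))
  refine (h1.div (by fun_prop) ?_).continuousWithinAt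
  exact pow_ne_zero _ (add_ne_zero_of_mem_slitPlane hw (le_of_lt ht))

theorem integrableOn_cpow_div_add_pow {a w : ℂ} {n : ℕ} (hw : w ∈ Complex.slitPlane)
    (ha : 0 < a.re) (han : a.re < n) :
    IntegrableOn (fun t : ℝ => (t : ℂ) ^ (a - 1) / (t + w) ^ n) (Set.Ioi 0) := by
  obtain ⟨c, hc, h⟩ := exists_ball_mul_one_add_le_norm_add hw
  refine Integrable.mono' ((integrableOn_rpow_mul_one_add_pow_inv ha han).const_mul (c ^ n)⁻¹)
    ((continuousOn_cpow_div_add_pow n hw).aestronglyMeasurable measurableSet_Ioi) ?_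
  rw [ae_restrict_iff' measurableSet_Ioi]
  exact Eventually.of_forall fun t ht =>
    norm_cpow_div_add_pow_le hc ht (h w (Metric.mem_ball_self hc) t (le_of_lt ht))

theorem hasDerivAt_integral_cpow_div_add {a w : ℂ} (hw : w ∈ Complex.slitPlane)
    (ha : 0 < a.re) (ha1 : a.re < 1) :
    HasDerivAt (fun w : ℂ => ∫ t in Set.Ioi (0 : ℝ), (t : ℂ) ^ (a - 1) / (t + w))
      (-∫ t in Set.Ioi (0 : ℝ), (t : ℂ) ^ (a - 1) / (t + w) ^ 2) w := by
  obtain ⟨c, hc, h⟩ := exists_ball_mul_one_add_le_norm_add hw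
  rw [← integral_neg]
  have hU : Complex.slitPlane ∈ 𝓝 w := Complex.isOpen_slitPlane.mem_nhds hw
  refine (hasDerivAt_integral_of_dominated_loc_of_deriv_le (μ := volume.restrict (Set.Ioi (0 : ℝ)))
    (F := fun (w : ℂ) (t : ℝ) => (t : ℂ) ^ (a - 1) / (t + w))
    (F' := fun (w : ℂ) (t : ℝ) => -((t : ℂ) ^ (a - 1) / (t + w) ^ 2))
    (bound := fun t => (c ^ 2)⁻¹ * (t ^ (a.re - 1) * ((1 + t) ^ 2)⁻¹))
    (Metric.ball_mem_nhds w hc) ?_ ?_ ?_ ?_ ?_ ?_).2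
  · filter_upwards [hU] with z hz
    simpa using (continuousOn_cpow_div_add_pow (a := a) 1 hz).aestronglyMeasurable measurableSet_Ioi
  · simpa [IntegrableOn] using
      integrableOn_cpow_div_add_pow (n := 1) hw ha (by simpa using ha1)
  · exact ((continuousOn_cpow_div_add_pow (a := a) 2 hw).neg).aestronglyMeasurable measurableSet_Ioi
  · rw [ae_restrict_iff' measurableSet_Ioi]
    refine Eventually.of_forall fun t ht z hz => ?_
    rw [norm_neg]
    exact norm_cpow_div_add_pow_le hc ht (h z hz t (le_of_lt ht))
  · exact (integrableOn_rpow_mul_one_add_pow_inv (n := 2) ha (by norm_num; linarith)).const_mul _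
  · rw [ae_restrict_iff' measurableSet_Ioi]
    refine Eventually.of_forall fun t ht z hz => ?_
    have hne : (t : ℂ) + z ≠ 0 := by
      have := h z hz t (le_of_lt ht)
      have ht0 : (0 : ℝ) < t := ht
      rw [← norm_pos_iff]
      exact lt_of_lt_of_le (by positivity) this
    have := (hasDerivAt_const z ((t : ℂ) ^ (a - 1))).div ((hasDerivAt_id z).const_add (t : ℂ)) hne
    exact this.congr_deriv (by simp [neg_div])

/-- Integrate the derivative of t^a / (t + w) over (0, ∞), writing t = (t + w) - w; the boundary
values vanish for 0 < Re a < 1. -/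
theorem integral_cpow_div_add_sq {a w : ℂ} (hw : w ∈ Complex.slitPlane)
    (ha : 0 < a.re) (ha1 : a.re < 1) :
    w * ∫ t in Set.Ioi (0 : ℝ), (t : ℂ) ^ (a - 1) / (t + w) ^ 2 =
      (1 - a) * ∫ t in Set.Ioi (0 : ℝ), (t : ℂ) ^ (a - 1) / (t + w) := by
  have hi1 : IntegrableOn (fun t : ℝ => (t : ℂ) ^ (a - 1) / (t + w)) (Set.Ioi 0) := by
    simpa using integrableOn_cpow_div_add_pow (n := 1) hw ha (by simpa using ha1)
  have hi2 : IntegrableOn (fun t : ℝ => (t : ℂ) ^ (a - 1) / (t + w) ^ 2) (Set.Ioi 0) :=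
    integrableOn_cpow_div_add_pow (n := 2) hw ha (by norm_num; linarith)
  have ha0 : a ≠ 0 := by rintro rfl; simp at ha
  have hder : ∀ t ∈ Set.Ioi (0 : ℝ), HasDerivAt (fun t : ℝ => (t : ℂ) ^ a / (t + w))
      (w * ((t : ℂ) ^ (a - 1) / (t + w) ^ 2) - (1 - a) * ((t : ℂ) ^ (a - 1) / (t + w))) t := by
    intro t ht
    have ht0 : (0 : ℝ) < t := ht
    have hne := add_ne_zero_of_mem_slitPlane hw ht0.le
    have h1 : HasDerivAt (fun z : ℂ => z ^ a) (a * (t : ℂ) ^ (a - 1) * 1) (t : ℂ) :=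
      (hasDerivAt_id (t : ℂ)).cpow_const (Complex.ofReal_mem_slitPlane.2 ht0)
    have h2 := (h1.div ((hasDerivAt_id (t : ℂ)).add_const w) hne).comp_ofReal
    refine h2.congr_deriv ?_
    have h3 : (t : ℂ) ^ a = t * (t : ℂ) ^ (a - 1) := by
      rw [Complex.cpow_sub _ _ (by exact_mod_cast ht0.ne'), Complex.cpow_one]
      have : (t : ℂ) ≠ 0 := by exact_mod_cast ht0.ne'
      field_simp
    simp only [id]
    rw [h3]
    field_simp
    ring
  have hlim : Tendsto (fun t : ℝ => (t : ℂ) ^ a / (t + w)) atTop (𝓝 0) := by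
    obtain ⟨c, hc, h⟩ := exists_ball_mul_one_add_le_norm_add hw
    have h0 : Tendsto (fun t : ℝ => c⁻¹ * t ^ (-(1 - a.re))) atTop (𝓝 0) := by
      simpa using (tendsto_rpow_neg_atTop (y := 1 - a.re) (by linarith)).const_mul c⁻¹
    refine squeeze_zero_norm' ?_ h0
    filter_upwards [eventually_gt_atTop 0] with t ht
    have h1 := h w (Metric.mem_ball_self hc) t ht.le
    rw [norm_div, Complex.norm_cpow_eq_rpow_re_of_pos ht]
    calc t ^ a.re / ‖t + w‖ ≤ t ^ a.re / (c * t) := by gcongr; nlinarith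
      _ = _ := by
        rw [show -(1 - a.re) = a.re - 1 by ring, Real.rpow_sub ht, Real.rpow_one]
        field_simp
  have hmain := integral_Ioi_of_hasDerivAt_of_tendsto (a := 0) (m := 0)
    (f := fun t : ℝ => (t : ℂ) ^ a / (t + w)) ?_ hder
    ((hi2.const_mul w).sub (hi1.const_mul (1 - a))) hlim
  · rw [integral_sub (hi2.const_mul w) (hi1.const_mul (1 - a)), integral_const_mul,
      integral_const_mul] at hmain
    simp only [Complex.ofReal_zero, Complex.zero_cpow ha0, zero_div, sub_zero] at hmain
    exact sub_eq_zero.1 hmain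
  · refine ContinuousAt.continuousWithinAt ?_
    have h1 : ContinuousAt (fun t : ℝ => (t : ℂ) ^ a) 0 :=
      Complex.continuousAt_ofReal_cpow_const _ _ (Or.inl ha)
    exact h1.div (by fun_prop) (by simpa using Complex.slitPlane_ne_zero hw)

/-- The substitution u = t/(1 + t) gives the Beta integral Γ(a)Γ(1 - a), evaluated by the reflection
formula. -/
theorem integral_cpow_div_add_one {a : ℂ} (ha : 0 < a.re) (ha1 : a.re < 1) :
    ∫ t in Set.Ioi (0 : ℝ), (t : ℂ) ^ (a - 1) / (t + 1) =
      Real.pi / Complex.sin (Real.pi * a) := by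
  rw [← Complex.Gamma_mul_Gamma_one_sub,
    Complex.Gamma_mul_Gamma_eq_betaIntegral ha (by simpa using ha1), add_sub_cancel,
    Complex.Gamma_one, one_mul, Complex.betaIntegral, intervalIntegral.integral_of_le zero_le_one,
    integral_Ioc_eq_integral_Ioo]
  have himg : (fun t : ℝ => t / (1 + t)) '' Set.Ioi 0 = Set.Ioo 0 1 := by
    ext x
    constructor
    · rintro ⟨t, ht, rfl⟩
      have ht0 : (0 : ℝ) < t := ht
      exact ⟨by positivity, by rw [div_lt_one (by positivity)]; linarith⟩
    · rintro ⟨h0, h1⟩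
      have : 0 < 1 - x := by linarith
      refine ⟨x / (1 - x), by simpa using div_pos h0 this, ?_⟩
      field_simp
      ring
  have hder : ∀ t ∈ Set.Ioi (0 : ℝ), HasDerivWithinAt (fun t : ℝ => t / (1 + t))
      (1 / (1 + t) ^ 2) (Set.Ioi 0) t := by
    intro t ht
    have ht0 : (0 : ℝ) < t := ht
    have := ((hasDerivAt_id t).div ((hasDerivAt_id t).const_add 1)
      (by simp; positivity)).hasDerivWithinAt (s := Set.Ioi 0)
    refine this.congr_deriv ?_
    simp
  have hinj : Set.InjOn (fun t : ℝ => t / (1 + t)) (Set.Ioi 0) := by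
    intro x hx y hy hxy
    have hx0 : (0 : ℝ) < x := hx
    have hy0 : (0 : ℝ) < y := hy
    simp only at hxy
    rw [div_eq_div_iff (by positivity) (by positivity)] at hxy
    linarith
  rw [← himg, integral_image_eq_integral_abs_deriv_smul measurableSet_Ioi hder hinj]
  refine setIntegral_congr_fun measurableSet_Ioi fun t ht => ?_
  have ht0 : (0 : ℝ) < t := ht
  have h1 : (0 : ℝ) < 1 + t := by linarith
  have h1c : ((1 + t : ℝ) : ℂ) ≠ 0 := by exact_mod_cast h1.ne'
  have e1 : (1 : ℂ) - ((t / (1 + t) : ℝ) : ℂ) = ((1 + t : ℝ) : ℂ)⁻¹ := by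
    push_cast
    push_cast at h1c
    field_simp
    ring
  have e2 : ((t / (1 + t) : ℝ) : ℂ) ^ (a - 1) = (t : ℂ) ^ (a - 1) * (((1 + t : ℝ) : ℂ) ^ (a - 1))⁻¹ := by
    rw [div_eq_mul_inv, Complex.ofReal_mul, Complex.mul_cpow_ofReal_nonneg ht0.le (by positivity),
      Complex.ofReal_inv, Complex.inv_cpow]
    rw [Complex.arg_ofReal_of_nonneg h1.le]
    exact Real.pi_pos.ne
  have e3 : ((1 + t : ℝ) : ℂ)⁻¹ ^ (1 - a - 1) = ((1 + t : ℝ) : ℂ) ^ (a - 1) * ((1 + t : ℝ) : ℂ) := by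
    rw [Complex.inv_cpow, ← Complex.cpow_neg, show -(1 - a - 1) = a - 1 + 1 by ring,
      Complex.cpow_add _ _ h1c, Complex.cpow_one]
    rw [Complex.arg_ofReal_of_nonneg h1.le]
    exact Real.pi_pos.ne
  have h4 : ((1 + t : ℝ) : ℂ) ^ (a - 1) ≠ 0 := by
    rw [Complex.cpow_def_of_ne_zero h1c]; exact Complex.exp_ne_zero _
  rw [e1, e2, e3, abs_of_pos (by positivity), Complex.real_smul]
  have e4 : ((1 / (1 + t) ^ 2 : ℝ) : ℂ) = 1 / ((1 + t : ℝ) : ℂ) ^ 2 := by push_cast; rfl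
  have e5 : (t : ℂ) + 1 = ((1 + t : ℝ) : ℂ) := by push_cast; ring
  rw [e4, e5]
  field_simp

/-- The Mellin transform of `1 / (t + w)`, for `w` in the plane cut along the negative real
axis. -/
theorem integral_cpow_div_add {a w : ℂ} (hw : w ∈ Complex.slitPlane)
    (ha : 0 < a.re) (ha1 : a.re < 1) :
    ∫ t in Set.Ioi (0 : ℝ), (t : ℂ) ^ (a - 1) / (t + w) =
      w ^ (a - 1) * (Real.pi / Complex.sin (Real.pi * a)) := by
  set F : ℂ → ℂ := fun w => ∫ t in Set.Ioi (0 : ℝ), (t : ℂ) ^ (a - 1) / (t + w) with hF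
  -- By the integration by parts above, z^(1-a) F(z) has zero derivative on the connected slit
  -- plane, so its value is the one at z = 1.
  have hder : ∀ z ∈ Complex.slitPlane, HasDerivAt (fun z => z ^ (1 - a) * F z) 0 z := by
    intro z hz
    have hz0 := Complex.slitPlane_ne_zero hz
    have h1 : HasDerivAt (fun z : ℂ => z ^ (1 - a)) ((1 - a) * z ^ (1 - a - 1) * 1) z :=
      (hasDerivAt_id z).cpow_const hz
    refine (h1.mul (hasDerivAt_integral_cpow_div_add hz ha ha1)).congr_deriv ?_
    have h2 := integral_cpow_div_add_sq hz ha ha1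
    have h3 : z ^ (1 - a) = z * z ^ (1 - a - 1) := by
      rw [Complex.cpow_sub _ 1 hz0, Complex.cpow_one]
      field_simp
    rw [h3]
    linear_combination (-z ^ (1 - a - 1)) * h2
  have hconst := Complex.isOpen_slitPlane.is_const_of_deriv_eq_zero
    (f := fun z => z ^ (1 - a) * F z)
    (Complex.starConvex_one_slitPlane.isPathConnected
      Complex.one_mem_slitPlane).isConnected.isPreconnected
    (fun z hz => (hder z hz).differentiableAt.differentiableWithinAt)
    (fun z hz => (hder z hz).deriv) hw Complex.one_mem_slitPlane
  have hF1 : F 1 = Real.pi / Complex.sin (Real.pi * a) := integral_cpow_div_add_one ha ha1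
  simp only [Complex.one_cpow, one_mul, hF1] at hconst
  have hw0 := Complex.slitPlane_ne_zero hw
  change F w = _
  rw [← hconst, ← mul_assoc, ← Complex.cpow_add _ _ hw0]
  simp

/-- The Mellin transform of `1 / (t + w) ^ 2`, for `w` in the plane cut along the negative real
axis. -/
theorem integral_cpow_div_add_sq_eq {a w : ℂ} (hw : w ∈ Complex.slitPlane)
    (ha : 0 < a.re) (ha1 : a.re < 1) :
    ∫ t in Set.Ioi (0 : ℝ), (t : ℂ) ^ (a - 1) / (t + w) ^ 2 =
      w ^ (a - 2) * ((1 - a) * (Real.pi / Complex.sin (Real.pi * a))) := by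
  have hw0 := Complex.slitPlane_ne_zero hw
  have h := integral_cpow_div_add_sq hw ha ha1
  rw [integral_cpow_div_add hw ha ha1] at h
  have h3 : w ^ (a - 1) = w * w ^ (a - 2) := by
    rw [show a - 2 = a - 1 - 1 by ring, Complex.cpow_sub (a - 1) 1 hw0, Complex.cpow_one]
    field_simp
  rw [h3] at h
  apply mul_left_cancel₀ hw0
  rw [h]
  ring

/-- The Mellin transform of `1 / (t + r) ^ 2` for positive `r`, in real form. -/
theorem integral_rpow_div_add_sq_eq {x r : ℝ} (hr : 0 < r) (hx : 0 < x) (hx1 : x < 1) :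
    IntegrableOn (fun t : ℝ => t ^ (x - 1) / (t + r) ^ 2) (Set.Ioi 0) ∧
    ∫ t in Set.Ioi (0 : ℝ), t ^ (x - 1) / (t + r) ^ 2 =
      r ^ (x - 2) * ∫ t in Set.Ioi (0 : ℝ), t ^ (x - 1) / (t + 1) ^ 2 := by
  have hcast : ∀ r : ℝ, ∀ t ∈ Set.Ioi (0 : ℝ), ((t ^ (x - 1) / (t + r) ^ 2 : ℝ) : ℂ) =
      (t : ℂ) ^ ((x : ℂ) - 1) / (t + (r : ℂ)) ^ 2 := by
    intro r t ht
    have ht0 : (0 : ℝ) < t := ht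
    rw [Complex.ofReal_div, Complex.ofReal_cpow ht0.le]
    push_cast
    rfl
  have hI : ∀ r : ℝ, 0 < r → ((∫ t in Set.Ioi (0 : ℝ), t ^ (x - 1) / (t + r) ^ 2 : ℝ) : ℂ) =
      (r : ℂ) ^ ((x : ℂ) - 2) *
        ((1 - x) * (Real.pi / Complex.sin (Real.pi * x))) := by
    intro r hr
    rw [← integral_cpow_div_add_sq_eq (Complex.ofReal_mem_slitPlane.2 hr) (by simpa using hx)
      (by simpa using hx1), ← integral_complex_ofReal]
    exact setIntegral_congr_fun measurableSet_Ioi (hcast r)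
  constructor
  · have h1 := integrableOn_cpow_div_add_pow (a := x) (n := 2) (Complex.ofReal_mem_slitPlane.2 hr)
      (by simpa using hx) (by norm_num; linarith)
    refine IntegrableOn.congr_fun h1.norm (fun t ht => ?_) measurableSet_Ioi
    have ht0 : (0 : ℝ) < t := ht
    rw [← hcast r t ht, Complex.norm_real, Real.norm_of_nonneg (by positivity)]
  · have h1 := hI r hr
    have h2 := hI 1 one_pos
    rw [Complex.ofReal_one, Complex.one_cpow, one_mul] at h2
    rw [← h2] at h1
    have h3 : (r : ℂ) ^ ((x : ℂ) - 2) = ((r ^ (x - 2) : ℝ) : ℂ) := by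
      rw [Complex.ofReal_cpow hr.le]; push_cast; rfl
    rw [h3] at h1
    exact_mod_cast h1

/-! ### The series for the derivative of the digamma function. -/

theorem Real.hasDerivAt_log_Gamma {x : ℝ} (hx : 0 < x) :
    HasDerivAt (Real.log ∘ Real.Gamma) (logDeriv Real.Gamma x) x := by
  have h1 : DifferentiableAt ℝ Real.Gamma x := Real.differentiableAt_Gamma fun m => by
    have : (0 : ℝ) ≤ m := Nat.cast_nonneg m
    linarith
  exact h1.hasDerivAt.log (Real.Gamma_pos_of_pos hx).ne'

theorem Real.log_Gamma_add_one {x : ℝ} (hx : 0 < x) :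
    Real.log (Real.Gamma (x + 1)) = Real.log x + Real.log (Real.Gamma x) := by
  rw [Real.Gamma_add_one hx.ne', Real.log_mul hx.ne' (Real.Gamma_pos_of_pos hx).ne']

/-- By convexity of log Γ, its slope at x is at most the slope of the chord over [x, x + 1], which
is log x. -/
theorem Real.logDeriv_Gamma_le_log {x : ℝ} (hx : 0 < x) : logDeriv Real.Gamma x ≤ Real.log x := by
  have h := Real.convexOn_log_Gamma.le_slope_of_hasDerivAt (x := x) (y := x + 1) hx
    (Set.mem_Ioi.2 (by linarith)) (by linarith) (Real.hasDerivAt_log_Gamma hx)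
  rw [slope_def_field] at h
  simpa [Real.log_Gamma_add_one hx] using h

theorem Real.log_le_logDeriv_Gamma_add_one {x : ℝ} (hx : 0 < x) :
    Real.log x ≤ logDeriv Real.Gamma (x + 1) := by
  have h := Real.convexOn_log_Gamma.slope_le_of_hasDerivAt (x := x) (y := x + 1) hx
    (Set.mem_Ioi.2 (by linarith)) (by linarith) (Real.hasDerivAt_log_Gamma (by linarith))
  rw [slope_def_field] at h
  simpa [Real.log_Gamma_add_one hx] using h

theorem Real.logDeriv_Gamma_add_one {x : ℝ} (hx : 0 < x) :
    logDeriv Real.Gamma (x + 1) = logDeriv Real.Gamma x + 1 / x := by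
  have h1 : HasDerivAt (fun x => (Real.log ∘ Real.Gamma) (x + 1)) (logDeriv Real.Gamma (x + 1)) x :=
    (Real.hasDerivAt_log_Gamma (by linarith : 0 < x + 1)).comp_add_const x 1
  have h2 : HasDerivAt (fun x => (Real.log ∘ Real.Gamma) (x + 1))
      (x⁻¹ + logDeriv Real.Gamma x) x := by
    refine ((Real.hasDerivAt_log hx.ne').add (Real.hasDerivAt_log_Gamma hx)).congr_of_eventuallyEq ?_
    filter_upwards [Ioi_mem_nhds hx] with y hy
    exact Real.log_Gamma_add_one hy
  rw [h1.unique h2]; ring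

theorem Real.logDeriv_Gamma_add_nat {x : ℝ} (hx : 0 < x) (n : ℕ) :
    logDeriv Real.Gamma (x + n) = logDeriv Real.Gamma x + ∑ k ∈ Finset.range n, 1 / (x + k) := by
  induction n with
  | zero => simp
  | succ n ih =>
    rw [Finset.sum_range_succ, ← add_assoc, ← ih, Nat.cast_succ, ← add_assoc,
      Real.logDeriv_Gamma_add_one (by positivity)]

theorem Real.tendsto_logDeriv_Gamma_sub_log :
    Tendsto (fun x => logDeriv Real.Gamma x - Real.log x) atTop (𝓝 0) := by
  have h0 : Tendsto (fun x : ℝ => Real.log (1 - x⁻¹)) atTop (𝓝 0) := by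
    have h1 : Tendsto (fun x : ℝ => 1 - x⁻¹) atTop (𝓝 1) := by
      simpa using tendsto_inv_atTop_zero.const_sub (1 : ℝ)
    have := (Real.continuousAt_log one_ne_zero).tendsto.comp h1
    simpa using! this
  refine tendsto_of_tendsto_of_tendsto_of_le_of_le' h0 tendsto_const_nhds ?_ ?_
  · filter_upwards [eventually_gt_atTop 1] with x hx
    have h1 := Real.log_le_logDeriv_Gamma_add_one (x := x - 1) (by linarith)
    rw [sub_add_cancel] at h1
    have h2 : 1 - x⁻¹ = (x - 1) / x := by field_simp
    rw [h2, Real.log_div (by linarith) (by linarith)]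
    linarith
  · filter_upwards [eventually_gt_atTop 0] with x hx
    linarith [Real.logDeriv_Gamma_le_log hx]

/-- Partial sums come from ψ(x + n) = ψ(x) + ∑ 1/(x + k), and the remainders cancel because ψ(x) -
log x → 0. The condition y ≤ x makes the terms nonnegative. -/
theorem Real.hasSum_logDeriv_Gamma_sub {x y : ℝ} (hy : 0 < y) (hyx : y ≤ x) :
    HasSum (fun k : ℕ => 1 / (y + k) - 1 / (x + k))
      (logDeriv Real.Gamma x - logDeriv Real.Gamma y) := by
  have hx : 0 < x := hy.trans_le hyx
  rw [hasSum_iff_tendsto_nat_of_nonneg]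
  · have hs : ∀ n : ℕ, ∑ k ∈ Finset.range n, (1 / (y + k) - 1 / (x + k)) =
        (logDeriv Real.Gamma x - logDeriv Real.Gamma y) -
        ((logDeriv Real.Gamma (x + n) - Real.log (x + n)) -
          (logDeriv Real.Gamma (y + n) - Real.log (y + n)) +
          Real.log (1 + (x - y) * (y + n)⁻¹)) := by
      intro n
      have hyn : 0 < y + n := by positivity
      have hxn : 0 < x + n := by positivity
      have h3 : 1 + (x - y) * (y + n)⁻¹ = (x + n) / (y + n) := by field_simp; ring
      rw [Finset.sum_sub_distrib, Real.logDeriv_Gamma_add_nat hx, Real.logDeriv_Gamma_add_nat hy, h3,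
        Real.log_div hxn.ne' hyn.ne']
      ring
    have hT : ∀ z : ℝ, Tendsto (fun n : ℕ => z + (n : ℝ)) atTop atTop := fun z =>
      tendsto_atTop_add_const_left _ _ tendsto_natCast_atTop_atTop
    have h1 := (Real.tendsto_logDeriv_Gamma_sub_log.comp (hT x)).sub
      (Real.tendsto_logDeriv_Gamma_sub_log.comp (hT y))
    have h2 : Tendsto (fun n : ℕ => Real.log (1 + (x - y) * (y + n)⁻¹)) atTop (𝓝 0) := by
      have h3 : Tendsto (fun n : ℕ => 1 + (x - y) * (y + n)⁻¹) atTop (𝓝 1) := by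
        simpa using ((tendsto_inv_atTop_zero.comp (hT y)).const_mul (x - y)).const_add (1 : ℝ)
      have := (Real.continuousAt_log one_ne_zero).tendsto.comp h3
      simpa using! this
    have h4 := (h1.add h2).const_sub (logDeriv Real.Gamma x - logDeriv Real.Gamma y)
    simp only [sub_zero, add_zero] at h4
    exact h4.congr fun n => (hs n).symm
  · intro k
    rw [sub_nonneg]
    have : 0 < y + k := by positivity
    exact one_div_le_one_div_of_le this (by linarith)

theorem Real.hasSum_deriv_logDeriv_Gamma {x : ℝ} (hx : 0 < x) :
    ∃ d : ℝ, HasSum (fun k : ℕ => 1 / (x + k) ^ 2) d ∧ HasDerivAt (logDeriv Real.Gamma) d x := by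
  -- On (x/2, ∞) the differentiated terms are dominated by 1/(y + k)², and the constant ψ(y)
  -- disappears on differentiation.
  set y := x / 2 with hy
  have hy0 : 0 < y := by positivity
  have hyx : y < x := by rw [hy]; linarith
  have hu : Summable fun k : ℕ => 1 / (y + k) ^ 2 := by
    have h1 : Summable fun k : ℕ => (y ^ 2)⁻¹ * (if k = 0 then 1 else 0) + 1 / (k : ℝ) ^ 2 :=
      ((summable_of_ne_finset_zero (s := {0}) (by simp +contextual)).mul_left _).add
        (Real.summable_one_div_nat_pow.2 one_lt_two)
    refine Summable.of_nonneg_of_le (fun k => by positivity) (fun k => ?_) h1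
    rcases Nat.eq_zero_or_pos k with rfl | hk
    · simp
    · have : (0 : ℝ) < k := by exact_mod_cast hk
      simp only [hk.ne', if_false, mul_zero, zero_add]
      gcongr
      linarith
  have hder : ∀ (k : ℕ), ∀ z ∈ Set.Ioi y, HasDerivAt (fun z : ℝ => 1 / (y + k) - 1 / (z + k))
      (1 / (z + k) ^ 2) z := by
    intro k z hz
    have hz0 : 0 < z := hy0.trans hz
    have hzk : z + k ≠ 0 := by positivity
    have h1 := ((hasDerivAt_const z (1 : ℝ)).div ((hasDerivAt_id z).add_const (k : ℝ)) hzk).const_sub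
      (1 / (y + k))
    refine h1.congr_deriv ?_
    simp [neg_div]
  have hmain := hasDerivAt_tsum_of_isPreconnected hu isOpen_Ioi isPreconnected_Ioi hder
    (fun k z hz => by
      have hz' : y < z := hz
      rw [Real.norm_of_nonneg (by positivity)]
      gcongr) hyx (Real.hasSum_logDeriv_Gamma_sub hy0 hyx.le).summable hyx
  refine ⟨∑' k : ℕ, 1 / (x + k) ^ 2, ?_, ?_⟩
  · refine (Summable.of_nonneg_of_le (fun k => by positivity) (fun k => ?_) hu).hasSum
    gcongr
  · have h2 : HasDerivAt (fun z => logDeriv Real.Gamma z - logDeriv Real.Gamma y)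
        (∑' k : ℕ, 1 / (x + k) ^ 2) x := by
      refine hmain.congr_of_eventuallyEq ?_
      filter_upwards [Ioi_mem_nhds hyx] with z hz
      exact (Real.hasSum_logDeriv_Gamma_sub hy0 (le_of_lt hz)).tsum_eq.symm
    simpa using h2.add_const (logDeriv Real.Gamma y)

theorem Complex.digamma_ofReal {x : ℝ} (hx : 0 < x) :
    Complex.digamma x = (logDeriv Real.Gamma x : ℝ) := by
  have h1 : DifferentiableAt ℂ Complex.Gamma x := Complex.differentiableAt_Gamma _ fun m h => by
    have := congrArg Complex.re h
    simp at this
    have : (0 : ℝ) ≤ m := Nat.cast_nonneg m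
    linarith
  have h2 : DifferentiableAt ℝ Real.Gamma x := Real.differentiableAt_Gamma fun m => by
    have : (0 : ℝ) ≤ m := Nat.cast_nonneg m
    linarith
  have h3 := h1.hasDerivAt.comp_ofReal
  have h4 := h2.hasDerivAt.ofReal_comp
  have h5 : deriv Complex.Gamma x = ((deriv Real.Gamma x : ℝ) : ℂ) := by
    refine h3.unique (h4.congr_of_eventuallyEq ?_)
    exact Eventually.of_forall fun z => Complex.Gamma_ofReal z
  rw [Complex.digamma_def, logDeriv_apply, logDeriv_apply, h5, Complex.Gamma_ofReal]
  push_cast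
  rfl

theorem Complex.analyticAt_digamma {z : ℂ} (hz : 0 < z.re) : AnalyticAt ℂ Complex.digamma z := by
  have hU : IsOpen {z : ℂ | 0 < z.re} := isOpen_lt continuous_const Complex.continuous_re
  have h1 : DifferentiableOn ℂ Complex.Gamma {z : ℂ | 0 < z.re} := by
    intro w hw
    refine (Complex.differentiableAt_Gamma _ fun m h => ?_).differentiableWithinAt
    have hw' : 0 < w.re := hw
    rw [h] at hw'
    simp at hw'
    have : (0 : ℝ) ≤ m := Nat.cast_nonneg m
    linarith
  have h2 : AnalyticAt ℂ Complex.Gamma z := h1.analyticAt (hU.mem_nhds hz)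
  exact h2.deriv.div h2 (Complex.Gamma_ne_zero_of_re_pos hz)

theorem Complex.hasSum_deriv_digamma {x : ℝ} (hx : 0 < x) :
    HasSum (fun k : ℕ => 1 / ((x : ℂ) + k) ^ 2) (deriv Complex.digamma x) := by
  obtain ⟨d, hd, hder⟩ := Real.hasSum_deriv_logDeriv_Gamma hx
  have h1 := (Complex.analyticAt_digamma (z := x) (by simpa using hx)).differentiableAt.hasDerivAt
  have h2 : deriv Complex.digamma x = d := by
    refine h1.comp_ofReal.unique (hder.ofReal_comp.congr_of_eventuallyEq ?_)
    filter_upwards [Ioi_mem_nhds hx] with z hz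
    exact Complex.digamma_ofReal hz
  rw [h2]
  have := Complex.hasSum_ofReal.2 hd
  push_cast at this
  exact this

/-! ### Logarithmic derivative of ξ: Gamma part and zeta part. -/

/-- The regularised logarithmic derivative `ζ'/ζ(1/2 + t) + 1/(t - 1/2)`. -/
noncomputable def zetaLogDeriv (t : ℂ) : ℂ := logDeriv riemannZeta₁ (1 / 2 + t)

/-- The logarithmic derivative of the Gamma factor of `ξ(1/2 + t)`. -/
noncomputable def gammaLogDeriv (t : ℂ) : ℂ :=
  Complex.digamma (5 / 4 + t / 2) / 2 - Real.log Real.pi / 2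

/-- The factor s is absorbed through (s/2)Γ(s/2) = Γ(s/2 + 1). The poles left are t = -(1/2 + 2k), k
≥ 1, which are the origin of the shadow series. -/
theorem xiCentered_eq {t : ℂ} (ht : -(1 / 2) < t.re) :
    xiCentered t = 2 * riemannZeta₁ (1 / 2 + t) *
      ((Real.pi : ℂ) ^ (-(1 / 2 + t) / 2) * Complex.Gamma (5 / 4 + t / 2)) := by
  have hre : 0 < (1 / 2 + t).re := by simp; linarith
  have hne : (1 / 2 + t) / 2 ≠ 0 := by
    intro h
    have : 1 / 2 + t = 0 := by simpa using h
    rw [this] at hre; simp at hre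
  rw [xiCentered, riemannXi_eq_of_re_pos hre, Complex.Gammaℝ_def,
    show (5 / 4 + t / 2 : ℂ) = (1 / 2 + t) / 2 + 1 by ring, Complex.Gamma_add_one _ hne]
  ring

theorem riemannZeta₁_ne_zero_of_xiCentered_ne_zero {t : ℂ} (ht : -(1 / 2) < t.re)
    (h : xiCentered t ≠ 0) : riemannZeta₁ (1 / 2 + t) ≠ 0 := by
  intro h0
  rw [xiCentered_eq ht, h0] at h
  simp at h

theorem logDeriv_xiCentered {t : ℂ} (ht : -(1 / 2) < t.re) (h : xiCentered t ≠ 0) :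
    logDeriv xiCentered t = gammaLogDeriv t + zetaLogDeriv t := by
  have hz := riemannZeta₁_ne_zero_of_xiCentered_ne_zero ht h
  have hev : xiCentered =ᶠ[𝓝 t] fun t => 2 * riemannZeta₁ (1 / 2 + t) *
      ((Real.pi : ℂ) ^ (-(1 / 2 + t) / 2) * Complex.Gamma (5 / 4 + t / 2)) := by
    filter_upwards [(isOpen_lt continuous_const Complex.continuous_re).mem_nhds ht] with w hw
    exact xiCentered_eq hw
  have hG : 0 < (5 / 4 + t / 2).re := by
    simp; linarith
  have hGne := Complex.Gamma_ne_zero_of_re_pos hG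
  have hpi : (Real.pi : ℂ) ≠ 0 := by exact_mod_cast Real.pi_ne_zero
  have hdG : DifferentiableAt ℂ Complex.Gamma (5 / 4 + t / 2) :=
    Complex.differentiableAt_Gamma _ fun m hm => by
      rw [hm] at hG
      simp at hG
      have : (0 : ℝ) ≤ m := Nat.cast_nonneg m
      linarith
  have h1 : HasDerivAt (fun t => riemannZeta₁ (1 / 2 + t)) (deriv riemannZeta₁ (1 / 2 + t)) t := by
    simpa using (differentiable_riemannZeta₁ (1 / 2 + t)).hasDerivAt.comp_const_add (1 / 2) t
  have h2 : HasDerivAt (fun t : ℂ => (Real.pi : ℂ) ^ (-(1 / 2 + t) / 2))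
      ((Real.pi : ℂ) ^ (-(1 / 2 + t) / 2) * Complex.log Real.pi * (-1 / 2)) t := by
    have := ((((hasDerivAt_id t).const_add (1 / 2)).neg).div_const 2).const_cpow (c := (Real.pi : ℂ))
      (Or.inl hpi)
    exact this
  have h3 : HasDerivAt (fun t => Complex.Gamma (5 / 4 + t / 2))
      (deriv Complex.Gamma (5 / 4 + t / 2) * (1 / 2)) t :=
    hdG.hasDerivAt.comp t (((hasDerivAt_id t).div_const 2).const_add (5 / 4))
  have hP : (Real.pi : ℂ) ^ (-(1 / 2 + t) / 2) ≠ 0 := by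
    rw [Complex.cpow_def_of_ne_zero hpi]; exact Complex.exp_ne_zero _
  have hd := ((h1.const_mul 2).mul (h2.mul h3)).congr_of_eventuallyEq hev
  rw [logDeriv_apply, hd.deriv, xiCentered_eq ht, gammaLogDeriv, zetaLogDeriv, Complex.digamma_def,
    logDeriv_apply, logDeriv_apply, Complex.ofReal_log Real.pi_pos.le]
  simp only [Pi.mul_apply]
  generalize Complex.Gamma (5 / 4 + t / 2) = A at hGne ⊢
  generalize riemannZeta₁ (1 / 2 + t) = B at hz ⊢
  generalize (Real.pi : ℂ) ^ (-(1 / 2 + t) / 2) = D at hP ⊢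
  field_simp
  ring

theorem analyticAt_zetaLogDeriv {t : ℂ} (h : riemannZeta₁ (1 / 2 + t) ≠ 0) :
    AnalyticAt ℂ zetaLogDeriv t := by
  have h1 := differentiable_riemannZeta₁.analyticAt (1 / 2 + t)
  have h2 : AnalyticAt ℂ (logDeriv riemannZeta₁) (1 / 2 + t) := h1.deriv.div h1 h
  exact h2.comp (f := fun t : ℂ => 1 / 2 + t) (by fun_prop)

theorem analyticAt_gammaLogDeriv {t : ℂ} (ht : -(1 / 2) < t.re) : AnalyticAt ℂ gammaLogDeriv t := by
  have h1 : AnalyticAt ℂ Complex.digamma (5 / 4 + t / 2) :=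
    Complex.analyticAt_digamma (by simp; linarith)
  have h2 : AnalyticAt ℂ (fun t : ℂ => Complex.digamma (5 / 4 + t / 2)) t :=
    h1.comp (f := fun t : ℂ => 5 / 4 + t / 2) (by fun_prop)
  exact (h2.div_const).sub analyticAt_const

theorem deriv_logDeriv_xiCentered {t : ℝ} (ht : 0 ≤ t) :
    deriv (logDeriv xiCentered) t = deriv gammaLogDeriv t + deriv zetaLogDeriv t := by
  have hre : -(1 / 2) < (t : ℂ).re := by simp; linarith
  have hx := xiCentered_ofReal_ne_zero t
  have hz := riemannZeta₁_ne_zero_of_xiCentered_ne_zero hre hx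
  have : logDeriv xiCentered =ᶠ[𝓝 (t : ℂ)] fun t => gammaLogDeriv t + zetaLogDeriv t := by
    filter_upwards [(isOpen_lt continuous_const Complex.continuous_re).mem_nhds hre,
      differentiable_xiCentered.continuous.continuousAt.eventually_ne hx] with w hw hw'
    exact logDeriv_xiCentered hw hw'
  rw [this.deriv_eq]
  exact ((analyticAt_gammaLogDeriv hre).differentiableAt.hasDerivAt.add
    (analyticAt_zetaLogDeriv hz).differentiableAt.hasDerivAt).deriv

theorem hasSum_deriv_gammaLogDeriv {t : ℝ} (ht : 0 ≤ t) :
    HasSum (fun k : ℕ => 1 / ((t : ℂ) + (1 / 2 + 2 * ((k : ℂ) + 1))) ^ 2)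
      (deriv gammaLogDeriv t) := by
  have h1 := Complex.hasSum_deriv_digamma (x := 5 / 4 + t / 2) (by positivity)
  have h0 : ((5 / 4 + t / 2 : ℝ) : ℂ) = 5 / 4 + (t : ℂ) / 2 := by push_cast; ring
  rw [h0] at h1
  have h2 : HasDerivAt gammaLogDeriv (deriv Complex.digamma (5 / 4 + (t : ℂ) / 2) / 4) t := by
    have h3 := (Complex.analyticAt_digamma (z := 5 / 4 + (t : ℂ) / 2)
      (by simp; positivity)).differentiableAt.hasDerivAt
    have h4 := (h3.comp (t : ℂ) (((hasDerivAt_id (t : ℂ)).div_const 2).const_add (5 / 4)))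
    have h5 := (h4.div_const 2).sub_const ((Real.log Real.pi : ℂ) / 2)
    refine h5.congr_deriv ?_
    ring
  rw [h2.deriv]
  refine (h1.div_const 4).congr_fun fun k => ?_
  rw [show (t : ℂ) + (1 / 2 + 2 * ((k : ℂ) + 1)) = 2 * (5 / 4 + (t : ℂ) / 2 + k) by ring, mul_pow]
  rw [div_div]
  ring_nf

/-- Evenness gives ξ'(1/2) = 0, so vanishing here would force ψ(5/4) = log π, whereas ψ(5/4) ≤
log(5/4) < log π. This is what makes the regularised integral diverge at 0 when Re σ ≥ 1/2. -/
theorem zetaLogDeriv_zero_ne_zero : zetaLogDeriv 0 ≠ 0 := by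
  have hx := xiCentered_zero_ne_zero
  have h1 := logDeriv_xiCentered (t := 0) (by simp) hx
  have h2 : deriv xiCentered 0 = 0 := by
    have h3 := (differentiable_xiCentered 0).hasDerivAt
    have h4 : HasDerivAt xiCentered (-deriv xiCentered 0) 0 := by
      have h5 : HasDerivAt xiCentered (deriv xiCentered 0) (-(0 : ℂ)) := by simpa using h3
      have := h5.comp (0 : ℂ) (hasDerivAt_neg (0 : ℂ))
      rw [mul_neg_one] at this
      refine this.congr_of_eventuallyEq (Eventually.of_forall fun z => ?_)
      simp [xiCentered_neg]
    have := h3.unique h4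
    exact self_eq_neg.1 this
  rw [logDeriv_apply, h2, zero_div] at h1
  intro h0
  rw [h0, add_zero, gammaLogDeriv] at h1
  have h3 : (5 / 4 + 0 / 2 : ℂ) = ((5 / 4 : ℝ) : ℂ) := by push_cast; ring
  rw [h3, Complex.digamma_ofReal (by norm_num)] at h1
  have h4 : logDeriv Real.Gamma (5 / 4) / 2 - Real.log Real.pi / 2 = 0 := by exact_mod_cast h1.symm
  have h5 := Real.logDeriv_Gamma_le_log (x := 5 / 4) (by norm_num)
  have h6 : Real.log (5 / 4) < Real.log Real.pi :=
    Real.log_lt_log (by norm_num) (by linarith [Real.pi_gt_three])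
  linarith

/-! ### Rotation of the path of integration. -/

/-- **Rotation of the path of integration**: the integrals of `f` along the rays of angle
`θ₁` and `θ₂` agree if `f` is holomorphic in the sector between the rays, `O(|t| ^ (η - 1))` at the
origin and `O(|t| ^ (-η - 1))` at infinity. -/
theorem integral_rayPullback_eq_of_bound {f : ℂ → ℂ} {θ₁ θ₂ η C : ℝ} (hη : 0 < η) (h12 : θ₁ ≤ θ₂)
    (hd : ∀ r : ℝ, 0 < r → ∀ θ ∈ Set.Icc θ₁ θ₂,
      DifferentiableAt ℂ f (r * Complex.exp (θ * Complex.I)))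
    (hb0 : ∀ r : ℝ, 0 < r → ∀ θ ∈ Set.Icc θ₁ θ₂,
      ‖f (r * Complex.exp (θ * Complex.I))‖ * r ≤ C * r ^ η)
    (hb1 : ∀ r : ℝ, 0 < r → ∀ θ ∈ Set.Icc θ₁ θ₂,
      ‖f (r * Complex.exp (θ * Complex.I))‖ * r ≤ C * r ^ (-η)) :
    (∀ θ ∈ Set.Icc θ₁ θ₂, IntegrableOn (rayPullback f θ) (Set.Ioi 0)) ∧
      ∫ r in Set.Ioi (0 : ℝ), rayPullback f θ₁ r = ∫ r in Set.Ioi (0 : ℝ), rayPullback f θ₂ r := by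
  have hnorm : ∀ θ r : ℝ, ‖rayPullback f θ r‖ = ‖f (r * Complex.exp (θ * Complex.I))‖ := by
    intro θ r
    rw [rayPullback, norm_mul, Complex.norm_exp_ofReal_mul_I, mul_one]
  have hcont : ∀ θ ∈ Set.Icc θ₁ θ₂, ContinuousOn (rayPullback f θ) (Set.Ioi 0) := by
    intro θ hθ r hr
    have h1 : ContinuousAt (fun r : ℝ => f (r * Complex.exp (θ * Complex.I))) r :=
      ContinuousAt.comp (f := fun r : ℝ => (r : ℂ) * Complex.exp (θ * Complex.I))
        (hd r hr θ hθ).continuousAt (by fun_prop)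
    exact (h1.mul continuousAt_const).continuousWithinAt
  have hint : ∀ θ ∈ Set.Icc θ₁ θ₂, IntegrableOn (rayPullback f θ) (Set.Ioi 0) := by
    intro θ hθ
    rw [← Set.Ioc_union_Ioi_eq_Ioi zero_le_one]
    refine IntegrableOn.union ?_ ?_
    · have h1 : IntegrableOn (fun r : ℝ => C * r ^ (η - 1)) (Set.Ioc 0 1) :=
        ((intervalIntegral.intervalIntegrable_rpow' (by linarith)).const_mul C).1
      refine Integrable.mono' h1 (((hcont θ hθ).mono Set.Ioc_subset_Ioi_self).aestronglyMeasurable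
        measurableSet_Ioc) ?_
      rw [ae_restrict_iff' measurableSet_Ioc]
      refine Eventually.of_forall fun r hr => ?_
      rw [hnorm, Real.rpow_sub hr.1, Real.rpow_one, ← mul_div_assoc, le_div_iff₀ hr.1]
      exact hb0 r hr.1 θ hθ
    · have h1 : IntegrableOn (fun r : ℝ => C * r ^ (-η - 1)) (Set.Ioi 1) :=
        (integrableOn_Ioi_rpow_of_lt (by linarith) zero_lt_one).const_mul C
      refine Integrable.mono' h1 (((hcont θ hθ).mono
        (Set.Ioi_subset_Ioi zero_le_one)).aestronglyMeasurable measurableSet_Ioi) ?_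
      rw [ae_restrict_iff' measurableSet_Ioi]
      refine Eventually.of_forall fun r hr => ?_
      have hr0 : 0 < r := zero_lt_one.trans hr
      rw [hnorm, Real.rpow_sub hr0, Real.rpow_one, ← mul_div_assoc, le_div_iff₀ hr0]
      exact hb1 r hr0 θ hθ
  refine ⟨hint, ?_⟩
  -- In the coordinate z = log t the two rays become horizontal lines, and the growth conditions
  -- become |q| ≤ C e^(-η|Re z|). Cauchy's theorem applies on rectangles whose vertical sides recede
  -- to ±∞.
  set q : ℂ → ℂ := fun z => f (Complex.exp z) * Complex.exp z with hq
  have hexp : ∀ u θ : ℝ, Complex.exp (u + θ * Complex.I) =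
      (Real.exp u : ℝ) * Complex.exp (θ * Complex.I) := by
    intro u θ; rw [Complex.exp_add, Complex.ofReal_exp]
  have hqr : ∀ u θ : ℝ, q (u + θ * Complex.I) = Real.exp u • rayPullback f θ (Real.exp u) := by
    intro u θ
    simp only [hq, hexp, rayPullback, Complex.real_smul]
    ring
  have himg : Real.exp '' Set.univ = Set.Ioi 0 := by rw [Set.image_univ, Real.range_exp]
  have hsub : ∀ g : ℝ → ℂ, ∫ r in Set.Ioi (0 : ℝ), g r = ∫ u : ℝ, Real.exp u • g (Real.exp u) := by
    intro g
    rw [← himg, integral_image_eq_integral_abs_deriv_smul MeasurableSet.univ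
      (fun x _ => (Real.hasDerivAt_exp x).hasDerivWithinAt) Real.exp_injective.injOn]
    simp [abs_of_pos (Real.exp_pos _)]
  have hsubi : ∀ g : ℝ → ℂ, IntegrableOn g (Set.Ioi 0) →
      Integrable fun u : ℝ => Real.exp u • g (Real.exp u) := by
    intro g hg
    rw [← himg, integrableOn_image_iff_integrableOn_abs_deriv_smul MeasurableSet.univ
      (fun x _ => (Real.hasDerivAt_exp x).hasDerivWithinAt) Real.exp_injective.injOn] at hg
    simpa [abs_of_pos (Real.exp_pos _)] using hg
  have hlim : ∀ θ ∈ Set.Icc θ₁ θ₂, Tendsto (fun T : ℝ => ∫ u in -T..T, q (u + θ * Complex.I)) atTop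
      (𝓝 (∫ r in Set.Ioi (0 : ℝ), rayPullback f θ r)) := by
    intro θ hθ
    rw [hsub]
    simp_rw [hqr]
    exact intervalIntegral_tendsto_integral (hsubi _ (hint θ hθ)) tendsto_neg_atTop_atBot tendsto_id
  have hqb : ∀ u θ : ℝ, θ ∈ Set.Icc θ₁ θ₂ → ‖q (u + θ * Complex.I)‖ ≤ C * Real.exp (-η * |u|) := by
    intro u θ hθ
    rw [hqr, norm_smul, hnorm, Real.norm_of_nonneg (Real.exp_pos u).le, mul_comm]
    rcases le_total 0 u with h | h
    · refine (hb1 _ (Real.exp_pos u) θ hθ).trans (le_of_eq ?_)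
      rw [abs_of_nonneg h, ← Real.exp_mul, mul_comm u]
    · refine (hb0 _ (Real.exp_pos u) θ hθ).trans (le_of_eq ?_)
      rw [abs_of_nonpos h, ← Real.exp_mul]
      ring_nf
  have hrect : ∀ T : ℝ, (∫ u in -T..T, q (u + θ₁ * Complex.I)) - ∫ u in -T..T, q (u + θ₂ * Complex.I)
      = Complex.I * (∫ y in θ₁..θ₂, q ((-T : ℝ) + y * Complex.I)) -
        Complex.I * ∫ y in θ₁..θ₂, q (T + y * Complex.I) := by
    intro T
    have h := Complex.integral_boundary_rect_eq_zero_of_differentiableOn q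
      ((-T : ℝ) + θ₁ * Complex.I) (T + θ₂ * Complex.I) ?_
    · simp only [Complex.add_re, Complex.ofReal_re, Complex.mul_re, Complex.I_re, mul_zero,
        Complex.ofReal_im, Complex.I_im, mul_one, sub_self, add_zero, Complex.add_im,
        Complex.mul_im, zero_add, smul_eq_mul] at h
      linear_combination h
    · intro z hz
      have him : z.im ∈ Set.Icc θ₁ θ₂ := by
        have := (Complex.mem_reProdIm.1 hz).2
        simpa [Set.uIcc_of_le h12] using this
      have hz' : Complex.exp z = (Real.exp z.re : ℝ) * Complex.exp (z.im * Complex.I) := by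
        rw [← hexp, Complex.re_add_im]
      have h1 : DifferentiableAt ℂ f (Complex.exp z) := by
        rw [hz']; exact hd _ (Real.exp_pos _) _ him
      exact ((h1.comp z Complex.differentiableAt_exp).mul
        Complex.differentiableAt_exp).differentiableWithinAt
  have hvert : ∀ T : ℝ, ‖∫ y in θ₁..θ₂, q (T + y * Complex.I)‖ ≤
      C * Real.exp (-η * |T|) * |θ₂ - θ₁| := by
    intro T
    refine intervalIntegral.norm_integral_le_of_norm_le_const fun y hy => ?_
    rw [Set.uIoc_of_le h12] at hy
    exact hqb T y ⟨hy.1.le, hy.2⟩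
  have hzero : Tendsto (fun T : ℝ => (∫ u in -T..T, q (u + θ₁ * Complex.I)) -
      ∫ u in -T..T, q (u + θ₂ * Complex.I)) atTop (𝓝 0) := by
    have h0 : Tendsto (fun T : ℝ => 2 * (C * Real.exp (-η * T) * |θ₂ - θ₁|)) atTop (𝓝 0) := by
      have h1 : Tendsto (fun T : ℝ => Real.exp (-η * T)) atTop (𝓝 0) :=
        Real.tendsto_exp_atBot.comp (tendsto_id.const_mul_atTop_of_neg (by linarith))
      simpa using ((h1.const_mul C).mul_const |θ₂ - θ₁|).const_mul 2
    refine squeeze_zero_norm' ?_ h0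
    filter_upwards [eventually_ge_atTop 0] with T hT
    rw [hrect]
    refine (norm_sub_le _ _).trans ?_
    rw [norm_mul, norm_mul, Complex.norm_I, one_mul, one_mul]
    have h1 := hvert T
    have h2 := hvert (-T)
    rw [abs_neg] at h2
    rw [abs_of_nonneg hT] at h1 h2
    linarith
  have h3 := tendsto_nhds_unique ((hlim θ₁ ⟨le_rfl, h12⟩).sub (hlim θ₂ ⟨h12, le_rfl⟩)) hzero
  exact sub_eq_zero.1 h3

/-- Rotation of the path of integration, with bounds required only near the origin and near
infinity. -/
theorem integral_rayPullback_eq {f : ℂ → ℂ} {θ₁ θ₂ η C : ℝ} (hη : 0 < η) (h12 : θ₁ ≤ θ₂)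
    (hd : ∀ r : ℝ, 0 < r → ∀ θ ∈ Set.Icc θ₁ θ₂,
      DifferentiableAt ℂ f (r * Complex.exp (θ * Complex.I)))
    (hb0 : ∀ r : ℝ, 0 < r → r ≤ 1 / 4 → ∀ θ ∈ Set.Icc θ₁ θ₂,
      ‖f (r * Complex.exp (θ * Complex.I))‖ * r ≤ C * r ^ η)
    (hb1 : ∀ r : ℝ, 4 ≤ r → ∀ θ ∈ Set.Icc θ₁ θ₂,
      ‖f (r * Complex.exp (θ * Complex.I))‖ * r ≤ C * r ^ (-η)) :
    (∀ θ ∈ Set.Icc θ₁ θ₂, IntegrableOn (rayPullback f θ) (Set.Ioi 0)) ∧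
      ∫ r in Set.Ioi (0 : ℝ), rayPullback f θ₁ r = ∫ r in Set.Ioi (0 : ℝ), rayPullback f θ₂ r := by
  have hK : IsCompact (Set.Icc (1 / 4 : ℝ) 4 ×ˢ Set.Icc θ₁ θ₂) := isCompact_Icc.prod isCompact_Icc
  obtain ⟨B, hB⟩ := hK.exists_bound_of_continuousOn
    (f := fun p : ℝ × ℝ => f (p.1 * Complex.exp (p.2 * Complex.I)))
    (fun p hp => (ContinuousAt.comp
      (f := fun p : ℝ × ℝ => (p.1 : ℂ) * Complex.exp (p.2 * Complex.I))
      (hd p.1 (by have := hp.1.1; linarith) p.2 hp.2).continuousAt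
      (by fun_prop)).continuousWithinAt)
  -- On the compact range 1/4 ≤ r ≤ 4 the quantity |f| r is at most 4|B|, while r^η and r^(-η) are
  -- both at least 4^(-η).
  set D : ℝ := |C| + |B| * 4 * 4 ^ η with hD
  have hCD : C ≤ D := (le_abs_self C).trans (by rw [hD]; linarith [show 0 ≤ |B| * 4 * 4 ^ η by positivity])
  have hD0 : 0 ≤ D := by positivity
  have hmid : ∀ r : ℝ, 1 / 4 ≤ r → r ≤ 4 → ∀ θ ∈ Set.Icc θ₁ θ₂, ∀ x : ℝ, 1 ≤ 4 ^ η * x →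
      ‖f (r * Complex.exp (θ * Complex.I))‖ * r ≤ D * x := by
    intro r h1 h2 θ hθ x hx
    have h3 := hB (r, θ) ⟨⟨h1, h2⟩, hθ⟩
    have h4 : (0 : ℝ) < 4 ^ η := by positivity
    have hx0 : 0 < x := by
      by_contra! h
      nlinarith
    calc ‖f (r * Complex.exp (θ * Complex.I))‖ * r ≤ |B| * 4 := by
          gcongr
          exact h3.trans (le_abs_self B)
      _ ≤ |B| * 4 * (4 ^ η * x) := le_mul_of_one_le_right (by positivity) hx
      _ ≤ D * x := by
          rw [← mul_assoc]
          gcongr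
          rw [hD]; linarith [abs_nonneg C]
  refine integral_rayPullback_eq_of_bound (C := D) hη h12 hd (fun r hr θ hθ => ?_)
    fun r hr θ hθ => ?_
  · have hrη : 0 ≤ r ^ η := by positivity
    rcases le_total r (1 / 4) with h | h
    · exact (hb0 r hr h θ hθ).trans (by gcongr)
    · rcases le_total r 4 with h' | h'
      · refine hmid r h h' θ hθ _ ?_
        rw [← Real.mul_rpow (by norm_num) hr.le]
        exact Real.one_le_rpow (by linarith) hη.le
      · refine (hb1 r h' θ hθ).trans ?_
        have : r ^ (-η) ≤ r ^ η := Real.rpow_le_rpow_of_exponent_le (by linarith) (by linarith)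
        have h5 : 0 ≤ r ^ (-η) := by positivity
        calc C * r ^ (-η) ≤ D * r ^ (-η) := by gcongr
          _ ≤ _ := by gcongr
  · have hrη : 0 ≤ r ^ (-η) := by positivity
    rcases le_total 4 r with h | h
    · exact (hb1 r h θ hθ).trans (by gcongr)
    · rcases le_total r (1 / 4) with h' | h'
      · refine (hb0 r hr h' θ hθ).trans ?_
        have : r ^ η ≤ r ^ (-η) := Real.rpow_le_rpow_of_exponent_ge hr (by linarith) (by linarith)
        have h5 : 0 ≤ r ^ η := by positivity
        calc C * r ^ η ≤ D * r ^ η := by gcongr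
          _ ≤ _ := by gcongr
      · refine hmid r h' h θ hθ _ ?_
        rw [Real.rpow_neg hr.le, ← div_eq_mul_inv, ← Real.div_rpow (by norm_num) hr.le]
        exact Real.one_le_rpow (by rw [le_div_iff₀ hr]; linarith) hη.le

/-! ### Estimates for ζ'/ζ in a sector about the positive half-line. -/

theorem ofReal_mul_exp_cpow {r θ : ℝ} (hr : 0 < r) (h1 : -Real.pi < θ) (h2 : θ ≤ Real.pi) (a : ℂ) :
    ((r : ℂ) * Complex.exp (θ * Complex.I)) ^ a = (r : ℂ) ^ a * Complex.exp (a * θ * Complex.I) := by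
  have he : Complex.exp (θ * Complex.I) ≠ 0 := Complex.exp_ne_zero _
  have hr' : (r : ℂ) ≠ 0 := Complex.ofReal_ne_zero.2 hr.ne'
  rw [Complex.cpow_def_of_ne_zero (mul_ne_zero hr' he), Complex.cpow_def_of_ne_zero hr',
    Complex.log_ofReal_mul hr he, Complex.log_exp (by simpa using h1) (by simpa using h2),
    ← Complex.exp_add, Complex.ofReal_log hr.le]
  ring_nf

theorem norm_ofReal_mul_exp_cpow_le {r θ : ℝ} (hr : 0 < r) (hθ : |θ| ≤ 1) (a : ℂ) :
    ‖((r : ℂ) * Complex.exp (θ * Complex.I)) ^ a‖ ≤ Real.exp |a.im| * r ^ a.re := by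
  have h := abs_le.1 hθ
  rw [ofReal_mul_exp_cpow hr (by linarith [Real.pi_gt_three]) (by linarith [Real.pi_gt_three]),
    norm_mul, Complex.norm_cpow_eq_rpow_re_of_pos hr, mul_comm, Complex.norm_exp]
  gcongr
  have : (a * θ * Complex.I).re = -(a.im * θ) := by simp
  rw [this]
  calc -(a.im * θ) ≤ |a.im * θ| := neg_le_abs _
    _ = |a.im| * |θ| := abs_mul _ _
    _ ≤ |a.im| * 1 := by gcongr
    _ = _ := mul_one _

/-- In the Dirichlet series of ζ'/ζ only n ≥ 2 occurs. Relative to s = 2 each term gains n^(-(Re s -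
2)) ≤ e^(1 - Re s/2), because log n ≥ log 2 ≥ 1/2. -/
theorem exists_norm_logDeriv_riemannZeta_le : ∃ C : ℝ, 0 < C ∧ ∀ s : ℂ, 2 ≤ s.re →
    ‖deriv riemannZeta s / riemannZeta s‖ ≤ C * Real.exp (-(s.re / 2)) := by
  set Λ' : ℕ → ℂ := fun n => (ArithmeticFunction.vonMangoldt n : ℂ) with hΛ
  have hsum : ∀ s : ℂ, 2 ≤ s.re → LSeriesSummable Λ' s := fun s hs =>
    ArithmeticFunction.LSeriesSummable_vonMangoldt (by linarith)
  have h2 : Summable fun n => ‖LSeries.term Λ' 2 n‖ := (hsum 2 (by simp)).norm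
  set A : ℝ := ∑' n, ‖LSeries.term Λ' 2 n‖ with hA
  have hA0 : 0 ≤ A := tsum_nonneg fun n => norm_nonneg _
  refine ⟨(A + 1) * Real.exp 1, by positivity, fun s hs => ?_⟩
  have h := ArithmeticFunction.LSeries_vonMangoldt_eq_deriv_riemannZeta_div
    (s := s) (by linarith)
  have h' : deriv riemannZeta s / riemannZeta s = -LSeries Λ' s := by
    rw [h]; ring
  rw [h', norm_neg]
  have hterm : ∀ n, ‖LSeries.term Λ' s n‖ ≤
      ‖LSeries.term Λ' 2 n‖ * (Real.exp 1 * Real.exp (-(s.re / 2))) := by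
    intro n
    rcases Nat.lt_or_ge n 2 with hn | hn
    · have : Λ' n = 0 := by
        interval_cases n <;> simp [hΛ]
      rcases Nat.eq_zero_or_pos n with h0 | h0
      · simp [h0]
      · simp [LSeries.term_of_ne_zero h0.ne', this]
    · have hn0 : 0 < (n : ℝ) := by positivity
      rw [LSeries.norm_term_eq, LSeries.norm_term_eq, if_neg (by lia), if_neg (by lia)]
      rw [div_mul_eq_mul_div, div_le_div_iff₀ (by positivity) (by positivity), mul_assoc]
      refine mul_le_mul_of_nonneg_left ?_ (norm_nonneg _)
      have h3 : (n : ℝ) ^ s.re = (n : ℝ) ^ ((2 : ℂ).re) * (n : ℝ) ^ (s.re - 2) := by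
        rw [← Real.rpow_add hn0]; simp
      have h4 : Real.exp (s.re / 2 - 1) ≤ (n : ℝ) ^ (s.re - 2) := by
        have h5 : (1 : ℝ) / 2 ≤ Real.log n := by
          have := Real.log_two_gt_d9
          have h6 : Real.log 2 ≤ Real.log n := Real.log_le_log (by norm_num) (by exact_mod_cast hn)
          linarith
        rw [Real.rpow_def_of_pos hn0]
        apply Real.exp_le_exp.2
        nlinarith
      rw [h3]
      have h7 : Real.exp 1 * Real.exp (-(s.re / 2)) * Real.exp (s.re / 2 - 1) = 1 := by
        rw [← Real.exp_add, ← Real.exp_add, Real.exp_eq_one_iff]; ring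
      have h8 : 1 ≤ Real.exp 1 * Real.exp (-(s.re / 2)) * (n : ℝ) ^ (s.re - 2) := by
        refine h7.symm.le.trans ?_
        gcongr
      have h9 : 0 ≤ (n : ℝ) ^ ((2 : ℂ).re) := by positivity
      calc (n : ℝ) ^ ((2 : ℂ).re) ≤ (n : ℝ) ^ ((2 : ℂ).re) *
            (Real.exp 1 * Real.exp (-(s.re / 2)) * (n : ℝ) ^ (s.re - 2)) :=
              le_mul_of_one_le_right h9 h8
        _ = _ := by ring
  have hs1 : Summable fun n => ‖LSeries.term Λ' s n‖ := (hsum s hs).norm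
  calc ‖LSeries Λ' s‖ ≤ ∑' n, ‖LSeries.term Λ' s n‖ := norm_tsum_le_tsum_norm hs1
    _ ≤ ∑' n, ‖LSeries.term Λ' 2 n‖ * (Real.exp 1 * Real.exp (-(s.re / 2))) :=
        hs1.tsum_le_tsum hterm (h2.mul_right _)
    _ = A * (Real.exp 1 * Real.exp (-(s.re / 2))) := tsum_mul_right
    _ ≤ (A + 1) * (Real.exp 1 * Real.exp (-(s.re / 2))) := by gcongr; linarith
    _ = _ := by ring

theorem mul_exp_mul_I_re {r θ : ℝ} :
    ((r : ℂ) * Complex.exp (θ * Complex.I)).re = r * Real.cos θ := by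
  rw [Complex.re_ofReal_mul, Complex.exp_ofReal_mul_I_re]

theorem mul_exp_mul_I_im {r θ : ℝ} :
    ((r : ℂ) * Complex.exp (θ * Complex.I)).im = r * Real.sin θ := by
  rw [Complex.im_ofReal_mul, Complex.exp_ofReal_mul_I_im]

theorem norm_ofReal_mul_exp {r θ : ℝ} (hr : 0 ≤ r) :
    ‖(r : ℂ) * Complex.exp (θ * Complex.I)‖ = r := by
  rw [norm_mul, Complex.norm_exp_ofReal_mul_I, mul_one, Complex.norm_real, Real.norm_of_nonneg hr]

theorem seven_div_eight_le_cos {θ : ℝ} (h : |θ| ≤ 1 / 2) : 7 / 8 ≤ Real.cos θ := by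
  have h1 := Real.one_sub_sq_div_two_le_cos (x := θ)
  have h2 : θ ^ 2 ≤ (1 / 2) ^ 2 := by rw [← sq_abs]; gcongr
  linarith

/-- The completed zeta function has no zeros `1/2 + t` with `t` in a small sector about the positive
half-line. -/
theorem exists_sector_riemannZeta₁_ne_zero : ∃ ε₀ : ℝ, 0 < ε₀ ∧ ε₀ ≤ 1 / 2 ∧
    ∀ r : ℝ, 0 ≤ r → ∀ θ : ℝ, |θ| ≤ ε₀ →
      riemannZeta₁ (1 / 2 + r * Complex.exp (θ * Complex.I)) ≠ 0 := by
  obtain ⟨δ, hδ, h⟩ := exists_le_abs_im_of_riemannXi_eq_zero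
  -- A zero in the sector would have Re s < 1, hence r < 1 since cos θ ≥ 7/8. Then |Im s| ≤ |θ| ≤
  -- δ/2 contradicts |Im s| ≥ δ.
  refine ⟨min (1 / 2) (δ / 2), by positivity, min_le_left _ _, fun r hr θ hθ h0 => ?_⟩
  have hcos := seven_div_eight_le_cos (hθ.trans (min_le_left _ _))
  set s : ℂ := 1 / 2 + r * Complex.exp (θ * Complex.I) with hs
  have hre : s.re = 1 / 2 + r * Real.cos θ := by
    rw [hs, Complex.add_re, mul_exp_mul_I_re]; norm_num
  have him : s.im = r * Real.sin θ := by
    rw [hs, Complex.add_im, mul_exp_mul_I_im]; norm_num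
  have hpos : 0 < s.re := by rw [hre]; nlinarith
  have hxi : riemannXi s = 0 := by rw [riemannXi_eq_of_re_pos hpos, h0]; ring
  have h1 : s.re < 1 := by
    by_contra! h2
    exact riemannZeta₁_ne_zero_of_one_le_re h2 h0
  have hr1 : r < 1 := by nlinarith
  have h3 := h s hxi
  rw [him, abs_mul, abs_of_nonneg hr] at h3
  have h4 : |Real.sin θ| ≤ |θ| := Real.abs_sin_le_abs
  have h5 := hθ.trans (min_le_right _ _)
  nlinarith [abs_nonneg (Real.sin θ)]

/-- Half the opening of a sector about the positive half-line in which `t ↦ ζ'/ζ(1/2 + t)` has no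
pole but `1/2`. -/
noncomputable def sectorAngle : ℝ := exists_sector_riemannZeta₁_ne_zero.choose

theorem sectorAngle_pos : 0 < sectorAngle := exists_sector_riemannZeta₁_ne_zero.choose_spec.1

theorem sectorAngle_le : sectorAngle ≤ 1 / 2 := exists_sector_riemannZeta₁_ne_zero.choose_spec.2.1

theorem riemannZeta₁_ne_zero_of_abs_le_sectorAngle {r θ : ℝ} (hr : 0 ≤ r) (hθ : |θ| ≤ sectorAngle) :
    riemannZeta₁ (1 / 2 + r * Complex.exp (θ * Complex.I)) ≠ 0 :=
  exists_sector_riemannZeta₁_ne_zero.choose_spec.2.2 r hr θ hθ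

theorem differentiableAt_zetaLogDeriv_sector {r θ : ℝ} (hr : 0 ≤ r) (hθ : |θ| ≤ sectorAngle) :
    DifferentiableAt ℂ zetaLogDeriv (r * Complex.exp (θ * Complex.I)) :=
  (analyticAt_zetaLogDeriv (riemannZeta₁_ne_zero_of_abs_le_sectorAngle hr hθ)).differentiableAt

theorem analyticAt_zetaLogDeriv_ofReal {x : ℝ} (hx : 0 ≤ x) : AnalyticAt ℂ zetaLogDeriv x := by
  apply analyticAt_zetaLogDeriv
  simpa using riemannZeta₁_ne_zero_of_abs_le_sectorAngle (θ := 0) hx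
    (by simpa using sectorAngle_pos.le)

theorem zetaLogDeriv_eq {t : ℂ} (ht : t ≠ 1 / 2) (h : riemannZeta₁ (1 / 2 + t) ≠ 0) :
    zetaLogDeriv t =
      deriv riemannZeta (1 / 2 + t) / riemannZeta (1 / 2 + t) + 1 / (t - 1 / 2) := by
  have h1 : (1 / 2 + t : ℂ) ≠ 1 := fun h2 => ht (by linear_combination h2)
  have h3 : t - 1 / 2 ≠ 0 := sub_ne_zero.2 ht
  have h4 : (1 / 2 + t - 1 : ℂ) = t - 1 / 2 := by ring
  rw [zetaLogDeriv, logDeriv_apply, riemannZeta_eq_inv_sub_mul h1,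
    deriv_riemannZeta_eq_neg_inv_sub_sq_mul_add h1, h4]
  generalize t - 1 / 2 = u at h3
  generalize riemannZeta₁ (1 / 2 + t) = v at h
  field_simp
  ring

/-- Since cos θ ≥ 7/8, the real part 1/2 + r cos θ is at least r/2 + 2 once r ≥ 4; half of it
exceeds r/4. -/
theorem exists_norm_logDeriv_zeta_sector_le : ∃ C : ℝ, 0 < C ∧ ∀ r : ℝ, 4 ≤ r → ∀ θ : ℝ,
    |θ| ≤ sectorAngle →
    ‖deriv riemannZeta (1 / 2 + r * Complex.exp (θ * Complex.I)) /
      riemannZeta (1 / 2 + r * Complex.exp (θ * Complex.I))‖ ≤ C * Real.exp (-(1 / 4) * r) := by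
  obtain ⟨C, hC, h⟩ := exists_norm_logDeriv_riemannZeta_le
  refine ⟨C, hC, fun r hr θ hθ => ?_⟩
  have hcos := seven_div_eight_le_cos (hθ.trans sectorAngle_le)
  have hre : (1 / 2 + r * Complex.exp (θ * Complex.I)).re = 1 / 2 + r * Real.cos θ := by
    rw [Complex.add_re, mul_exp_mul_I_re]; norm_num
  have h1 : r / 2 + 2 ≤ (1 / 2 + r * Complex.exp (θ * Complex.I)).re := by rw [hre]; nlinarith
  refine (h _ (by linarith)).trans ?_
  gcongr
  linarith

theorem ofReal_mul_exp_ne_half {r θ : ℝ} (hr : 0 ≤ r) (h : r ≠ 1 / 2) :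
    (r : ℂ) * Complex.exp (θ * Complex.I) ≠ 1 / 2 := by
  intro h1
  have h2 := congrArg norm h1
  rw [norm_ofReal_mul_exp hr] at h2
  norm_num at h2
  exact h (by linarith)

/-- The decay is only 1/r because of the added polar term; ζ'/ζ itself is exponentially small. -/
theorem exists_norm_zetaLogDeriv_sector_le : ∃ C : ℝ, 0 < C ∧ ∀ r : ℝ, 0 ≤ r → ∀ θ : ℝ,
    |θ| ≤ sectorAngle → ‖zetaLogDeriv (r * Complex.exp (θ * Complex.I))‖ ≤ C / (1 + r) := by
  obtain ⟨C, hC, h⟩ := exists_norm_logDeriv_zeta_sector_le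
  have hK : IsCompact (Set.Icc (0 : ℝ) 4 ×ˢ Set.Icc (-sectorAngle) sectorAngle) :=
    isCompact_Icc.prod isCompact_Icc
  obtain ⟨B, hB⟩ := hK.exists_bound_of_continuousOn
    (f := fun p : ℝ × ℝ => zetaLogDeriv (p.1 * Complex.exp (p.2 * Complex.I)))
    (fun p hp => (ContinuousAt.comp
      (f := fun p : ℝ × ℝ => (p.1 : ℂ) * Complex.exp (p.2 * Complex.I))
      (differentiableAt_zetaLogDeriv_sector hp.1.1 (abs_le.2 hp.2)).continuousAt
      (by fun_prop)).continuousWithinAt)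
  refine ⟨|B| * 5 + 4 * C + 2, by positivity, fun r hr θ hθ => ?_⟩
  rw [le_div_iff₀ (by linarith)]
  rcases le_total r 4 with h4 | h4
  · have h1 := (hB (r, θ) ⟨⟨hr, h4⟩, abs_le.1 hθ⟩).trans (le_abs_self B)
    have h2 : ‖zetaLogDeriv (r * Complex.exp (θ * Complex.I))‖ * (1 + r) ≤ |B| * 5 := by
      gcongr
      linarith
    linarith
  · have hne := ofReal_mul_exp_ne_half (θ := θ) hr (by linarith : r ≠ 1 / 2)
    rw [zetaLogDeriv_eq hne (riemannZeta₁_ne_zero_of_abs_le_sectorAngle hr hθ)]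
    have h1 := h r h4 θ hθ
    have h2 : (1 + r) / 2 ≤ ‖(r : ℂ) * Complex.exp (θ * Complex.I) - 1 / 2‖ := by
      have := norm_sub_norm_le ((r : ℂ) * Complex.exp (θ * Complex.I)) (1 / 2)
      rw [norm_ofReal_mul_exp hr] at this
      norm_num at this ⊢
      linarith
    have h3 : ‖1 / ((r : ℂ) * Complex.exp (θ * Complex.I) - 1 / 2)‖ ≤ 2 / (1 + r) := by
      rw [norm_div, norm_one, div_le_div_iff₀ (by linarith) (by linarith)]
      linarith
    have h5 : Real.exp (-(1 / 4) * r) ≤ 4 / (1 + r) := by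
      have h6 := Real.add_one_le_exp (1 / 4 * r)
      rw [neg_mul, Real.exp_neg, ← one_div, div_le_div_iff₀ (Real.exp_pos _) (by linarith)]
      linarith
    have h7 := (norm_add_le _ _).trans (add_le_add (h1.trans
      (mul_le_mul_of_nonneg_left h5 hC.le)) h3)
    refine (mul_le_mul_of_nonneg_right h7 (by linarith)).trans ?_
    have h8 : (C * (4 / (1 + r)) + 2 / (1 + r)) * (1 + r) = 4 * C + 2 := by
      field_simp
    rw [h8]
    linarith [abs_nonneg B]

theorem exists_norm_zetaLogDeriv_ofReal_le : ∃ C : ℝ, 0 < C ∧ ∀ t : ℝ, 0 ≤ t →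
    ‖zetaLogDeriv t‖ ≤ C / (1 + t) := by
  obtain ⟨C, hC, h⟩ := exists_norm_zetaLogDeriv_sector_le
  exact ⟨C, hC, fun t ht => by simpa using h t ht 0 (by simpa using sectorAngle_pos.le)⟩

theorem exists_norm_deriv_zetaLogDeriv_le : ∃ C : ℝ, 0 < C ∧ ∀ t : ℝ, 0 ≤ t →
    ‖deriv zetaLogDeriv t‖ ≤ C / (1 + t) ^ 2 := by
  obtain ⟨C, hC, h⟩ := exists_norm_logDeriv_riemannZeta_le
  have hcont : ContinuousOn (fun t : ℝ => deriv zetaLogDeriv t) (Set.Icc 0 4) := fun t ht =>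
    (ContinuousAt.comp (f := fun t : ℝ => (t : ℂ))
      (analyticAt_zetaLogDeriv_ofReal ht.1).deriv.continuousAt (by fun_prop)).continuousWithinAt
  obtain ⟨B, hB⟩ := isCompact_Icc.exists_bound_of_continuousOn hcont
  refine ⟨|B| * 25 + 64 * C + 4, by positivity, fun t ht => ?_⟩
  rw [le_div_iff₀ (by positivity)]
  rcases le_total t 4 with h4 | h4
  · have h1 := (hB t ⟨ht, h4⟩).trans (le_abs_self B)
    have h2 : ‖deriv zetaLogDeriv t‖ * (1 + t) ^ 2 ≤ |B| * 25 := by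
      gcongr
      nlinarith
    linarith
  · set l : ℂ → ℂ := fun z => deriv riemannZeta (1 / 2 + z) / riemannZeta (1 / 2 + z) with hl
    have hz1 : ∀ z : ℂ, 2 ≤ z.re → riemannZeta₁ (1 / 2 + z) ≠ 0 ∧ z ≠ 1 / 2 := by
      intro z hz
      refine ⟨riemannZeta₁_ne_zero_of_one_le_re (by norm_num; linarith), ?_⟩
      rintro rfl
      norm_num at hz
    have hl1 : ∀ z : ℂ, 2 ≤ z.re → l z = zetaLogDeriv z - 1 / (z - 1 / 2) := by
      intro z hz
      rw [zetaLogDeriv_eq (hz1 z hz).2 (hz1 z hz).1]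
      ring
    have hev : ∀ z : ℂ, 2 < z.re → l =ᶠ[𝓝 z] fun z => zetaLogDeriv z - 1 / (z - 1 / 2) := by
      intro z hz
      filter_upwards [(isOpen_lt continuous_const Complex.continuous_re).mem_nhds hz] with w hw
      exact hl1 w (le_of_lt hw)
    have hd : ∀ z : ℂ, 2 < z.re → HasDerivAt l (deriv zetaLogDeriv z + 1 / (z - 1 / 2) ^ 2) z := by
      intro z hz
      have h1 := (analyticAt_zetaLogDeriv (hz1 z hz.le).1).differentiableAt.hasDerivAt
      have h3 : z - 1 / 2 ≠ 0 := sub_ne_zero.2 (hz1 z hz.le).2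
      have h2 : HasDerivAt (fun z : ℂ => 1 / (z - 1 / 2)) (-1 / (z - 1 / 2) ^ 2) z := by
        simpa [Function.comp_def] using ((hasDerivAt_id z).sub_const (1 / 2 : ℂ)).fun_inv h3
      refine ((h1.sub h2).congr_of_eventuallyEq (hev z hz)).congr_deriv ?_
      ring
    have hsub : ∀ z : ℂ, z ∈ Metric.closedBall (t : ℂ) 1 → t - 1 ≤ z.re := by
      intro z hz
      have h1 := (Complex.abs_re_le_norm (z - t)).trans (by simpa [dist_eq_norm] using hz)
      have := (abs_le.1 h1).1
      simp at this
      linarith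
    -- Cauchy's estimate on the unit circle about `t`. The real part drops by at most 1, which is
    -- absorbed in passing from the rate 1/2 to 1/4.
    have hcauchy : ‖deriv l t‖ ≤ C * Real.exp (-(1 / 4) * t) / 1 := by
      refine Complex.norm_deriv_le_of_forall_mem_sphere_norm_le zero_lt_one ?_ ?_
      · refine DifferentiableOn.diffContOnCl fun z hz => ?_
        rw [closure_ball _ one_ne_zero] at hz
        exact (hd z (by have := hsub z hz; linarith)).differentiableAt.differentiableWithinAt
      · intro z hz
        have h1 := hsub z (Metric.sphere_subset_closedBall hz)
        have hre : (1 / 2 + z).re = 1 / 2 + z.re := by norm_num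
        refine (h (1 / 2 + z) (by rw [hre]; linarith)).trans ?_
        gcongr
        rw [hre]
        linarith
    rw [div_one, (hd t (by simpa using by linarith)).deriv] at hcauchy
    have h5 : Real.exp (-(1 / 4) * t) ≤ 64 / (1 + t) ^ 2 := by
      have h6 := Real.add_one_le_exp (1 / 8 * t)
      have h7 : Real.exp (-(1 / 4) * t) = (Real.exp (1 / 8 * t) ^ 2)⁻¹ := by
        rw [← Real.exp_nat_mul, ← Real.exp_neg]; push_cast; ring_nf
      rw [h7, ← one_div, div_le_div_iff₀ (by positivity) (by positivity)]
      have h8 : (1 / 8 * t + 1) ^ 2 ≤ Real.exp (1 / 8 * t) ^ 2 := by gcongr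
      nlinarith
    have h9 : ‖1 / ((t : ℂ) - 1 / 2) ^ 2‖ ≤ 4 / (1 + t) ^ 2 := by
      have : ‖(t : ℂ) - 1 / 2‖ = t - 1 / 2 := by
        rw [show (t : ℂ) - 1 / 2 = ((t - 1 / 2 : ℝ) : ℂ) by push_cast; ring, Complex.norm_real,
          Real.norm_of_nonneg (by linarith)]
      rw [norm_div, norm_one, norm_pow, this, div_le_div_iff₀ (by nlinarith) (by positivity)]
      nlinarith
    have h10 : ‖deriv zetaLogDeriv t‖ ≤ C * (64 / (1 + t) ^ 2) + 4 / (1 + t) ^ 2 := by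
      calc ‖deriv zetaLogDeriv t‖ = ‖(deriv zetaLogDeriv t + 1 / ((t : ℂ) - 1 / 2) ^ 2) -
            1 / ((t : ℂ) - 1 / 2) ^ 2‖ := by rw [add_sub_cancel_right]
        _ ≤ _ := (norm_sub_le _ _).trans (add_le_add (hcauchy.trans (by gcongr)) h9)
    refine (mul_le_mul_of_nonneg_right h10 (by positivity)).trans ?_
    have h11 : (C * (64 / (1 + t) ^ 2) + 4 / (1 + t) ^ 2) * (1 + t) ^ 2 = 64 * C + 4 := by
      field_simp
    rw [h11]
    linarith [abs_nonneg B]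

/-! ### Removal of the pole at 1/2 and the integrals along rays. -/

/-- The kernel with residues `±1` at `±1/2`. -/
noncomputable def polarKernel (t : ℂ) : ℂ := 1 / (t ^ 2 - 1 / 4)

/-- The function `t ^ (-2σ) ζ'/ζ(1/2 + t)`, with its pole at `1/2` removed by means of
`polarKernel`. -/
noncomputable def reducedIntegrand (σ t : ℂ) : ℂ :=
  t ^ (-2 * σ) * zetaLogDeriv t -
    dslope (fun t : ℂ => t ^ (-2 * σ) - 2 ^ (2 * σ) / (t + 1 / 2)) (1 / 2) t

theorem half_cpow_neg (a : ℂ) : (1 / 2 : ℂ) ^ (-a) = 2 ^ a := by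
  have h : (2 : ℂ).arg ≠ Real.pi := by
    rw [show (2 : ℂ) = ((2 : ℝ) : ℂ) by norm_num, Complex.arg_ofReal_of_nonneg (by norm_num)]
    exact Real.pi_ne_zero.symm
  rw [one_div, Complex.inv_cpow _ _ h, Complex.cpow_neg, inv_inv]

/-- At t = 1/2, ζ'/ζ(1/2 + t) has residue -1 and t^(-2σ) equals 2^(2σ), so 2^(2σ) `polarKernel`
cancels the pole. In the definition, the function under `dslope` vanishes at 1/2, so its difference
quotient is holomorphic. A kernel of size t⁻² at infinity needs no restriction on σ there. -/
theorem reducedIntegrand_eq {σ t : ℂ} (ht : t ≠ 1 / 2) (ht' : t + 1 / 2 ≠ 0)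
    (h : riemannZeta₁ (1 / 2 + t) ≠ 0) :
    reducedIntegrand σ t = mellinIntegrand σ t + 2 ^ (2 * σ) * polarKernel t := by
  have h1 : t - 1 / 2 ≠ 0 := sub_ne_zero.2 ht
  have h2 : (1 / 2 : ℂ) ^ (-2 * σ) = 2 ^ (2 * σ) := by rw [neg_mul, half_cpow_neg]
  rw [reducedIntegrand, mellinIntegrand, polarKernel, dslope_of_ne _ ht, slope_def_field,
    zetaLogDeriv_eq ht h, h2, show t ^ 2 - 1 / 4 = (t - 1 / 2) * (t + 1 / 2) by ring]
  have h3 : (1 / 2 + 1 / 2 : ℂ) = 1 := by norm_num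
  rw [h3]
  generalize hu : t - 1 / 2 = u at h1
  generalize hv : t + 1 / 2 = v at ht'
  generalize t ^ (-2 * σ) = a
  field_simp
  have : v = u + 1 := by rw [← hu, ← hv]; ring
  rw [this]
  ring

theorem mul_exp_re_pos {r θ : ℝ} (hr : 0 < r) (hθ : |θ| ≤ 1 / 2) :
    0 < ((r : ℂ) * Complex.exp (θ * Complex.I)).re := by
  rw [mul_exp_mul_I_re]
  have := seven_div_eight_le_cos hθ
  positivity

theorem differentiableAt_cpow_of_re_pos {t : ℂ} (ht : 0 < t.re) (a : ℂ) :
    DifferentiableAt ℂ (fun t : ℂ => t ^ a) t :=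
  differentiableAt_id.cpow_const (Or.inl ht)

theorem add_half_ne_zero_of_re_pos {t : ℂ} (ht : 0 < t.re) : t + 1 / 2 ≠ 0 := by
  intro h
  have := congrArg Complex.re h
  norm_num at this
  linarith

theorem differentiableAt_reducedIntegrand {r θ : ℝ} (σ : ℂ) (hr : 0 < r) (hθ : |θ| ≤ sectorAngle) :
    DifferentiableAt ℂ (reducedIntegrand σ) (r * Complex.exp (θ * Complex.I)) := by
  have hre := mul_exp_re_pos hr (hθ.trans sectorAngle_le)
  refine ((differentiableAt_cpow_of_re_pos hre _).mul
    (differentiableAt_zetaLogDeriv_sector hr.le hθ)).sub ?_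
  have hopen : IsOpen {t : ℂ | 0 < t.re} := isOpen_lt continuous_const Complex.continuous_re
  have h1 : DifferentiableOn ℂ (dslope (fun t : ℂ => t ^ (-2 * σ) - 2 ^ (2 * σ) / (t + 1 / 2))
      (1 / 2)) {t : ℂ | 0 < t.re} := by
    rw [Complex.differentiableOn_dslope (hopen.mem_nhds (by norm_num))]
    intro t ht
    have h0 : t + 1 / 2 ≠ 0 := add_half_ne_zero_of_re_pos ht
    exact ((differentiableAt_cpow_of_re_pos ht _).sub ((differentiableAt_const _).div
      (differentiableAt_id.add_const _) h0)).differentiableWithinAt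
  exact h1.differentiableAt (hopen.mem_nhds hre)

theorem exists_norm_logDeriv_zeta_sector_le_const : ∃ C : ℝ, 0 < C ∧ ∀ r : ℝ, 0 < r → r ≤ 1 / 4 →
    ∀ θ : ℝ, |θ| ≤ sectorAngle →
    ‖deriv riemannZeta (1 / 2 + r * Complex.exp (θ * Complex.I)) /
      riemannZeta (1 / 2 + r * Complex.exp (θ * Complex.I))‖ ≤ C := by
  obtain ⟨C, hC, h⟩ := exists_norm_zetaLogDeriv_sector_le
  refine ⟨C + 4, by positivity, fun r hr h4 θ hθ => ?_⟩
  have hne := ofReal_mul_exp_ne_half (θ := θ) hr.le (by linarith : r ≠ 1 / 2)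
  have h1 := zetaLogDeriv_eq hne (riemannZeta₁_ne_zero_of_abs_le_sectorAngle hr.le hθ)
  have h2 : 1 / 4 ≤ ‖(r : ℂ) * Complex.exp (θ * Complex.I) - 1 / 2‖ := by
    have := norm_sub_norm_le (1 / 2 : ℂ) ((r : ℂ) * Complex.exp (θ * Complex.I))
    rw [norm_ofReal_mul_exp hr.le, norm_sub_rev] at this
    norm_num at this ⊢
    linarith
  have h3 : ‖1 / ((r : ℂ) * Complex.exp (θ * Complex.I) - 1 / 2)‖ ≤ 4 := by
    rw [norm_div, norm_one, div_le_iff₀ (by linarith)]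
    linarith
  have h5 := h r hr.le θ hθ
  have h6 : C / (1 + r) ≤ C := div_le_self hC.le (by linarith)
  rw [← sub_eq_iff_eq_add] at h1
  rw [← h1]
  exact (norm_sub_le _ _).trans (add_le_add (h5.trans h6) h3)

theorem norm_polarKernel_le_of_le {r θ : ℝ} (hr : 0 ≤ r) (h : r ≤ 1 / 4) :
    ‖polarKernel (r * Complex.exp (θ * Complex.I))‖ ≤ 6 := by
  have h1 := norm_sub_norm_le (1 / 4 : ℂ) (((r : ℂ) * Complex.exp (θ * Complex.I)) ^ 2)
  rw [norm_pow, norm_ofReal_mul_exp hr, norm_sub_rev] at h1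
  rw [polarKernel, norm_div, norm_one]
  have h2 : (1 : ℝ) / 6 ≤ ‖((r : ℂ) * Complex.exp (θ * Complex.I)) ^ 2 - 1 / 4‖ := by
    refine le_trans ?_ h1
    norm_num
    nlinarith
  rw [div_le_iff₀ (by linarith)]
  linarith

theorem norm_polarKernel_le_of_ge {r θ : ℝ} (h : 4 ≤ r) :
    ‖polarKernel (r * Complex.exp (θ * Complex.I))‖ ≤ 2 / r ^ 2 := by
  have hr : 0 ≤ r := by linarith
  have h1 := norm_sub_norm_le (((r : ℂ) * Complex.exp (θ * Complex.I)) ^ 2) (1 / 4 : ℂ)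
  rw [norm_pow, norm_ofReal_mul_exp hr] at h1
  rw [polarKernel, norm_div, norm_one]
  have h2 : r ^ 2 / 2 ≤ ‖((r : ℂ) * Complex.exp (θ * Complex.I)) ^ 2 - 1 / 4‖ := by
    refine le_trans ?_ h1
    norm_num
    nlinarith
  rw [div_le_div_iff₀ (by nlinarith) (by positivity)]
  linarith

theorem exists_exp_neg_mul_rpow_le (b : ℝ) : ∃ C : ℝ, 0 < C ∧ ∀ r : ℝ, 1 ≤ r →
    Real.exp (-(1 / 4) * r) * r ^ b ≤ C := by
  obtain ⟨n, hn⟩ := exists_nat_ge b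
  refine ⟨n.factorial * 4 ^ n, by positivity, fun r hr => ?_⟩
  have h1 : r ^ b ≤ r ^ n := by
    rw [← Real.rpow_natCast]
    exact Real.rpow_le_rpow_of_exponent_le hr hn
  have h2 := Real.pow_div_factorial_le_exp (1 / 4 * r) (by linarith) n
  rw [div_le_iff₀ (by positivity), mul_pow] at h2
  rw [neg_mul, Real.exp_neg, inv_mul_le_iff₀ (Real.exp_pos _)]
  refine h1.trans ?_
  have h3 : (r : ℝ) ^ n = ((1 / 4) ^ n * r ^ n) * 4 ^ n := by
    rw [mul_right_comm, ← mul_pow]; norm_num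
  rw [h3]
  calc (1 / 4) ^ n * r ^ n * 4 ^ n ≤ (Real.exp (1 / 4 * r) * n.factorial) * 4 ^ n := by gcongr
    _ = _ := by ring

theorem reducedIntegrand_ray {σ : ℂ} {r θ : ℝ} (hr : 0 < r) (hr' : r ≠ 1 / 2)
    (hθ : |θ| ≤ sectorAngle) :
    reducedIntegrand σ (r * Complex.exp (θ * Complex.I)) =
      mellinIntegrand σ (r * Complex.exp (θ * Complex.I)) +
        2 ^ (2 * σ) * polarKernel (r * Complex.exp (θ * Complex.I)) :=
  reducedIntegrand_eq (ofReal_mul_exp_ne_half hr.le hr')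
    (add_half_ne_zero_of_re_pos (mul_exp_re_pos hr (hθ.trans sectorAngle_le)))
    (riemannZeta₁_ne_zero_of_abs_le_sectorAngle hr.le hθ)

theorem integral_rayPullback_reducedIntegrand {σ : ℂ} (hσ : σ.re < 1 / 2) {θ₁ θ₂ : ℝ}
    (h1 : -sectorAngle ≤ θ₁) (h12 : θ₁ ≤ θ₂) (h2 : θ₂ ≤ sectorAngle) :
    (∀ θ ∈ Set.Icc θ₁ θ₂, IntegrableOn (rayPullback (reducedIntegrand σ) θ) (Set.Ioi 0)) ∧
      ∫ r in Set.Ioi (0 : ℝ), rayPullback (reducedIntegrand σ) θ₁ r =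
        ∫ r in Set.Ioi (0 : ℝ), rayPullback (reducedIntegrand σ) θ₂ r := by
  have hθ : ∀ θ ∈ Set.Icc θ₁ θ₂, |θ| ≤ sectorAngle := fun θ hθ =>
    abs_le.2 ⟨h1.trans hθ.1, hθ.2.trans h2⟩
  obtain ⟨C, hC, hL0⟩ := exists_norm_logDeriv_zeta_sector_le_const
  obtain ⟨C', hC', hL1⟩ := exists_norm_logDeriv_zeta_sector_le
  obtain ⟨D, hD, hexp⟩ := exists_exp_neg_mul_rpow_le (2 - 2 * σ.re)
  -- Near 0, after multiplication by r, the two parts are O(r^(1 - 2 Re σ)) and O(r); at infinity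
  -- the polar part is O(1/r) and the other decays exponentially.
  set η : ℝ := min 1 (1 - 2 * σ.re) with hη
  set E : ℝ := Real.exp |(-2 * σ).im| with hE
  set A : ℝ := ‖(2 : ℂ) ^ (2 * σ)‖ with hA
  have hE0 : 0 < E := Real.exp_pos _
  have hA0 : 0 ≤ A := norm_nonneg _
  have hre : (-2 * σ).re = -(2 * σ.re) := by simp
  have hcp : ∀ r : ℝ, 0 < r → ∀ θ ∈ Set.Icc θ₁ θ₂,
      ‖((r : ℂ) * Complex.exp (θ * Complex.I)) ^ (-2 * σ)‖ ≤ E * r ^ (-(2 * σ.re)) := by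
    intro r hr θ h
    have := norm_ofReal_mul_exp_cpow_le hr (((hθ θ h).trans sectorAngle_le).trans (by norm_num))
      (-2 * σ)
    rwa [hre] at this
  refine integral_rayPullback_eq (η := η) (C := E * C + E * C' * D + A * 6)
    (lt_min one_pos (by linarith)) h12
    (fun r hr θ h => differentiableAt_reducedIntegrand σ hr (hθ θ h)) (fun r hr hr4 θ h => ?_)
    fun r hr4 θ h => ?_
  · rw [reducedIntegrand_ray hr (by linarith) (hθ θ h)]
    have e1 : r ^ (-(2 * σ.re)) * r ≤ r ^ η := by
      calc r ^ (-(2 * σ.re)) * r = r ^ (1 - 2 * σ.re) := by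
            rw [← Real.rpow_add_one hr.ne']; ring_nf
        _ ≤ r ^ η := Real.rpow_le_rpow_of_exponent_ge hr (by linarith) (min_le_right _ _)
    have e2 : r ≤ r ^ η := by
      calc r = r ^ (1 : ℝ) := (Real.rpow_one r).symm
        _ ≤ r ^ η := Real.rpow_le_rpow_of_exponent_ge hr (by linarith) (min_le_left _ _)
    have e3 : ‖mellinIntegrand σ (r * Complex.exp (θ * Complex.I))‖ ≤
        E * r ^ (-(2 * σ.re)) * C := by
      rw [mellinIntegrand, norm_mul]
      gcongr
      exacts [hcp r hr θ h, hL0 r hr hr4 θ (hθ θ h)]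
    have e4 : ‖2 ^ (2 * σ) * polarKernel (r * Complex.exp (θ * Complex.I))‖ ≤ A * 6 := by
      rw [norm_mul]
      gcongr
      exact norm_polarKernel_le_of_le hr.le hr4
    calc _ ≤ (E * r ^ (-(2 * σ.re)) * C + A * 6) * r := by
          gcongr
          exact (norm_add_le _ _).trans (add_le_add e3 e4)
      _ = E * C * (r ^ (-(2 * σ.re)) * r) + A * 6 * r := by ring
      _ ≤ E * C * r ^ η + A * 6 * r ^ η := by gcongr
      _ ≤ E * C * r ^ η + A * 6 * r ^ η + E * C' * D * r ^ η :=
          le_add_of_nonneg_right (by positivity)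
      _ = _ := by ring
  · have hr : 0 < r := by linarith
    rw [reducedIntegrand_ray hr (by linarith) (hθ θ h)]
    have e0 : r⁻¹ ≤ r ^ (-η) := by
      rw [← Real.rpow_neg_one]
      exact Real.rpow_le_rpow_of_exponent_le (by linarith) (neg_le_neg (min_le_left _ _))
    have e1 : r ^ (-(2 * σ.re)) * Real.exp (-(1 / 4) * r) * r ≤ D * r⁻¹ := by
      have h3 := hexp r (by linarith)
      have h4 : r ^ (2 - 2 * σ.re) = r ^ (-(2 * σ.re)) * r * r := by
        rw [← Real.rpow_add_one hr.ne', ← Real.rpow_add_one hr.ne']; ring_nf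
      rw [h4] at h3
      rw [← div_eq_mul_inv, le_div_iff₀ hr]
      linarith
    have e3 : ‖mellinIntegrand σ (r * Complex.exp (θ * Complex.I))‖ ≤
        E * r ^ (-(2 * σ.re)) * (C' * Real.exp (-(1 / 4) * r)) := by
      rw [mellinIntegrand, norm_mul]
      gcongr
      exacts [hcp r hr θ h, hL1 r hr4 θ (hθ θ h)]
    have e4 : ‖2 ^ (2 * σ) * polarKernel (r * Complex.exp (θ * Complex.I))‖ ≤ A * (2 / r ^ 2) := by
      rw [norm_mul]
      gcongr
      exact norm_polarKernel_le_of_ge hr4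
    calc _ ≤ (E * r ^ (-(2 * σ.re)) * (C' * Real.exp (-(1 / 4) * r)) + A * (2 / r ^ 2)) * r := by
          gcongr
          exact (norm_add_le _ _).trans (add_le_add e3 e4)
      _ = E * C' * (r ^ (-(2 * σ.re)) * Real.exp (-(1 / 4) * r) * r) + A * 2 * r⁻¹ := by
          field_simp
      _ ≤ E * C' * (D * r⁻¹) + A * 6 * r⁻¹ := by gcongr; norm_num
      _ = (E * C' * D + A * 6) * r⁻¹ := by ring
      _ ≤ (E * C' * D + A * 6) * r ^ (-η) := by gcongr
      _ ≤ (E * C' * D + A * 6) * r ^ (-η) + E * C * r ^ (-η) :=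
          le_add_of_nonneg_right (by positivity)
      _ = _ := by ring

theorem integrableOn_rayPullback_polarKernel {θ : ℝ} (h0 : θ ≠ 0) (h1 : |θ| ≤ 1) :
    IntegrableOn (rayPullback polarKernel θ) (Set.Ioi 0) := by
  -- The rotation lemma is used with θ₁ = θ₂, for its integrability conclusion only.
  refine (integral_rayPullback_eq (η := 1) (C := 6) (θ₁ := θ) (θ₂ := θ) one_pos le_rfl
    (fun r hr φ h => ?_) (fun r hr hr4 φ h => ?_) fun r hr4 φ h => ?_).1 θ ⟨le_rfl, le_rfl⟩
  · have hφ : φ = θ := le_antisymm h.2 h.1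
    subst hφ
    have hne : ((r : ℂ) * Complex.exp (φ * Complex.I)) ^ 2 - 1 / 4 ≠ 0 := by
      intro h2
      have h3 : ((r : ℂ) * Complex.exp (φ * Complex.I) - 1 / 2) *
          ((r : ℂ) * Complex.exp (φ * Complex.I) + 1 / 2) = 0 := by linear_combination h2
      have him : ((r : ℂ) * Complex.exp (φ * Complex.I)).im ≠ 0 := by
        rw [mul_exp_mul_I_im]
        refine mul_ne_zero hr.ne' fun h4 => h0 ?_
        have h5 := abs_le.1 h1
        exact (Real.sin_eq_zero_iff_of_lt_of_lt (by linarith [Real.pi_gt_three])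
          (by linarith [Real.pi_gt_three])).1 h4
      rcases mul_eq_zero.1 h3 with h4 | h4
      · apply him
        have := congrArg Complex.im h4
        simpa using this
      · apply him
        have := congrArg Complex.im h4
        simpa using this
    unfold polarKernel
    exact (differentiableAt_const _).div ((differentiableAt_id.pow 2).sub_const _) hne
  · rw [Real.rpow_one]
    gcongr
    exact norm_polarKernel_le_of_le hr.le hr4
  · have hr : 0 < r := by linarith
    rw [Real.rpow_neg_one]
    calc _ ≤ 2 / r ^ 2 * r := by gcongr; exact norm_polarKernel_le_of_ge hr4
      _ = 2 * r⁻¹ := by field_simp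
      _ ≤ _ := by gcongr; norm_num

theorem integral_rayPullback_polarKernel {θ : ℝ} (h0 : 0 < θ) (h1 : θ ≤ 1) :
    ∫ r in Set.Ioi (0 : ℝ), rayPullback polarKernel θ r = -(Real.pi * Complex.I) := by
  have hpi := Real.pi_gt_three
  have hsin : 0 < Real.sin θ := Real.sin_pos_of_pos_of_lt_pi h0 (by linarith)
  set e : ℂ := Complex.exp (θ * Complex.I) with he
  have heim : e.im = Real.sin θ := by rw [he, Complex.exp_ofReal_mul_I_im]
  have hs1 : ∀ r : ℝ, 0 ≤ r → (1 / 2 - r * e) ∈ Complex.slitPlane := by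
    intro r hr
    rcases hr.eq_or_lt with rfl | hr
    · left; norm_num
    · right
      simp [heim, hr.ne', hsin.ne']
  have hs2 : ∀ r : ℝ, 0 ≤ r → (1 / 2 + r * e) ∈ Complex.slitPlane := by
    intro r hr
    rcases hr.eq_or_lt with rfl | hr
    · left; norm_num
    · right
      simp [heim, hr.ne', hsin.ne']
  have hlin : ∀ r : ℝ, HasDerivAt (fun r : ℝ => (r : ℂ) * e) e r := fun r => by
    simpa using (Complex.ofRealCLM.hasDerivAt (x := r)).mul_const e
  -- A primitive along the ray. At infinity it tends to log(-e^(iθ)) - log(e^(iθ)), and for 0 < θ ≤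
  -- 1 the principal argument of -e^(iθ) is θ - π, so the limit is -πi.
  set F : ℝ → ℂ := fun r => Complex.log (1 / 2 - r * e) - Complex.log (1 / 2 + r * e) with hF
  have hd : ∀ r : ℝ, 0 ≤ r → HasDerivAt F (rayPullback polarKernel θ r) r := by
    intro r hr
    have d1 := ((hlin r).const_sub (1 / 2)).clog_real (hs1 r hr)
    have d2 := ((hlin r).const_add (1 / 2)).clog_real (hs2 r hr)
    refine (d1.sub d2).congr_deriv ?_
    have n1 := Complex.slitPlane_ne_zero (hs1 r hr)
    have n2 := Complex.slitPlane_ne_zero (hs2 r hr)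
    rw [rayPullback, polarKernel, ← he,
      show ((r : ℂ) * e) ^ 2 - 1 / 4 = -((1 / 2 - r * e) * (1 / 2 + r * e)) by ring]
    have h3 : (1 / 2 - (r : ℂ) * e) + (1 / 2 + r * e) = 1 := by ring
    generalize (1 / 2 - (r : ℂ) * e) = u at *
    generalize (1 / 2 + (r : ℂ) * e) = v at *
    field_simp
    linear_combination (-e) * h3
  have hlog : ∀ u : ℂ, u ∈ Complex.slitPlane → Tendsto (fun r : ℝ =>
      Complex.log (((1 / 2 * r⁻¹ : ℝ) : ℂ) + u)) atTop (𝓝 (Complex.log u)) := by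
    intro u hu
    have h2 : Tendsto (fun r : ℝ => 1 / 2 * r⁻¹) atTop (𝓝 (1 / 2 * 0)) :=
      tendsto_inv_atTop_zero.const_mul _
    have h3 : Tendsto (fun r : ℝ => ((1 / 2 * r⁻¹ : ℝ) : ℂ) + u) atTop (𝓝 u) := by
      have := ((Complex.continuous_ofReal.tendsto _).comp h2).add_const u
      simpa using this
    exact (continuousAt_clog hu).tendsto.comp h3
  have hsplit : ∀ r : ℝ, 0 < r → ∀ u : ℂ, ((1 / 2 * r⁻¹ : ℝ) : ℂ) + u ≠ 0 →
      Complex.log (1 / 2 + r * u) =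
        Real.log r + Complex.log (((1 / 2 * r⁻¹ : ℝ) : ℂ) + u) := by
    intro r hr u hu
    rw [← Complex.log_ofReal_mul hr hu]
    congr 1
    have : (r : ℂ) ≠ 0 := Complex.ofReal_ne_zero.2 hr.ne'
    push_cast
    field_simp
  have hlim : Tendsto F atTop (𝓝 (-(Real.pi * Complex.I))) := by
    have hm1 : -e ∈ Complex.slitPlane := by right; simp [heim, hsin.ne']
    have hm2 : e ∈ Complex.slitPlane := by right; simp [heim, hsin.ne']
    have h2 := (hlog (-e) hm1).sub (hlog e hm2)
    have hle : Complex.log e = θ * Complex.I := by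
      rw [he, Complex.log_exp] <;> simp <;> linarith
    have hlne : Complex.log (-e) = (θ - Real.pi) * Complex.I := by
      have : -e = Complex.exp (((θ - Real.pi : ℝ) : ℂ) * Complex.I) := by
        push_cast
        rw [he, sub_mul, Complex.exp_sub, Complex.exp_pi_mul_I]; ring
      rw [this, Complex.log_exp] <;> simp <;> linarith
    rw [hle, hlne] at h2
    have h3 : ((θ : ℂ) - Real.pi) * Complex.I - θ * Complex.I = -(Real.pi * Complex.I) := by ring
    rw [h3] at h2
    refine h2.congr' ?_
    filter_upwards [eventually_gt_atTop 0] with r hr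
    have him : ∀ u : ℂ, u.im ≠ 0 → ((1 / 2 * r⁻¹ : ℝ) : ℂ) + u ≠ 0 := by
      intro u hu h
      apply hu
      have := congrArg Complex.im h
      rwa [Complex.add_im, Complex.ofReal_im, zero_add, Complex.zero_im] at this
    rw [hF]
    have e1 := hsplit r hr (-e) (him _ (by simp [heim, hsin.ne']))
    have e2 := hsplit r hr e (him _ (by simp [heim, hsin.ne']))
    rw [mul_neg, ← sub_eq_add_neg] at e1
    simp only [e1, e2]
    ring
  have h := integral_Ioi_of_hasDerivAt_of_tendsto
    (hd 0 le_rfl).continuousAt.continuousWithinAt (fun r hr => hd r (le_of_lt hr))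
    (integrableOn_rayPullback_polarKernel h0.ne' (by rwa [abs_of_pos h0])) hlim
  rw [h, hF]
  simp

theorem integral_rayPullback_polarKernel_neg {θ : ℝ} (h0 : 0 < θ) (h1 : θ ≤ 1) :
    ∫ r in Set.Ioi (0 : ℝ), rayPullback polarKernel (-θ) r = Real.pi * Complex.I := by
  have h := congrArg (starRingEnd ℂ) (integral_rayPullback_polarKernel h0 h1)
  rw [← integral_conj] at h
  simp only [map_neg, map_mul, Complex.conj_I, Complex.conj_ofReal, mul_neg, neg_neg] at h
  rw [← h]
  congr 1
  funext r
  simp only [rayPullback, polarKernel, map_mul, map_div₀, map_sub, map_pow, map_one,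
    Complex.conj_ofReal, ← Complex.exp_conj, Complex.conj_I, Complex.ofReal_neg, neg_mul, mul_neg]
  congr 3
  rw [map_ofNat (starRingEnd ℂ) 4]

/-- The principal value of `∫ t ^ (-2σ) ζ'/ζ(1/2 + t) dt` over the positive half-line. -/
noncomputable def reducedIntegral (σ : ℂ) : ℂ := ∫ t in Set.Ioi (0 : ℝ), reducedIntegrand σ t

theorem rayPullback_zero (f : ℂ → ℂ) : rayPullback f 0 = fun r : ℝ => f r := by
  funext r; simp [rayPullback]

theorem integrableOn_reducedIntegrand {σ : ℂ} (hσ : σ.re < 1 / 2) :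
    IntegrableOn (fun t : ℝ => reducedIntegrand σ t) (Set.Ioi 0) := by
  rw [← rayPullback_zero]
  exact (integral_rayPullback_reducedIntegrand hσ (θ₁ := 0) (θ₂ := 0)
    (by linarith [sectorAngle_pos]) le_rfl sectorAngle_pos.le).1 0 ⟨le_rfl, le_rfl⟩

theorem ae_ne_half : ∀ᵐ r : ℝ ∂volume, r ≠ 1 / 2 := by
  simp [ae_iff]

theorem rayPullback_mellinIntegrand_ae_eq {θ : ℝ} (σ : ℂ) (hθ : |θ| ≤ sectorAngle) :
    rayPullback (mellinIntegrand σ) θ =ᵐ[volume.restrict (Set.Ioi 0)]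
      fun r => rayPullback (reducedIntegrand σ) θ r -
        2 ^ (2 * σ) * rayPullback polarKernel θ r := by
  filter_upwards [ae_restrict_mem measurableSet_Ioi, ae_restrict_of_ae ae_ne_half] with r hr hne
  simp only [rayPullback]
  rw [reducedIntegrand_ray hr hne hθ]
  ring

/-- The reduced integral is the same along all rays of the sector. The rays thus differ only through
the polar kernel, whose integrals ∓πi are half residues of opposite sign. -/
theorem integral_rayPullback_mellinIntegrand {σ : ℂ} (hσ : σ.re < 1 / 2) {θ : ℝ} (h0 : 0 < θ)
    (h1 : θ ≤ sectorAngle) :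
    (IntegrableOn (rayPullback (mellinIntegrand σ) θ) (Set.Ioi 0) ∧
      ∫ r in Set.Ioi (0 : ℝ), rayPullback (mellinIntegrand σ) θ r =
        reducedIntegral σ + Real.pi * Complex.I * 2 ^ (2 * σ)) ∧
    (IntegrableOn (rayPullback (mellinIntegrand σ) (-θ)) (Set.Ioi 0) ∧
      ∫ r in Set.Ioi (0 : ℝ), rayPullback (mellinIntegrand σ) (-θ) r =
        reducedIntegral σ - Real.pi * Complex.I * 2 ^ (2 * σ)) := by
  have hle := sectorAngle_le
  have ha : |θ| ≤ sectorAngle := by rwa [abs_of_pos h0]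
  have ha' : |(-θ)| ≤ sectorAngle := by rwa [abs_neg]
  have hP : reducedIntegral σ = ∫ r in Set.Ioi (0 : ℝ), rayPullback (reducedIntegrand σ) 0 r := by
    rw [rayPullback_zero]; rfl
  have r1 := integral_rayPullback_reducedIntegrand hσ (θ₁ := 0) (θ₂ := θ)
    (by linarith) h0.le h1
  have r2 := integral_rayPullback_reducedIntegrand hσ (θ₁ := -θ) (θ₂ := 0)
    (by linarith) (by linarith) (by linarith)
  have i1 := r1.1 θ ⟨h0.le, le_rfl⟩
  have i2 := r2.1 (-θ) ⟨le_rfl, by linarith⟩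
  have k1 := (integrableOn_rayPullback_polarKernel h0.ne' (by linarith)).const_mul (2 ^ (2 * σ))
  have k2 := (integrableOn_rayPullback_polarKernel (neg_ne_zero.2 h0.ne')
    (by linarith)).const_mul (2 ^ (2 * σ))
  refine ⟨⟨(i1.sub k1).congr (rayPullback_mellinIntegrand_ae_eq σ ha).symm, ?_⟩,
    (i2.sub k2).congr (rayPullback_mellinIntegrand_ae_eq σ ha').symm, ?_⟩
  · rw [integral_congr_ae (rayPullback_mellinIntegrand_ae_eq σ ha), integral_sub i1 k1,
      integral_const_mul, integral_rayPullback_polarKernel h0 (by linarith), ← r1.2, hP]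
    ring
  · rw [integral_congr_ae (rayPullback_mellinIntegrand_ae_eq σ ha'), integral_sub i2 k2,
      integral_const_mul, integral_rayPullback_polarKernel_neg h0 (by linarith), r2.2, hP]
    ring

/-! ### Principal values at t = 1/2. -/

theorem polarKernel_ofReal (t : ℝ) : polarKernel t = ((1 / (t ^ 2 - 1 / 4) : ℝ) : ℂ) := by
  simp [polarKernel]

theorem hasDerivAt_log_sub_log {t : ℝ} (h1 : t - 1 / 2 ≠ 0) (h2 : t + 1 / 2 ≠ 0) :
    HasDerivAt (fun t : ℝ => Real.log (t - 1 / 2) - Real.log (t + 1 / 2))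
      (1 / (t ^ 2 - 1 / 4)) t := by
  have d1 := ((hasDerivAt_id t).sub_const (1 / 2)).log h1
  have d2 := ((hasDerivAt_id t).add_const (1 / 2)).log h2
  refine (d1.sub d2).congr_deriv ?_
  simp only [id]
  rw [show t ^ 2 - 1 / 4 = (t - 1 / 2) * (t + 1 / 2) by ring]
  generalize hu : t - 1 / 2 = u at h1
  generalize hv : t + 1 / 2 = v at h2
  field_simp
  rw [← hu, ← hv]; ring

theorem hasPrincipalValue_polarKernel :
    HasPrincipalValue (fun t : ℝ => polarKernel t) (1 / 2) 0 := by
  -- `Real.log` takes the logarithm of the absolute value, so `F` is a primitive on both sides of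
  -- 1/2. It vanishes at 0 and at infinity, and the excised integral is log(1 + δ) - log(1 - δ).
  set F : ℝ → ℝ := fun t => Real.log (t - 1 / 2) - Real.log (t + 1 / 2) with hF
  set p : ℝ → ℝ := fun t => 1 / (t ^ 2 - 1 / 4) with hp
  have hset : ∀ δ : ℝ, 0 < δ → δ < 1 / 2 → Set.Ioi (0 : ℝ) \ Set.Ioo (1 / 2 - δ) (1 / 2 + δ) =
      Set.Ioc 0 (1 / 2 - δ) ∪ Set.Ici (1 / 2 + δ) := by
    intro δ h0 h1
    ext t
    simp only [Set.mem_sdiff, Set.mem_Ioi, Set.mem_Ioo, not_and, not_lt, Set.mem_union, Set.mem_Ioc,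
      Set.mem_Ici]
    constructor
    · rintro ⟨a, b⟩
      by_cases h : 1 / 2 - δ < t
      · exact Or.inr (b h)
      · exact Or.inl ⟨a, not_lt.1 h⟩
    · rintro (⟨a, b⟩ | a)
      · exact ⟨a, fun h => absurd h (not_lt.2 b)⟩
      · exact ⟨by linarith, fun _ => a⟩
  have hIoi : ∀ δ : ℝ, 0 < δ → IntegrableOn p (Set.Ioi (1 / 2 + δ)) ∧
      ∫ t in Set.Ioi (1 / 2 + δ), p t = 0 - F (1 / 2 + δ) := by
    intro δ h0
    have hd : ∀ t ∈ Set.Ici (1 / 2 + δ), HasDerivAt F (p t) t := fun t ht => by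
      have ht' : 1 / 2 + δ ≤ t := ht
      exact hasDerivAt_log_sub_log (by linarith) (by linarith)
    have hlim : Tendsto F atTop (𝓝 0) := by
      have h1 : Tendsto (fun t : ℝ => Real.log (1 - 1 / (t + 1 / 2))) atTop (𝓝 (Real.log 1)) := by
        refine (Real.continuousAt_log one_ne_zero).tendsto.comp ?_
        have : Tendsto (fun t : ℝ => 1 / (t + 1 / 2)) atTop (𝓝 0) := by
          simp_rw [one_div]
          exact tendsto_inv_atTop_zero.comp (tendsto_atTop_add_const_right _ _ tendsto_id)
        simpa using this.const_sub 1
      rw [Real.log_one] at h1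
      refine h1.congr' ?_
      filter_upwards [eventually_gt_atTop (1 / 2)] with t ht
      have e1 : t - 1 / 2 ≠ 0 := by linarith
      have e2 : t + 1 / 2 ≠ 0 := by linarith
      simp only [hF]
      rw [← Real.log_div e1 e2]
      congr 1
      field_simp
      ring
    have hpos : ∀ t ∈ Set.Ioi (1 / 2 + δ), 0 ≤ p t := fun t ht => by
      have ht' : 1 / 2 + δ < t := ht
      simp only [hp]
      refine div_nonneg zero_le_one ?_
      nlinarith
    exact ⟨integrableOn_Ioi_deriv_of_nonneg' hd hpos hlim,
      integral_Ioi_of_hasDerivAt_of_nonneg' hd hpos hlim⟩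
  have hIoc : ∀ δ : ℝ, 0 < δ → δ < 1 / 2 → IntegrableOn p (Set.Ioc 0 (1 / 2 - δ)) ∧
      ∫ t in Set.Ioc 0 (1 / 2 - δ), p t = F (1 / 2 - δ) - F 0 := by
    intro δ h0 h1
    have hle : (0 : ℝ) ≤ 1 / 2 - δ := by linarith
    have hne : ∀ t ∈ Set.uIcc 0 (1 / 2 - δ), t - 1 / 2 ≠ 0 ∧ t + 1 / 2 ≠ 0 := by
      intro t ht
      rw [Set.uIcc_of_le hle] at ht
      exact ⟨by linarith [ht.2], by linarith [ht.1]⟩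
    have hc : IntervalIntegrable p volume 0 (1 / 2 - δ) := by
      refine ContinuousOn.intervalIntegrable fun t ht => ContinuousAt.continuousWithinAt ?_
      refine continuousAt_const.div (by fun_prop) ?_
      have := mul_ne_zero (hne t ht).1 (hne t ht).2
      intro h
      apply this
      linear_combination h
    refine ⟨hc.1, ?_⟩
    rw [← intervalIntegral.integral_of_le hle]
    exact intervalIntegral.integral_eq_sub_of_hasDerivAt
      (fun t ht => hasDerivAt_log_sub_log (hne t ht).1 (hne t ht).2) hc
  have hint : ∀ δ : ℝ, 0 < δ → δ < 1 / 2 →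
      IntegrableOn p (Set.Ioi (0 : ℝ) \ Set.Ioo (1 / 2 - δ) (1 / 2 + δ)) := by
    intro δ h0 h1
    rw [hset δ h0 h1]
    exact (hIoc δ h0 h1).1.union ((integrableOn_Ici_iff_integrableOn_Ioi).2 (hIoi δ h0).1)
  have hval : ∀ δ : ℝ, 0 < δ → δ < 1 / 2 →
      ∫ t in Set.Ioi (0 : ℝ) \ Set.Ioo (1 / 2 - δ) (1 / 2 + δ), p t =
        Real.log (1 + δ) - Real.log (1 - δ) := by
    intro δ h0 h1
    rw [hset δ h0 h1, setIntegral_union _ measurableSet_Ici (hIoc δ h0 h1).1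
      ((integrableOn_Ici_iff_integrableOn_Ioi).2 (hIoi δ h0).1), (hIoc δ h0 h1).2,
      integral_Ici_eq_integral_Ioi, (hIoi δ h0).2]
    · simp only [hF]
      have e1 : (1 / 2 - δ - 1 / 2 : ℝ) = -δ := by ring
      have e2 : (1 / 2 + δ - 1 / 2 : ℝ) = δ := by ring
      have e3 : (1 / 2 - δ + 1 / 2 : ℝ) = 1 - δ := by ring
      have e4 : (1 / 2 + δ + 1 / 2 : ℝ) = 1 + δ := by ring
      have e5 : (0 - 1 / 2 : ℝ) = -(0 + 1 / 2) := by ring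
      rw [e1, e2, e3, e4, e5, Real.log_neg_eq_log, Real.log_neg_eq_log]
      ring
    · rw [Set.disjoint_left]
      intro t ht ht'
      have a : t ≤ 1 / 2 - δ := ht.2
      have b : 1 / 2 + δ ≤ t := ht'
      linarith
  have hcast : (fun t : ℝ => polarKernel t) = fun t => ((p t : ℝ) : ℂ) :=
    funext polarKernel_ofReal
  rw [hcast]
  refine ⟨fun δ hδ => ?_, ?_⟩
  · refine IntegrableOn.mono_set (Integrable.ofReal (hint (min δ (1 / 4)) (by positivity)
      (lt_of_le_of_lt (min_le_right _ _) (by norm_num)))) ?_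
    refine Set.sdiff_subset_sdiff_right (Set.Ioo_subset_Ioo ?_ ?_)
    · linarith [min_le_left δ (1 / 4)]
    · linarith [min_le_left δ (1 / 4)]
  · have h1 : Tendsto (fun δ : ℝ => ((Real.log (1 + δ) - Real.log (1 - δ) : ℝ) : ℂ)) (𝓝[>] 0)
        (𝓝 0) := by
      have : ContinuousAt (fun δ : ℝ => ((Real.log (1 + δ) - Real.log (1 - δ) : ℝ) : ℂ)) 0 := by
        refine Complex.continuous_ofReal.continuousAt.comp (ContinuousAt.sub ?_ ?_)
        · exact ContinuousAt.log (by fun_prop) (by norm_num)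
        · exact ContinuousAt.log (by fun_prop) (by norm_num)
      have h2 := this.tendsto
      simp only [add_zero, sub_zero, Real.log_one, Complex.ofReal_zero] at h2
      exact h2.mono_left nhdsWithin_le_nhds
    refine h1.congr' ?_
    filter_upwards [Ioo_mem_nhdsGT (show (0 : ℝ) < 1 / 2 by norm_num)] with δ hδ
    rw [← hval δ hδ.1 hδ.2, ← integral_complex_ofReal]

theorem HasPrincipalValue.const_mul {f : ℝ → ℂ} {c : ℝ} {P : ℂ} (h : HasPrincipalValue f c P)
    (a : ℂ) : HasPrincipalValue (fun t => a * f t) c (a * P) := by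
  refine ⟨fun δ hδ => (h.1 δ hδ).const_mul a, ?_⟩
  simp_rw [integral_const_mul]
  exact h.2.const_mul a

theorem HasPrincipalValue.sub {f g : ℝ → ℂ} {c : ℝ} {P Q : ℂ} (hf : HasPrincipalValue f c P)
    (hg : HasPrincipalValue g c Q) : HasPrincipalValue (fun t => f t - g t) c (P - Q) := by
  refine ⟨fun δ hδ => (hf.1 δ hδ).sub (hg.1 δ hδ), (hf.2.sub hg.2).congr' ?_⟩
  filter_upwards [self_mem_nhdsWithin] with δ hδ
  exact (integral_sub (hf.1 δ hδ) (hg.1 δ hδ)).symm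

theorem HasPrincipalValue.congr_ae {f g : ℝ → ℂ} {c : ℝ} {P : ℂ} (hf : HasPrincipalValue f c P)
    (h : f =ᵐ[volume.restrict (Set.Ioi 0)] g) : HasPrincipalValue g c P := by
  have h1 : ∀ δ, f =ᵐ[volume.restrict (Set.Ioi 0 \ Set.Ioo (c - δ) (c + δ))] g := fun δ =>
    ae_restrict_of_ae_restrict_of_subset Set.sdiff_subset h
  refine ⟨fun δ hδ => (hf.1 δ hδ).congr (h1 δ), hf.2.congr fun δ => integral_congr_ae (h1 δ)⟩

theorem hasPrincipalValue_of_integrableOn {f : ℝ → ℂ} (c : ℝ) (hf : IntegrableOn f (Set.Ioi 0)) :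
    HasPrincipalValue f c (∫ t in Set.Ioi (0 : ℝ), f t) := by
  refine ⟨fun δ _ => hf.mono_set Set.sdiff_subset, ?_⟩
  have hm : ∀ δ : ℝ, MeasurableSet (Set.Ioo (c - δ) (c + δ))ᶜ := fun δ => measurableSet_Ioo.compl
  have he : ∀ δ : ℝ, ∫ t in Set.Ioi 0 \ Set.Ioo (c - δ) (c + δ), f t =
      ∫ t in Set.Ioi (0 : ℝ), (Set.Ioo (c - δ) (c + δ))ᶜ.indicator f t := by
    intro δ
    rw [setIntegral_indicator (hm δ)]
    rfl
  simp_rw [he]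
  refine tendsto_integral_filter_of_dominated_convergence (fun t => ‖f t‖)
    (Eventually.of_forall fun δ => hf.aestronglyMeasurable.indicator (hm δ))
    (Eventually.of_forall fun δ => Eventually.of_forall fun t => norm_indicator_le_norm_self _ _)
    hf.norm ?_
  have hne : ∀ᵐ t : ℝ ∂volume, t ≠ c := by simp [ae_iff]
  filter_upwards [ae_restrict_of_ae hne] with t ht
  refine tendsto_const_nhds.congr' ?_
  have hpos : 0 < |t - c| := abs_pos.2 (sub_ne_zero.2 ht)
  filter_upwards [Ioo_mem_nhdsGT hpos] with δ hδ
  rw [Set.indicator_of_mem]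
  intro h
  have : |t - c| < δ := abs_lt.2 ⟨by linarith [h.1], by linarith [h.2]⟩
  linarith [hδ.2]

/-- The polar kernel has principal value 0, so subtracting it leaves the value of the absolutely
convergent reduced integral. -/
theorem hasPrincipalValue_mellinIntegrand {σ : ℂ} (hσ : σ.re < 1 / 2) :
    HasPrincipalValue (fun t : ℝ => mellinIntegrand σ t) (1 / 2) (reducedIntegral σ) := by
  have h := (hasPrincipalValue_of_integrableOn (1 / 2) (integrableOn_reducedIntegrand hσ)).sub
    (hasPrincipalValue_polarKernel.const_mul (2 ^ (2 * σ)))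
  rw [mul_zero, sub_zero] at h
  refine h.congr_ae ?_
  have h2 := rayPullback_mellinIntegrand_ae_eq (θ := 0) σ (by simpa using sectorAngle_pos.le)
  simp only [rayPullback_zero] at h2
  exact h2.symm

/-! ### Holomorphy in σ and the regularised Mellin transforms. -/

theorem mul_exp_sub_half_ne_zero {r θ : ℝ} (hr : 0 < r) (h0 : 0 < θ) (h1 : θ ≤ 1) :
    (r : ℂ) * Complex.exp (θ * Complex.I) - 1 / 2 ≠ 0 := by
  intro h
  have h2 := congrArg Complex.im h
  rw [Complex.sub_im, mul_exp_mul_I_im] at h2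
  have h3 : 0 < Real.sin θ := Real.sin_pos_of_pos_of_lt_pi h0 (by linarith [Real.pi_gt_three])
  norm_num at h2
  rcases h2 with h2 | h2
  · exact hr.ne' h2
  · exact h3.ne' h2

/-- On the positive axis the pole prevents a direct use of Mellin transforms. On the ray of angle
`sectorAngle` the integral is a genuine one, of a function bounded at 0 and exponentially small at
infinity. -/
theorem differentiableAt_reducedIntegral {σ : ℂ} (hσ : σ.re < 1 / 2) :
    DifferentiableAt ℂ reducedIntegral σ := by
  set θ : ℝ := sectorAngle with hθ
  have h0 : 0 < θ := sectorAngle_pos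
  have hle : θ ≤ 1 / 2 := sectorAngle_le
  have habs : |θ| ≤ sectorAngle := by rw [abs_of_pos h0]
  set f : ℝ → ℂ := fun r => deriv riemannZeta (1 / 2 + r * Complex.exp (θ * Complex.I)) /
    riemannZeta (1 / 2 + r * Complex.exp (θ * Complex.I)) with hf
  have hcont : ContinuousOn f (Set.Ioi 0) := by
    have h1 : ContinuousOn (fun r : ℝ => zetaLogDeriv (r * Complex.exp (θ * Complex.I)) -
        1 / ((r : ℂ) * Complex.exp (θ * Complex.I) - 1 / 2)) (Set.Ioi 0) := by
      intro r hr
      have hr' : 0 < r := hr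
      have h2 : ContinuousAt (fun r : ℝ => zetaLogDeriv (r * Complex.exp (θ * Complex.I))) r :=
        ContinuousAt.comp (f := fun r : ℝ => (r : ℂ) * Complex.exp (θ * Complex.I))
          (differentiableAt_zetaLogDeriv_sector hr'.le habs).continuousAt (by fun_prop)
      exact (h2.sub (continuousAt_const.div (by fun_prop)
        (mul_exp_sub_half_ne_zero hr' h0 (by linarith)))).continuousWithinAt
    refine h1.congr fun r hr => ?_
    have hr' : 0 < r := hr
    simp only [hf]
    rw [zetaLogDeriv_eq (sub_ne_zero.1 (mul_exp_sub_half_ne_zero hr' h0 (by linarith)))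
      (riemannZeta₁_ne_zero_of_abs_le_sectorAngle hr'.le habs)]
    ring
  have htop : f =O[atTop] fun r => Real.exp (-(1 / 4) * r) := by
    obtain ⟨C, hC, h⟩ := exists_norm_logDeriv_zeta_sector_le
    refine Asymptotics.IsBigO.of_bound C ?_
    filter_upwards [eventually_ge_atTop 4] with r hr
    rw [Real.norm_of_nonneg (Real.exp_pos _).le]
    exact h r hr θ habs
  have hbot : f =O[𝓝[>] 0] fun r : ℝ => r ^ (-(0 : ℝ)) := by
    obtain ⟨C, hC, h⟩ := exists_norm_logDeriv_zeta_sector_le_const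
    refine Asymptotics.IsBigO.of_bound C ?_
    filter_upwards [Ioo_mem_nhdsGT (show (0 : ℝ) < 1 / 4 by norm_num)] with r hr
    rw [neg_zero, Real.rpow_zero, norm_one, mul_one]
    exact h r hr.1 hr.2.le θ habs
  have hre : (1 - 2 * σ).re = 1 - 2 * σ.re := by simp
  have hm : DifferentiableAt ℂ (mellin f) (1 - 2 * σ) :=
    mellin_differentiableAt_of_isBigO_rpow_exp (by norm_num)
      (hcont.locallyIntegrableOn measurableSet_Ioi) htop hbot (by rw [hre]; linarith)
  have heq : ∀ s : ℂ, s.re < 1 / 2 → reducedIntegral s =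
      Complex.exp ((1 - 2 * s) * (θ * Complex.I)) * mellin f (1 - 2 * s) -
        Real.pi * Complex.I * 2 ^ (2 * s) := by
    intro s hs
    have h1 := (integral_rayPullback_mellinIntegrand hs h0 le_rfl).1.2
    have h2 : ∫ r in Set.Ioi (0 : ℝ), rayPullback (mellinIntegrand s) θ r =
        Complex.exp ((1 - 2 * s) * (θ * Complex.I)) * mellin f (1 - 2 * s) := by
      rw [mellin, ← integral_const_mul]
      refine setIntegral_congr_fun measurableSet_Ioi fun r hr => ?_
      have hr' : 0 < r := hr
      have hpi := Real.pi_gt_three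
      simp only [rayPullback, mellinIntegrand, smul_eq_mul, hf]
      rw [ofReal_mul_exp_cpow hr' (by linarith) (by linarith),
        show (1 - 2 * s - 1 : ℂ) = -2 * s by ring,
        show (1 - 2 * s) * (θ * Complex.I) = -2 * s * θ * Complex.I + θ * Complex.I by ring,
        Complex.exp_add]
      ring
    rw [← h2, h1]; ring
  have hev : reducedIntegral =ᶠ[𝓝 σ] fun s => Complex.exp ((1 - 2 * s) * (θ * Complex.I)) *
      mellin f (1 - 2 * s) - Real.pi * Complex.I * 2 ^ (2 * s) := by
    filter_upwards [(isOpen_lt Complex.continuous_re continuous_const).mem_nhds hσ] with s hs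
    exact heq s hs
  refine DifferentiableAt.congr_of_eventuallyEq ?_ hev
  have hl : DifferentiableAt ℂ (fun s : ℂ => 1 - 2 * s) σ := by fun_prop
  have h2 : DifferentiableAt ℂ (fun s : ℂ => mellin f (1 - 2 * s)) σ :=
    DifferentiableAt.comp (g := mellin f) σ hm hl
  have h3 : DifferentiableAt ℂ (fun s : ℂ => (2 : ℂ) ^ (2 * s)) σ :=
    (differentiableAt_id.const_mul 2).const_cpow (Or.inl two_ne_zero)
  exact ((by fun_prop : DifferentiableAt ℂ (fun s : ℂ =>
    Complex.exp ((1 - 2 * s) * (θ * Complex.I))) σ).mul h2).sub (h3.const_mul _)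

/-- The Mellin transform of `t ↦ ζ'/ζ(1/2 + t) + 1/(t - 1/2)` at `1 - 2σ`. -/
noncomputable def zetaLogDerivMellin (σ : ℂ) : ℂ :=
  ∫ t in Set.Ioi (0 : ℝ), (t : ℂ) ^ (-2 * σ) * zetaLogDeriv t

theorem sin_two_pi_mul_ne_zero {σ : ℂ} (h0 : 0 < σ.re) (h1 : σ.re < 1 / 2) :
    Complex.sin (2 * Real.pi * σ) ≠ 0 := by
  rw [Ne, Complex.sin_eq_zero_iff]
  rintro ⟨k, hk⟩
  have hpi : (Real.pi : ℂ) ≠ 0 := Complex.ofReal_ne_zero.2 Real.pi_ne_zero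
  have h2 : 2 * σ = k := by
    apply mul_left_cancel₀ hpi
    linear_combination hk
  have h3 := congrArg Complex.re h2
  simp at h3
  have h4 : (0 : ℝ) < k := by linarith
  have h5 : (k : ℝ) < 1 := by linarith
  norm_cast at h4 h5
  lia

/-- After multiplication by r the integrand is O(r^(1 - 2 Re σ)) at 0 and O(r^(-2 Re σ)) at
infinity; both exponents have the right sign exactly in the strip. -/
theorem integral_rayPullback_cpow_mul_zetaLogDeriv {σ : ℂ} (h0 : 0 < σ.re) (h1 : σ.re < 1 / 2)
    {θ : ℝ} (hθ0 : 0 ≤ θ) (hθ1 : θ ≤ sectorAngle) :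
    IntegrableOn (fun t : ℝ => (t : ℂ) ^ (-2 * σ) * zetaLogDeriv t) (Set.Ioi 0) ∧
      zetaLogDerivMellin σ = ∫ r in Set.Ioi (0 : ℝ),
        rayPullback (fun t => t ^ (-2 * σ) * zetaLogDeriv t) θ r := by
  obtain ⟨C, hC, hH⟩ := exists_norm_zetaLogDeriv_sector_le
  have habs : ∀ φ ∈ Set.Icc 0 θ, |φ| ≤ sectorAngle := fun φ hφ => by
    rw [abs_of_nonneg hφ.1]; exact hφ.2.trans hθ1
  set E : ℝ := Real.exp |(-2 * σ).im| with hE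
  have hE0 : 0 < E := Real.exp_pos _
  have hre : (-2 * σ).re = -(2 * σ.re) := by simp
  have hb : ∀ r : ℝ, 0 < r → ∀ φ ∈ Set.Icc 0 θ,
      ‖((r : ℂ) * Complex.exp (φ * Complex.I)) ^ (-2 * σ) *
        zetaLogDeriv (r * Complex.exp (φ * Complex.I))‖ ≤
        E * r ^ (-(2 * σ.re)) * (C / (1 + r)) := by
    intro r hr φ hφ
    rw [norm_mul]
    gcongr
    · have := norm_ofReal_mul_exp_cpow_le hr
        (((habs φ hφ).trans sectorAngle_le).trans (by norm_num)) (-2 * σ)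
      rwa [hre] at this
    · exact hH r hr.le φ (habs φ hφ)
  have key := integral_rayPullback_eq (f := fun t => t ^ (-2 * σ) * zetaLogDeriv t)
    (η := min (1 - 2 * σ.re) (2 * σ.re)) (C := E * C) (θ₁ := 0) (θ₂ := θ)
    (lt_min (by linarith) (by linarith)) hθ0
    (fun r hr φ hφ => (differentiableAt_cpow_of_re_pos
      (mul_exp_re_pos hr ((habs φ hφ).trans sectorAngle_le)) _).mul
      (differentiableAt_zetaLogDeriv_sector hr.le (habs φ hφ))) (fun r hr hr4 φ hφ => ?_)
    fun r hr4 φ hφ => ?_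
  · refine ⟨?_, ?_⟩
    · have := key.1 0 ⟨le_rfl, hθ0⟩
      rwa [rayPullback_zero] at this
    · rw [← key.2, rayPullback_zero]
      rfl
  · have e1 : r ^ (-(2 * σ.re)) * r ≤ r ^ min (1 - 2 * σ.re) (2 * σ.re) := by
      calc r ^ (-(2 * σ.re)) * r = r ^ (1 - 2 * σ.re) := by
            rw [← Real.rpow_add_one hr.ne']; ring_nf
        _ ≤ _ := Real.rpow_le_rpow_of_exponent_ge hr (by linarith) (min_le_left _ _)
    have e2 : C / (1 + r) ≤ C := div_le_self hC.le (by linarith)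
    calc _ ≤ E * r ^ (-(2 * σ.re)) * (C / (1 + r)) * r := by gcongr; exact hb r hr φ hφ
      _ ≤ E * r ^ (-(2 * σ.re)) * C * r := by gcongr
      _ = E * C * (r ^ (-(2 * σ.re)) * r) := by ring
      _ ≤ _ := by gcongr
  · have hr : 0 < r := by linarith
    have e1 : r ^ (-(2 * σ.re)) ≤ r ^ (-min (1 - 2 * σ.re) (2 * σ.re)) :=
      Real.rpow_le_rpow_of_exponent_le (by linarith) (neg_le_neg (min_le_right _ _))
    have e2 : C / (1 + r) * r ≤ C := by
      rw [div_mul_eq_mul_div, div_le_iff₀ (by linarith)]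
      nlinarith
    calc _ ≤ E * r ^ (-(2 * σ.re)) * (C / (1 + r)) * r := by gcongr; exact hb r hr φ hφ
      _ = E * r ^ (-(2 * σ.re)) * (C / (1 + r) * r) := by ring
      _ ≤ E * r ^ (-(2 * σ.re)) * C := by gcongr
      _ = E * C * r ^ (-(2 * σ.re)) := by ring
      _ ≤ _ := by gcongr

/-- The added term is the principal value of ∫ t^(-2σ)/(t - 1/2) dt, equal to 2^(2σ) π cot(2πσ). It
is computed on a ray, where the polar term is separately integrable; the resulting -πi 2^(2σ)
cancels the half residue. -/
theorem zetaLogDerivMellin_eq {σ : ℂ} (h0 : 0 < σ.re) (h1 : σ.re < 1 / 2) :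
    zetaLogDerivMellin σ = reducedIntegral σ +
      2 ^ (2 * σ) * (Real.pi * Complex.cos (2 * Real.pi * σ) / Complex.sin (2 * Real.pi * σ)) := by
  set θ : ℝ := sectorAngle with hθ
  have hθ0 : 0 < θ := sectorAngle_pos
  have hle : θ ≤ 1 / 2 := sectorAngle_le
  have habs : |θ| ≤ sectorAngle := by rw [abs_of_pos hθ0]
  have hpi := Real.pi_gt_three
  -- Chosen so that re^(iθ) - 1/2 = (r + w)e^(iθ), with `w` off the cut and of principal argument π
  -- - θ.
  set w : ℂ := ((1 / 2 : ℝ) : ℂ) * Complex.exp ((Real.pi - θ : ℝ) * Complex.I) with hw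
  have hws : w ∈ Complex.slitPlane := by
    right
    rw [hw, mul_exp_mul_I_im, Real.sin_pi_sub]
    have := Real.sin_pos_of_pos_of_lt_pi hθ0 (by linarith)
    positivity
  have hre : (1 - 2 * σ).re = 1 - 2 * σ.re := by simp
  have ha0 : 0 < (1 - 2 * σ).re := by rw [hre]; linarith
  have ha1 : (1 - 2 * σ).re < 1 := by rw [hre]; linarith
  have hint := integrableOn_cpow_div_add_pow (a := 1 - 2 * σ) (w := w) (n := 1) hws ha0
    (by exact_mod_cast ha1)
  simp only [pow_one] at hint
  have hwe : w * Complex.exp (θ * Complex.I) = -(1 / 2) := by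
    rw [hw, mul_assoc, ← Complex.exp_add]
    push_cast
    rw [show ((Real.pi : ℂ) - θ) * Complex.I + θ * Complex.I = Real.pi * Complex.I by ring,
      Complex.exp_pi_mul_I]
    ring
  have hray := (integral_rayPullback_cpow_mul_zetaLogDeriv h0 h1 hθ0.le le_rfl).2
  have hmel := (integral_rayPullback_mellinIntegrand h1 hθ0 le_rfl).1
  have hsplit : ∀ r ∈ Set.Ioi (0 : ℝ), rayPullback (fun t => t ^ (-2 * σ) * zetaLogDeriv t) θ r =
      rayPullback (mellinIntegrand σ) θ r + Complex.exp (-2 * σ * θ * Complex.I) *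
        ((r : ℂ) ^ ((1 - 2 * σ) - 1) / (r + w)) := by
    intro r hr
    have hr' : 0 < r := hr
    have hne := mul_exp_sub_half_ne_zero hr' hθ0 (by linarith)
    simp only [rayPullback, mellinIntegrand]
    rw [zetaLogDeriv_eq (sub_ne_zero.1 hne)
      (riemannZeta₁_ne_zero_of_abs_le_sectorAngle hr'.le habs),
      ofReal_mul_exp_cpow hr' (by linarith) (by linarith),
      show (1 - 2 * σ - 1 : ℂ) = -2 * σ by ring]
    have e1 : (r : ℂ) * Complex.exp (θ * Complex.I) - 1 / 2 =
        (r + w) * Complex.exp (θ * Complex.I) := by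
      rw [add_mul, hwe]; ring
    have e2 : (r : ℂ) + w ≠ 0 := by
      intro h
      rw [e1, h, zero_mul] at hne
      exact hne rfl
    rw [e1]
    have e3 := Complex.exp_ne_zero (θ * Complex.I)
    field_simp
  rw [hray, setIntegral_congr_fun measurableSet_Ioi hsplit,
    integral_add hmel.1 (hint.const_mul _), integral_const_mul, hmel.2,
    integral_cpow_div_add hws ha0 ha1, show (1 - 2 * σ - 1 : ℂ) = -2 * σ by ring, hw,
    ofReal_mul_exp_cpow (by norm_num) (by linarith) (by linarith)]
  have hs : Complex.sin (Real.pi * (1 - 2 * σ)) = Complex.sin (2 * Real.pi * σ) := by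
    rw [show (Real.pi : ℂ) * (1 - 2 * σ) = Real.pi - 2 * Real.pi * σ by ring, Complex.sin_pi_sub]
  have hhalf : (((1 / 2 : ℝ) : ℂ)) ^ (-2 * σ) = 2 ^ (2 * σ) := by
    rw [← half_cpow_neg]; push_cast; rw [neg_mul]
  have hexp : Complex.exp (-2 * σ * θ * Complex.I) *
      Complex.exp (-2 * σ * (Real.pi - θ : ℝ) * Complex.I) =
      Complex.cos (2 * Real.pi * σ) - Complex.sin (2 * Real.pi * σ) * Complex.I := by
    have h2 := Complex.exp_mul_I (-(2 * Real.pi * σ))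
    rw [Complex.cos_neg, Complex.sin_neg, neg_mul (Complex.sin _), ← sub_eq_add_neg] at h2
    rw [← Complex.exp_add, ← h2]
    congr 1
    push_cast
    ring
  rw [hs, hhalf]
  have hsin := sin_two_pi_mul_ne_zero h0 h1
  have e4 : Complex.exp (-2 * σ * θ * Complex.I) * (2 ^ (2 * σ) *
      Complex.exp (-2 * σ * (Real.pi - θ : ℝ) * Complex.I) *
        (Real.pi / Complex.sin (2 * Real.pi * σ))) = 2 ^ (2 * σ) *
      (Complex.cos (2 * Real.pi * σ) - Complex.sin (2 * Real.pi * σ) * Complex.I) *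
        (Real.pi / Complex.sin (2 * Real.pi * σ)) := by
    rw [← hexp]; ring
  rw [e4]
  generalize Complex.sin (2 * Real.pi * σ) = x at hsin
  field_simp
  ring

/-- The Mellin transform of the derivative of `t ↦ ζ'/ζ(1/2 + t) + 1/(t - 1/2)` at `2 - 2σ`. -/
noncomputable def zetaLogDerivDerivMellin (σ : ℂ) : ℂ :=
  ∫ t in Set.Ioi (0 : ℝ), (t : ℂ) ^ (1 - 2 * σ) * deriv zetaLogDeriv t

theorem continuousOn_deriv_zetaLogDeriv :
    ContinuousOn (fun t : ℝ => deriv zetaLogDeriv t) (Set.Ioi 0) := fun t ht =>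
  (ContinuousAt.comp (f := fun t : ℝ => (t : ℂ))
    (analyticAt_zetaLogDeriv_ofReal (le_of_lt ht)).deriv.continuousAt
    (by fun_prop)).continuousWithinAt

/-- The derivative decays like t⁻², which pays for the weight t^(1-2σ); the extra power of t at 0
moves the right edge of the strip from 1/2 to 1. -/
theorem integrableOn_cpow_mul_deriv_zetaLogDeriv {σ : ℂ} (h0 : 0 < σ.re) (h1 : σ.re < 1) :
    IntegrableOn (fun t : ℝ => (t : ℂ) ^ (1 - 2 * σ) * deriv zetaLogDeriv t) (Set.Ioi 0) ∧
      DifferentiableAt ℂ zetaLogDerivDerivMellin σ := by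
  obtain ⟨C, hC, h⟩ := exists_norm_deriv_zetaLogDeriv_le
  set f : ℝ → ℂ := fun t => deriv zetaLogDeriv t with hf
  have htop : f =O[atTop] fun r : ℝ => r ^ (-(2 : ℝ)) := by
    refine Asymptotics.IsBigO.of_bound C ?_
    filter_upwards [eventually_gt_atTop 0] with r hr
    rw [Real.norm_of_nonneg (by positivity), Real.rpow_neg hr.le]
    refine (h r hr.le).trans ?_
    rw [div_eq_mul_inv]
    norm_cast
    gcongr
    linarith
  have hbot : f =O[𝓝[>] 0] fun r : ℝ => r ^ (-(0 : ℝ)) := by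
    refine Asymptotics.IsBigO.of_bound C ?_
    filter_upwards [self_mem_nhdsWithin] with r hr
    have hr' : 0 < r := hr
    simp only [neg_zero, Real.rpow_zero, norm_one, mul_one]
    exact (h r hr'.le).trans (div_le_self hC.le (one_le_pow₀ (by linarith)))
  have hre : (2 - 2 * σ).re = 2 - 2 * σ.re := by simp
  have hloc := continuousOn_deriv_zetaLogDeriv.locallyIntegrableOn (μ := volume) measurableSet_Ioi
  have hsub : ∀ s : ℂ, (2 - 2 * s - 1 : ℂ) = 1 - 2 * s := fun s => by ring
  constructor
  · have hm := mellinConvergent_of_isBigO_rpow (s := 2 - 2 * σ) hloc htop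
      (by rw [hre]; linarith) hbot (by rw [hre]; linarith)
    rw [MellinConvergent] at hm
    simpa only [hsub, smul_eq_mul] using hm
  · have hm := mellin_differentiableAt_of_isBigO_rpow (s := 2 - 2 * σ) hloc htop
      (by rw [hre]; linarith) hbot (by rw [hre]; linarith)
    have he : zetaLogDerivDerivMellin = fun s => mellin f (2 - 2 * s) := by
      funext s
      simp only [zetaLogDerivDerivMellin, mellin, hsub, smul_eq_mul, hf]
    rw [he]
    exact DifferentiableAt.comp (g := mellin f) σ hm (by fun_prop)

/-- Integration by parts, with vanishing boundary terms for 0 < Re σ < 1/2. It leads from the wide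
strip back to the regularised ζ'/ζ. -/
theorem zetaLogDerivDerivMellin_eq {σ : ℂ} (h0 : 0 < σ.re) (h1 : σ.re < 1 / 2) :
    zetaLogDerivDerivMellin σ = -(1 - 2 * σ) * zetaLogDerivMellin σ := by
  obtain ⟨C, hC, h⟩ := exists_norm_zetaLogDeriv_ofReal_le
  have hre : (1 - 2 * σ).re = 1 - 2 * σ.re := by simp
  have hJ := (integral_rayPullback_cpow_mul_zetaLogDeriv h0 h1 le_rfl sectorAngle_pos.le).1
  have hK := (integrableOn_cpow_mul_deriv_zetaLogDeriv h0 (by linarith)).1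
  have hne : (1 - 2 * σ) ≠ 0 := by
    intro h2
    rw [h2] at hre
    simp at hre
    linarith
  have hd1 : ∀ t ∈ Set.Ioi (0 : ℝ), HasDerivAt (fun t : ℝ => (t : ℂ) ^ (1 - 2 * σ))
      ((1 - 2 * σ) * (t : ℂ) ^ (-2 * σ)) t := by
    intro t ht
    have ht' : 0 < t := ht
    have := (hasDerivAt_id (t : ℂ)).cpow_const (c := 1 - 2 * σ) (Or.inl (by simpa using ht'))
    simp only [id, mul_one, show (1 - 2 * σ - 1 : ℂ) = -2 * σ by ring] at this
    exact this.comp_ofReal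
  have hd2 : ∀ t ∈ Set.Ioi (0 : ℝ), HasDerivAt (fun t : ℝ => zetaLogDeriv t)
      (deriv zetaLogDeriv t) t := fun t ht =>
    (analyticAt_zetaLogDeriv_ofReal (le_of_lt ht)).differentiableAt.hasDerivAt.comp_ofReal
  have hnorm : ∀ t : ℝ, 0 < t → ‖(t : ℂ) ^ (1 - 2 * σ) * zetaLogDeriv t‖ ≤
      t ^ (1 - 2 * σ.re) * (C / (1 + t)) := by
    intro t ht
    rw [norm_mul, Complex.norm_cpow_eq_rpow_re_of_pos ht, hre]
    gcongr
    exact h t ht.le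
  have hlim0 : Tendsto (fun t : ℝ => (t : ℂ) ^ (1 - 2 * σ) * zetaLogDeriv t) (𝓝[>] 0) (𝓝 0) := by
    have h3 : Tendsto (fun t : ℝ => t ^ (1 - 2 * σ.re) * C) (𝓝[>] 0) (𝓝 0) := by
      have h4 := (Real.continuousAt_rpow_const 0 (1 - 2 * σ.re) (Or.inr (by linarith))).tendsto
      rw [Real.zero_rpow (by linarith)] at h4
      simpa using (h4.mono_left nhdsWithin_le_nhds).mul_const C
    refine squeeze_zero_norm' ?_ h3
    filter_upwards [self_mem_nhdsWithin] with t ht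
    have ht' : 0 < t := ht
    refine (hnorm t ht').trans ?_
    gcongr
    exact div_le_self hC.le (by linarith)
  have hlim1 : Tendsto (fun t : ℝ => (t : ℂ) ^ (1 - 2 * σ) * zetaLogDeriv t) atTop (𝓝 0) := by
    have h3 : Tendsto (fun t : ℝ => t ^ (-(2 * σ.re)) * C) atTop (𝓝 0) := by
      simpa using (tendsto_rpow_neg_atTop (by linarith : 0 < 2 * σ.re)).mul_const C
    refine squeeze_zero_norm' ?_ h3
    filter_upwards [eventually_gt_atTop 0] with t ht
    refine (hnorm t ht).trans ?_
    have e1 : t ^ (1 - 2 * σ.re) = t ^ (-(2 * σ.re)) * t := by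
      rw [← Real.rpow_add_one ht.ne']; ring_nf
    rw [e1, mul_assoc]
    gcongr
    rw [← mul_div_assoc, div_le_iff₀ (by linarith)]
    nlinarith
  have e1 : ∀ t : ℝ, (1 - 2 * σ) * (t : ℂ) ^ (-2 * σ) * zetaLogDeriv t =
      (1 - 2 * σ) * ((t : ℂ) ^ (-2 * σ) * zetaLogDeriv t) := fun t => mul_assoc _ _ _
  have hJ' : IntegrableOn (fun t : ℝ => (1 - 2 * σ) * (t : ℂ) ^ (-2 * σ) * zetaLogDeriv t)
      (Set.Ioi 0) := by
    simp_rw [e1]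
    exact hJ.const_mul _
  have key := integral_Ioi_deriv_mul_eq_sub hd1 hd2 (hJ'.add hK) hlim0 hlim1
  rw [integral_add hJ' hK] at key
  simp_rw [e1] at key
  rw [integral_const_mul] at key
  rw [zetaLogDerivDerivMellin, zetaLogDerivMellin]
  linear_combination key

/-! ### The shadow series ∑ (1/2 + 2k)^(-s). -/

/-- The formula for the continuation of `∑ (1/2 + 2k) ^ (-s)`. -/
noncomputable def shadowFormula (s : ℂ) : ℂ :=
  2 ^ s * (((1 - 2 ^ (-s)) * riemannZeta s + dirichletBeta s) / 2 - 1)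

theorem chiFour_ne_one : chiFour ≠ 1 := by
  intro h
  have h1 := congrArg (fun χ : DirichletCharacter ℂ 4 => χ 3) h
  have h2 : chiFour 3 = -1 := by
    simp only [chiFour, MulChar.ringHomComp_apply]
    have : ZMod.χ₄ 3 = -1 := by decide
    rw [this]; simp
  have h3 : (1 : DirichletCharacter ℂ 4) 3 = 1 := by
    apply MulChar.one_apply
    decide
  simp only [h2, h3] at h1
  norm_num at h1

theorem differentiable_dirichletBeta : Differentiable ℂ dirichletBeta :=
  DirichletCharacter.differentiable_LFunction chiFour_ne_one

theorem analyticAt_of_differentiableAt_ne_one {f : ℂ → ℂ}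
    (h : ∀ s : ℂ, s ≠ 1 → DifferentiableAt ℂ f s) {s : ℂ} (hs : s ≠ 1) : AnalyticAt ℂ f s := by
  have h1 : DifferentiableOn ℂ f {1}ᶜ := fun z hz => (h z hz).differentiableWithinAt
  exact h1.analyticAt (isOpen_compl_singleton.mem_nhds hs)

theorem analyticAt_shadowFormula {s : ℂ} (hs : s ≠ 1) : AnalyticAt ℂ shadowFormula s := by
  refine analyticAt_of_differentiableAt_ne_one (fun z hz => ?_) hs
  have h1 : DifferentiableAt ℂ (fun s : ℂ => (2 : ℂ) ^ s) z :=
    differentiableAt_id.const_cpow (Or.inl two_ne_zero)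
  have h2 : DifferentiableAt ℂ (fun s : ℂ => (2 : ℂ) ^ (-s)) z :=
    differentiableAt_id.neg.const_cpow (Or.inl two_ne_zero)
  exact h1.mul ((((h2.const_sub 1).mul (differentiableAt_riemannZeta hz)).add
    (differentiable_dirichletBeta z)).div_const 2 |>.sub_const 1)

theorem meromorphicAt_riemannZeta (s : ℂ) : MeromorphicAt riemannZeta s := by
  have h1 : MeromorphicAt (fun z : ℂ => (z - 1)⁻¹ * riemannZeta₁ z) s :=
    ((analyticAt_id.sub analyticAt_const).meromorphicAt.inv).mul
      (differentiable_riemannZeta₁.analyticAt s).meromorphicAt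
  refine h1.congr ?_
  have h2 : ∀ᶠ z in 𝓝[≠] s, z ≠ 1 := by
    by_cases hs : s = 1
    · rw [hs]; exact self_mem_nhdsWithin
    · exact (isOpen_compl_singleton.mem_nhds hs : {1}ᶜ ∈ 𝓝 s) |> mem_nhdsWithin_of_mem_nhds
  filter_upwards [h2] with z hz
  exact (riemannZeta_eq_inv_sub_mul hz).symm

theorem meromorphicAt_shadowFormula (s : ℂ) : MeromorphicAt shadowFormula s := by
  have h1 : Differentiable ℂ (fun s : ℂ => (2 : ℂ) ^ s) :=
    differentiable_id.const_cpow (Or.inl two_ne_zero)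
  have h2 : Differentiable ℂ (fun s : ℂ => (2 : ℂ) ^ (-s)) :=
    differentiable_id.neg.const_cpow (Or.inl two_ne_zero)
  exact (h1.analyticAt s).meromorphicAt.mul
    (((((analyticAt_const.sub (h2.analyticAt s)).meromorphicAt.mul (meromorphicAt_riemannZeta s)).add
    (differentiable_dirichletBeta.analyticAt s).meromorphicAt).div
      (MeromorphicAt.const 2 s)).sub (MeromorphicAt.const 1 s))

/-- The value of the normal form of `f` agrees with that of `f` where `f` is analytic. -/
theorem toMeromorphicNFOn_eq_of_analyticAt {f : ℂ → ℂ} (hf : MeromorphicOn f Set.univ) {x : ℂ}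
    (hx : AnalyticAt ℂ f x) : toMeromorphicNFOn f Set.univ x = f x := by
  rw [toMeromorphicNFOn_eq_toMeromorphicNFAt hf (Set.mem_univ x),
    toMeromorphicNFAt_eq_self.2 hx.meromorphicNFAt]

/-- The continuation of `∑ (1/2 + 2k) ^ (-s)`. -/
noncomputable def shadowZeta : ℂ → ℂ := toMeromorphicNFOn shadowFormula Set.univ

theorem shadowZeta_eq {s : ℂ} (hs : s ≠ 1) : shadowZeta s = shadowFormula s :=
  toMeromorphicNFOn_eq_of_analyticAt (fun s _ => meromorphicAt_shadowFormula s)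
    (analyticAt_shadowFormula hs)

/-- Since 1/2 + 2k = (4k + 1)/2, the series is 2^s times the sum of n^(-s) over n ≡ 1 mod 4, n ≥ 5.
-/
theorem hasSum_shadowSeriesTerm {s : ℂ} (hs : 1 < s.re) :
    HasSum (fun k => shadowSeriesTerm k s) (shadowFormula s) := by
  set f : ℕ → ℂ := fun n => 1 / (n : ℂ) ^ s with hf
  have hsum : Summable f := Complex.summable_one_div_nat_cpow.2 hs
  have hinj : ∀ a b : ℕ, a ≠ 0 → Function.Injective fun k : ℕ => a * k + b := by
    intro a b ha x y h
    have h' : a * x + b = a * y + b := h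
    exact Nat.eq_of_mul_eq_mul_left (Nat.pos_of_ne_zero ha) (Nat.add_right_cancel h')
  have hE := (hsum.comp_injective (hinj 4 1 (by norm_num))).hasSum
  have hO := (hsum.comp_injective (hinj 4 3 (by norm_num))).hasSum
  -- `E` and `O` are the sums over n ≡ 1 and n ≡ 3 mod 4. Then E + O = (1 - 2^(-s))ζ(s) and E - O =
  -- β(s); the final -1 removes n = 1 from `E`.
  set E := ∑' k, (f ∘ fun k : ℕ => 4 * k + 1) k
  set O := ∑' k, (f ∘ fun k : ℕ => 4 * k + 3) k
  have hζ : HasSum f (riemannZeta s) := by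
    rw [zeta_eq_tsum_one_div_nat_cpow hs]; exact hsum.hasSum
  have heven : HasSum (fun k => f (2 * k)) (2 ^ (-s) * riemannZeta s) := by
    refine (hζ.mul_left (2 ^ (-s))).congr_fun fun k => ?_
    simp only [hf]
    rw [Nat.cast_mul, Complex.natCast_mul_natCast_cpow 2 k s, Complex.cpow_neg, one_div, one_div, mul_inv,
      Nat.cast_ofNat]
  have hodd : HasSum (fun k => f (2 * k + 1)) (E + O) := by
    refine HasSum.even_add_odd ?_ ?_
    · refine hE.congr_fun fun k => ?_
      simp only [Function.comp]; congr 1; ring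
    · refine hO.congr_fun fun k => ?_
      simp only [Function.comp]; congr 1; ring
  have h1 := hζ.unique (heven.even_add_odd hodd)
  have hχ : ∀ n : ℕ, LSeries.term (fun n : ℕ => chiFour n) s n = chiFour n * f n := by
    intro n
    rw [LSeries.term_def₀ (by simp [chiFour]), hf, Complex.cpow_neg]
    simp only [one_div]
  have hβ : HasSum (fun n : ℕ => chiFour n * f n) (dirichletBeta s) := by
    rw [dirichletBeta, DirichletCharacter.LFunction_eq_LSeries _ hs]
    have := (DirichletCharacter.LSeriesSummable_of_one_lt_re chiFour hs).LSeriesHasSum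
    exact this.congr_fun fun n => (hχ n).symm
  have hc : ∀ n : ℕ, chiFour n = ((ZMod.χ₄ (n : ZMod 4) : ℤ) : ℂ) := fun n => by
    simp [chiFour]
  have hβ' : HasSum (fun n : ℕ => chiFour n * f n) (0 + (E + -O)) := by
    refine HasSum.even_add_odd ?_ (HasSum.even_add_odd ?_ ?_)
    · refine hasSum_zero.congr_fun fun k => ?_
      rw [hc, ZMod.χ₄_nat_eq_if_mod_four, if_pos (by lia)]
      simp
    · refine hE.congr_fun fun k => ?_
      rw [hc, ZMod.χ₄_nat_eq_if_mod_four, if_neg (by lia), if_pos (by lia)]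
      simp only [Function.comp, Int.cast_one, one_mul]; congr 1; ring
    · refine hO.neg.congr_fun fun k => ?_
      rw [hc, ZMod.χ₄_nat_eq_if_mod_four, if_neg (by lia), if_neg (by lia)]
      simp only [Function.comp, Int.cast_neg, Int.cast_one, neg_mul, one_mul]; congr 2; ring
  have h2 := hβ.unique hβ'
  have h3 : HasSum (fun k : ℕ => f (4 * (k + 1) + 1)) (E - 1) := by
    have := (hasSum_nat_add_iff' (f := f ∘ fun k : ℕ => 4 * k + 1) 1).2 hE
    simpa [hf] using this
  have h4 : shadowFormula s = 2 ^ s * (E - 1) := by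
    rw [shadowFormula, h2]
    congr 2
    linear_combination (1 / 2 : ℂ) * h1
  rw [h4]
  refine (h3.mul_left (2 ^ s)).congr_fun fun k => ?_
  simp only [hf, shadowSeriesTerm]
  have h5 : (1 / 2 + 2 * ((k : ℂ) + 1)) = ((1 / 2 : ℝ) : ℂ) * ((4 * (k + 1) + 1 : ℕ) : ℝ) := by
    push_cast; ring
  rw [h5, Complex.mul_cpow_ofReal_nonneg (by norm_num) (by positivity)]
  have h6 : ((1 / 2 : ℝ) : ℂ) ^ (-s) = 2 ^ s := by
    rw [← half_cpow_neg]; push_cast; rfl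
  rw [h6, Complex.ofReal_natCast, Complex.cpow_neg, one_div]

theorem isMeromorphicContinuation_shadowZeta :
    IsMeromorphicContinuation shadowSeriesTerm 1 shadowZeta := by
  refine ⟨meromorphicNFOn_toMeromorphicNFOn _ _, fun s hs => ?_⟩
  rw [shadowZeta_eq (by rintro rfl; norm_num at hs)]
  exact hasSum_shadowSeriesTerm hs

theorem meromorphicAt_shadowZeta (s : ℂ) : MeromorphicAt shadowZeta s :=
  (isMeromorphicContinuation_shadowZeta.1 (Set.mem_univ s)).meromorphicAt

theorem analyticAt_shadowZeta {s : ℂ} (hs : s ≠ 1) : AnalyticAt ℂ shadowZeta s := by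
  refine (analyticAt_shadowFormula hs).congr ?_
  filter_upwards [isOpen_compl_singleton.mem_nhds hs] with z hz
  exact (shadowZeta_eq hz).symm

/-! ### The series over the zeros and its holomorphy. -/

theorem countable_zetaZeroParam : Countable zetaZeroParam := by
  have h : (Set.univ : Set zetaZeroParam) = ⋃ n : ℕ, ↑(zetaZeroParamFinset n) := by
    ext τ
    obtain ⟨n, hn⟩ := exists_nat_ge ‖(τ : ℂ)‖
    simp only [Set.mem_univ, Set.mem_iUnion, true_iff]
    exact ⟨n, Finset.mem_coe.2 (mem_zetaZeroParamFinset.2 hn)⟩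
  rw [← Set.countable_univ_iff, h]
  exact Set.countable_iUnion fun n => Finset.countable_toSet _

theorem norm_cpow_le_rpow_mul_exp (z a : ℂ) :
    ‖z ^ a‖ ≤ ‖z‖ ^ a.re * Real.exp (Real.pi * |a.im|) := by
  refine (Complex.norm_cpow_le z a).trans ?_
  rw [div_eq_mul_inv, ← Real.exp_neg]
  gcongr
  calc -(z.arg * a.im) ≤ |z.arg * a.im| := neg_le_abs _
    _ = |z.arg| * |a.im| := abs_mul _ _
    _ ≤ _ := by gcongr; exact Complex.abs_arg_le_pi z

/-- The sum of the series `∑ τ ^ (-2σ)`. -/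
noncomputable def zeroSeries (σ : ℂ) : ℂ := ∑' τ : zetaZeroParam, zeroSeriesTerm τ σ

theorem norm_zeroSeriesTerm_le (τ : zetaZeroParam) (σ : ℂ) :
    ‖zeroSeriesTerm τ σ‖ ≤ Real.exp (Real.pi * |2 * σ.im|) *
      ((zetaZeroMult τ : ℝ) * ‖(τ : ℂ)‖ ^ (-(2 * σ.re))) := by
  rw [zeroSeriesTerm, norm_mul, Complex.norm_natCast]
  have h := norm_cpow_le_rpow_mul_exp (τ : ℂ) (-2 * σ)
  have h1 : (-2 * σ).re = -(2 * σ.re) := by simp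
  have h2 : (-2 * σ).im = -(2 * σ.im) := by simp
  rw [h1, h2, abs_neg] at h
  calc _ ≤ (zetaZeroMult τ : ℝ) *
        (‖(τ : ℂ)‖ ^ (-(2 * σ.re)) * Real.exp (Real.pi * |2 * σ.im|)) := by gcongr
    _ = _ := by ring

theorem hasSum_zeroSeriesTerm {σ : ℂ} (hσ : 1 / 2 < σ.re) :
    HasSum (fun τ => zeroSeriesTerm τ σ) (zeroSeries σ) :=
  (Summable.of_norm_bounded ((summable_zetaZeroMult_mul_norm_rpow (p := 2 * σ.re)
    (by linarith)).mul_left _) fun τ => norm_zeroSeriesTerm_le τ σ).hasSum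

/-- Treating x ≥ 1 and x ≤ 1 at once, this yields one summable majorant for a whole strip of
exponents. -/
theorem rpow_neg_le_add {x a b c : ℝ} (hx : 0 < x) (hab : a ≤ b) (hbc : b ≤ c) :
    x ^ (-b) ≤ x ^ (-a) + x ^ (-c) := by
  have ha : 0 ≤ x ^ (-a) := by positivity
  have hc : 0 ≤ x ^ (-c) := by positivity
  rcases le_total 1 x with h | h
  · have := Real.rpow_le_rpow_of_exponent_le h (neg_le_neg hab)
    linarith
  · have := Real.rpow_le_rpow_of_exponent_ge hx h (neg_le_neg hbc)
    linarith

theorem differentiableAt_zeroSeries {σ : ℂ} (hσ : 1 / 2 < σ.re) :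
    DifferentiableAt ℂ zeroSeries σ := by
  set p : ℝ := (σ.re + 1 / 2) / 2 with hp
  set q : ℝ := σ.re + 1 with hq
  set M : ℝ := |2 * σ.im| + 1 with hM
  -- Im σ is bounded as well, because the bound for a possibly non-real τ contains the factor
  -- exp(π|2 Im σ|).
  set U : Set ℂ := {s | p < s.re} ∩ {s | s.re < q} ∩ {s | |2 * s.im| < M} with hU
  have hUo : IsOpen U := by
    refine ((isOpen_lt continuous_const Complex.continuous_re).inter
      (isOpen_lt Complex.continuous_re continuous_const)).inter (isOpen_lt ?_ continuous_const)
    exact (continuous_const.mul Complex.continuous_im).abs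
  have hmem : σ ∈ U := ⟨⟨by simp only [Set.mem_ofPred_eq, hp]; linarith,
    by simp only [Set.mem_ofPred_eq, hq]; linarith⟩, by simp only [Set.mem_ofPred_eq, hM]; linarith⟩
  have hs1 := summable_zetaZeroMult_mul_norm_rpow (p := 2 * p) (by rw [hp]; linarith)
  have hs2 := summable_zetaZeroMult_mul_norm_rpow (p := 2 * q) (by rw [hq]; linarith)
  have hd : DifferentiableOn ℂ (fun s => ∑' τ : zetaZeroParam, zeroSeriesTerm τ s) U := by
    refine Complex.differentiableOn_tsum_of_summable_norm
      ((hs1.add hs2).mul_left (Real.exp (Real.pi * M))) (fun τ => ?_) hUo fun τ s hs => ?_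
    · have h1 : Differentiable ℂ (fun s : ℂ => (τ : ℂ) ^ (-2 * s)) :=
        (differentiable_id.const_mul (-2)).const_cpow (Or.inl (ne_zero_of_zetaZeroParam τ))
      exact (h1.const_mul _).differentiableOn
    · refine (norm_zeroSeriesTerm_le τ s).trans ?_
      have h2 : ‖(τ : ℂ)‖ ^ (-(2 * s.re)) ≤ ‖(τ : ℂ)‖ ^ (-(2 * p)) + ‖(τ : ℂ)‖ ^ (-(2 * q)) :=
        rpow_neg_le_add (norm_pos_iff.2 (ne_zero_of_zetaZeroParam τ))
          (by linarith [show p < s.re from hs.1.1]) (by linarith [show s.re < q from hs.1.2])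
      have h3 : |2 * s.im| ≤ M := le_of_lt hs.2
      rw [← mul_add]
      gcongr
  exact hd.differentiableAt (hUo.mem_nhds hmem)

/-- As |arg τ| < π/2, the principal logarithms satisfy log(±iτ) = log τ ± iπ/2 without a jump. -/
theorem cpow_neg_I_mul_add_cpow_I_mul {τ : ℂ} (hτ : 0 < τ.re) (a : ℂ) :
    (-(Complex.I * τ)) ^ a + (Complex.I * τ) ^ a =
      2 * Complex.cos (Real.pi * a / 2) * τ ^ a := by
  have h0 : τ ≠ 0 := by rintro rfl; simp at hτ
  have harg := abs_lt.1 (Complex.abs_arg_lt_pi_div_two_iff.2 (Or.inl hτ))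
  have hpi := Real.pi_pos
  have h1 : Complex.log (Complex.I * τ) = Complex.log Complex.I + Complex.log τ := by
    apply Complex.log_mul Complex.I_ne_zero h0
    rw [Complex.arg_I]
    constructor <;> linarith
  have h2 : Complex.log (-Complex.I * τ) = Complex.log (-Complex.I) + Complex.log τ := by
    apply Complex.log_mul (neg_ne_zero.2 Complex.I_ne_zero) h0
    rw [Complex.arg_neg_I]
    constructor <;> linarith
  rw [← neg_mul, Complex.cpow_def_of_ne_zero (mul_ne_zero (neg_ne_zero.2 Complex.I_ne_zero) h0),
    Complex.cpow_def_of_ne_zero (mul_ne_zero Complex.I_ne_zero h0),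
    Complex.cpow_def_of_ne_zero h0, h1, h2, Complex.log_I, Complex.log_neg_I, Complex.cos,
    add_mul, add_mul, Complex.exp_add, Complex.exp_add]
  have e1 : (Real.pi / 2 * Complex.I * a : ℂ) = Real.pi * a / 2 * Complex.I := by ring
  have e2 : (-(Real.pi / 2) * Complex.I * a : ℂ) = -(Real.pi * a / 2) * Complex.I := by ring
  rw [e1, e2]
  ring

/-! ### Termwise Mellin transforms over shadow points and zeros. -/

/-- By scaling, the L¹ norm is a constant times r^(Re a - 2), whose sum over the points converges;
this allows exchanging sum and integral. -/
theorem integral_norm_cpow_div_sq_le {a : ℂ} (ha : 0 < a.re) (ha1 : a.re < 1) {r K : ℝ} (hr : 0 < r)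
    {g : ℝ → ℂ} (hg : ∀ t : ℝ, 0 < t → ‖g t‖ ≤ K / (t + r) ^ 2) :
    ∫ t in Set.Ioi (0 : ℝ), ‖(t : ℂ) ^ (a - 1) * g t‖ ≤
      K * (∫ t in Set.Ioi (0 : ℝ), t ^ (a.re - 1) / (t + 1) ^ 2) * r ^ (a.re - 2) := by
  have h := integral_rpow_div_add_sq_eq hr ha ha1
  calc ∫ t in Set.Ioi (0 : ℝ), ‖(t : ℂ) ^ (a - 1) * g t‖
      ≤ ∫ t in Set.Ioi (0 : ℝ), K * (t ^ (a.re - 1) / (t + r) ^ 2) := by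
        refine integral_mono_of_nonneg (Eventually.of_forall fun t => norm_nonneg _)
          (h.1.const_mul K) ?_
        filter_upwards [ae_restrict_mem measurableSet_Ioi] with t ht
        have ht' : 0 < t := ht
        rw [norm_mul, Complex.norm_cpow_eq_rpow_re_of_pos ht', Complex.sub_re, Complex.one_re]
        calc t ^ (a.re - 1) * ‖g t‖ ≤ t ^ (a.re - 1) * (K / (t + r) ^ 2) := by
              gcongr; exact hg t ht'
          _ = _ := by ring
    _ = _ := by rw [integral_const_mul, h.2]; ring

/-- Needed for the Gamma part, so that the integral of (ξ'/ξ)' may be split into Gamma and zeta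
parts. -/
theorem integrable_tsum_of_summable_integral_norm {α ι : Type*} [MeasurableSpace α] {μ : Measure α}
    [Countable ι] {F : ι → α → ℂ} (hF : ∀ i, Integrable (F i) μ)
    (hs : Summable fun i => ∫ x, ‖F i x‖ ∂μ)
    (hm : AEStronglyMeasurable (fun x => ∑' i, F i x) μ) : Integrable (fun x => ∑' i, F i x) μ := by
  refine ⟨hm, ?_⟩
  have h1 : ∑' i, ∫⁻ x, ‖F i x‖ₑ ∂μ < ⊤ := by
    simp_rw [← fun i => ofReal_integral_norm_eq_lintegral_enorm (hF i)]
    exact hs.tsum_ofReal_lt_top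
  rw [← lintegral_tsum fun i => (hF i).1.enorm] at h1
  exact (lintegral_mono fun x => enorm_tsum_le_tsum_enorm).trans_lt h1

theorem shadowPoint_pos (k : ℕ) : (0 : ℝ) < 1 / 2 + 2 * ((k : ℝ) + 1) := by positivity

/-- With a = 2 - 2σ the hypotheses amount to 0 < Re a < 1, and Re 2σ > 1 makes the shadow series
converge. The two signs in sin(πa) = -sin(2πσ) and 1 - a = -(1 - 2σ) cancel. -/
theorem integral_cpow_mul_deriv_gammaLogDeriv {σ : ℂ} (h0 : 1 / 2 < σ.re) (h1 : σ.re < 1) :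
    IntegrableOn (fun t : ℝ => (t : ℂ) ^ (1 - 2 * σ) * deriv gammaLogDeriv t) (Set.Ioi 0) ∧
    ∫ t in Set.Ioi (0 : ℝ), (t : ℂ) ^ (1 - 2 * σ) * deriv gammaLogDeriv t =
      shadowZeta (2 * σ) * ((1 - 2 * σ) * (Real.pi / Complex.sin (2 * Real.pi * σ))) := by
  set a : ℂ := 2 - 2 * σ with ha
  have hre : a.re = 2 - 2 * σ.re := by simp [ha]
  have ha0 : 0 < a.re := by rw [hre]; linarith
  have ha1 : a.re < 1 := by rw [hre]; linarith
  have hsub : a - 1 = 1 - 2 * σ := by rw [ha]; ring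
  have hs2 : 1 < (2 * σ).re := by simp; linarith
  have hcast : ∀ k : ℕ, ((1 / 2 + 2 * ((k : ℝ) + 1) : ℝ) : ℂ) = 1 / 2 + 2 * ((k : ℂ) + 1) :=
    fun k => by push_cast; ring
  have hw : ∀ k : ℕ, (1 / 2 + 2 * ((k : ℂ) + 1)) ∈ Complex.slitPlane := fun k => by
    rw [← hcast]; exact Complex.ofReal_mem_slitPlane.2 (shadowPoint_pos k)
  set F : ℕ → ℝ → ℂ := fun k t => (t : ℂ) ^ (a - 1) *
    (1 / ((t : ℂ) + (1 / 2 + 2 * ((k : ℂ) + 1))) ^ 2) with hF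
  have hFi : ∀ k, Integrable (F k) (volume.restrict (Set.Ioi 0)) := fun k => by
    simp only [hF, mul_one_div]
    exact integrableOn_cpow_div_add_pow (n := 2) (hw k) ha0 (by push_cast; linarith)
  have hFs : Summable fun k => ∫ t, ‖F k t‖ ∂(volume.restrict (Set.Ioi 0)) := by
    have h2 : Summable fun k : ℕ => (1 / 2 + 2 * ((k : ℝ) + 1)) ^ (a.re - 2) := by
      have h3 := (hasSum_shadowSeriesTerm hs2).summable.norm
      refine h3.congr fun k => ?_
      rw [shadowSeriesTerm, ← hcast, Complex.norm_cpow_eq_rpow_re_of_pos (shadowPoint_pos k)]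
      congr 1
      rw [hre]; simp
    refine Summable.of_nonneg_of_le (fun k => integral_nonneg fun t => norm_nonneg _)
      (fun k => integral_norm_cpow_div_sq_le (K := 1) ha0 ha1 (shadowPoint_pos k)
        fun t ht => ?_) (h2.mul_left _)
    rw [← hcast, ← Complex.ofReal_add, norm_div, norm_one, norm_pow, Complex.norm_real,
      Real.norm_of_nonneg (by have := shadowPoint_pos k; linarith)]
  have key := hasSum_integral_of_summable_integral_norm hFi hFs
  have hval : ∀ k, ∫ t, F k t ∂(volume.restrict (Set.Ioi 0)) = shadowSeriesTerm k (2 * σ) *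
      ((1 - 2 * σ) * (Real.pi / Complex.sin (2 * Real.pi * σ))) := by
    intro k
    simp only [hF, mul_one_div]
    rw [integral_cpow_div_add_sq_eq (hw k) ha0 ha1, shadowSeriesTerm,
      show a - 2 = -(2 * σ) by rw [ha]; ring,
      show (Real.pi : ℂ) * a = 2 * Real.pi - 2 * Real.pi * σ by rw [ha]; ring,
      Complex.sin_two_pi_sub, show 1 - a = -(1 - 2 * σ) by rw [ha]; ring, div_neg, neg_mul_neg]
  simp_rw [hval] at key
  have h4 := ((hasSum_shadowSeriesTerm hs2).mul_right
    ((1 - 2 * σ) * (Real.pi / Complex.sin (2 * Real.pi * σ)))).unique key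
  have htsum : Set.EqOn (fun t => ∑' k, F k t)
      (fun t : ℝ => (t : ℂ) ^ (1 - 2 * σ) * deriv gammaLogDeriv t) (Set.Ioi 0) := by
    intro t ht
    have ht' : 0 < t := ht
    simp only [hF]
    rw [tsum_mul_left, (hasSum_deriv_gammaLogDeriv ht'.le).tsum_eq, hsub]
  have hcont : ContinuousOn (fun t : ℝ => (t : ℂ) ^ (1 - 2 * σ) * deriv gammaLogDeriv t)
      (Set.Ioi 0) := by
    intro t ht
    have ht' : 0 < t := ht
    have d2 : ContinuousAt (fun t : ℝ => deriv gammaLogDeriv t) t :=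
      ContinuousAt.comp (f := fun t : ℝ => (t : ℂ))
        (analyticAt_gammaLogDeriv (by simp; linarith)).deriv.continuousAt (by fun_prop)
    exact ((Complex.continuousAt_ofReal_cpow_const _ _ (Or.inr ht'.ne')).mul
      d2).continuousWithinAt
  constructor
  · refine IntegrableOn.congr_fun ?_ htsum measurableSet_Ioi
    exact integrable_tsum_of_summable_integral_norm hFi hFs
      ((hcont.congr htsum).aestronglyMeasurable measurableSet_Ioi)
  · rw [shadowZeta_eq (by intro h; rw [h] at hs2; norm_num at hs2), h4,
      setIntegral_congr_fun measurableSet_Ioi htsum]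

theorem integral_cpow_mul_deriv_logDeriv_xiCentered {σ : ℂ} (h0 : 1 / 2 < σ.re) (h1 : σ.re < 1) :
    ∫ t in Set.Ioi (0 : ℝ), (t : ℂ) ^ (1 - 2 * σ) * deriv (logDeriv xiCentered) t =
      -(2 * Complex.cos (Real.pi * σ) * zeroSeries σ *
        ((1 - 2 * σ) * (Real.pi / Complex.sin (2 * Real.pi * σ)))) := by
  have := countable_zetaZeroParam
  set a : ℂ := 2 - 2 * σ with ha
  have hre : a.re = 2 - 2 * σ.re := by simp [ha]
  have ha0 : 0 < a.re := by rw [hre]; linarith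
  have ha1 : a.re < 1 := by rw [hre]; linarith
  have hsub : a - 1 = 1 - 2 * σ := by rw [ha]; ring
  have hw1 : ∀ τ : zetaZeroParam, -(Complex.I * (τ : ℂ)) ∈ Complex.slitPlane := fun τ => by
    right
    have := re_pos_of_zetaZeroParam τ
    simpa using this.ne'
  have hw2 : ∀ τ : zetaZeroParam, Complex.I * (τ : ℂ) ∈ Complex.slitPlane := fun τ => by
    right
    have := re_pos_of_zetaZeroParam τ
    simpa using this.ne'
  obtain ⟨K, hK, hKb⟩ := exists_norm_xi_summand_le
  set g : zetaZeroParam → ℝ → ℂ := fun τ t => (zetaZeroMult τ : ℂ) *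
    (1 / (t - Complex.I * τ) ^ 2 + 1 / (t + Complex.I * τ) ^ 2) with hg
  set F : zetaZeroParam → ℝ → ℂ := fun τ t => (t : ℂ) ^ (a - 1) * g τ t with hF
  have hFeq : ∀ τ, F τ = fun t : ℝ => (zetaZeroMult τ : ℂ) *
      ((t : ℂ) ^ (a - 1) / (t + -(Complex.I * τ)) ^ 2 +
        (t : ℂ) ^ (a - 1) / (t + Complex.I * τ) ^ 2) := by
    intro τ
    funext t
    simp only [hF, hg, sub_eq_add_neg]
    ring
  have hi1 : ∀ τ : zetaZeroParam, IntegrableOn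
      (fun t : ℝ => (t : ℂ) ^ (a - 1) / (t + -(Complex.I * τ)) ^ 2) (Set.Ioi 0) := fun τ =>
    integrableOn_cpow_div_add_pow (hw1 τ) ha0 (by push_cast; linarith)
  have hi2 : ∀ τ : zetaZeroParam, IntegrableOn
      (fun t : ℝ => (t : ℂ) ^ (a - 1) / (t + Complex.I * τ) ^ 2) (Set.Ioi 0) := fun τ =>
    integrableOn_cpow_div_add_pow (hw2 τ) ha0 (by push_cast; linarith)
  have hFi : ∀ τ, Integrable (F τ) (volume.restrict (Set.Ioi 0)) := fun τ => by
    rw [hFeq]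
    exact ((hi1 τ).add (hi2 τ)).const_mul _
  have hgb : ∀ τ : zetaZeroParam, ∀ t : ℝ, 0 < t →
      ‖g τ t‖ ≤ ((zetaZeroMult τ : ℝ) * (2 * K)) / (t + ‖(τ : ℂ)‖) ^ 2 := by
    intro τ t ht
    have h2 := hKb τ t ht.le
    simp only [hg]
    rw [norm_mul, Complex.norm_natCast, mul_div_assoc]
    gcongr
    refine (norm_add_le _ _).trans ((add_le_add h2.1 h2.2).trans (le_of_eq ?_))
    ring
  have hFs : Summable fun τ => ∫ t, ‖F τ t‖ ∂(volume.restrict (Set.Ioi 0)) := by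
    have h2 := summable_zetaZeroMult_mul_norm_rpow (p := 2 * σ.re) (by linarith)
    refine Summable.of_nonneg_of_le (fun τ => integral_nonneg fun t => norm_nonneg _)
      (fun τ => (integral_norm_cpow_div_sq_le ha0 ha1
        (norm_pos_iff.2 (ne_zero_of_zetaZeroParam τ)) (hgb τ)).trans (le_of_eq ?_))
      (h2.mul_left (2 * K * ∫ t in Set.Ioi (0 : ℝ), t ^ (a.re - 1) / (t + 1) ^ 2))
    rw [show a.re - 2 = -(2 * σ.re) by rw [hre]; ring]
    ring
  have key := hasSum_integral_of_summable_integral_norm hFi hFs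
  have hval : ∀ τ, ∫ t, F τ t ∂(volume.restrict (Set.Ioi 0)) = zeroSeriesTerm τ σ *
      (2 * Complex.cos (Real.pi * σ) *
        ((1 - 2 * σ) * (Real.pi / Complex.sin (2 * Real.pi * σ)))) := by
    intro τ
    rw [hFeq, integral_const_mul, integral_add (hi1 τ) (hi2 τ),
      integral_cpow_div_add_sq_eq (hw1 τ) ha0 ha1, integral_cpow_div_add_sq_eq (hw2 τ) ha0 ha1,
      ← add_mul, cpow_neg_I_mul_add_cpow_I_mul (re_pos_of_zetaZeroParam τ), zeroSeriesTerm,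
      show a - 2 = -2 * σ by rw [ha]; ring,
      show (Real.pi : ℂ) * a = 2 * Real.pi - 2 * Real.pi * σ by rw [ha]; ring,
      Complex.sin_two_pi_sub, show 1 - a = -(1 - 2 * σ) by rw [ha]; ring, div_neg, neg_mul_neg,
      show (Real.pi : ℂ) * (-2 * σ) / 2 = -(Real.pi * σ) by ring, Complex.cos_neg]
    ring
  simp_rw [hval] at key
  have h4 := ((hasSum_zeroSeriesTerm h0).mul_right (2 * Complex.cos (Real.pi * σ) *
    ((1 - 2 * σ) * (Real.pi / Complex.sin (2 * Real.pi * σ))))).unique key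
  have htsum : ∀ t ∈ Set.Ioi (0 : ℝ), ∑' τ, F τ t =
      -((t : ℂ) ^ (1 - 2 * σ) * deriv (logDeriv xiCentered) t) := by
    intro t ht
    have ht' : 0 < t := ht
    simp only [hF]
    rw [tsum_mul_left, (hasSum_xi_summand ht'.le).tsum_eq, hsub, mul_neg]
  rw [setIntegral_congr_fun measurableSet_Ioi htsum, integral_neg] at h4
  linear_combination h4

/-! ### Gluing the formulas into a meromorphic function. -/

theorem sin_two_pi_mul_ne_zero' {σ : ℂ} (h0 : 1 / 2 < σ.re) (h1 : σ.re < 1) :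
    Complex.sin (2 * Real.pi * σ) ≠ 0 := by
  have h := sin_two_pi_mul_ne_zero (σ := σ - 1 / 2) (by norm_num; linarith) (by norm_num; linarith)
  rwa [show 2 * (Real.pi : ℂ) * (σ - 1 / 2) = 2 * Real.pi * σ - Real.pi by ring,
    Complex.sin_sub_pi, neg_ne_zero] at h

/-- The continuation of `∑ τ ^ (-2σ)` in the strip `0 < Re σ < 1`. -/
noncomputable def stripFormula (σ : ℂ) : ℂ :=
  -(shadowZeta (2 * σ) / (2 * Complex.cos (Real.pi * σ))) -
    Complex.sin (Real.pi * σ) / Real.pi * (zetaLogDerivDerivMellin σ / (1 - 2 * σ))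

/-- The continuation of `∑ τ ^ (-2σ)` in the half-plane `Re σ < 1/2`. -/
noncomputable def leftFormula (σ : ℂ) : ℂ :=
  (-shadowZeta (2 * σ) + 2 ^ (2 * σ) * Complex.cos (2 * Real.pi * σ)) /
    (2 * Complex.cos (Real.pi * σ)) + Complex.sin (Real.pi * σ) / Real.pi * reducedIntegral σ

/-- Compare the two Mellin transforms of (ξ'/ξ)', over zeros and over Gamma and zeta parts, and
divide by sin(2πσ) = 2 sin(πσ) cos(πσ). -/
theorem zeroSeries_eq_stripFormula {σ : ℂ} (h0 : 1 / 2 < σ.re) (h1 : σ.re < 1) :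
    zeroSeries σ = stripFormula σ := by
  have hG := integral_cpow_mul_deriv_gammaLogDeriv h0 h1
  have hH := (integrableOn_cpow_mul_deriv_zetaLogDeriv (by linarith) h1).1
  have hX := integral_cpow_mul_deriv_logDeriv_xiCentered h0 h1
  have heq : Set.EqOn (fun t : ℝ => (t : ℂ) ^ (1 - 2 * σ) * deriv (logDeriv xiCentered) t)
      (fun t : ℝ => (t : ℂ) ^ (1 - 2 * σ) * deriv gammaLogDeriv t +
        (t : ℂ) ^ (1 - 2 * σ) * deriv zetaLogDeriv t) (Set.Ioi 0) := by
    intro t ht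
    simp only
    rw [deriv_logDeriv_xiCentered (le_of_lt ht), mul_add]
  rw [setIntegral_congr_fun measurableSet_Ioi heq, integral_add hG.1 hH, hG.2] at hX
  change _ + zetaLogDerivDerivMellin σ = _ at hX
  have hsin := sin_two_pi_mul_ne_zero' h0 h1
  have hs2 : Complex.sin (2 * Real.pi * σ) =
      2 * Complex.sin (Real.pi * σ) * Complex.cos (Real.pi * σ) := by
    rw [← Complex.sin_two_mul]; congr 1; ring
  rw [hs2] at hsin hX
  have hne : (1 - 2 * σ) ≠ 0 := by
    intro h
    have := congrArg Complex.re h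
    simp at this
    linarith
  have hpi : (Real.pi : ℂ) ≠ 0 := Complex.ofReal_ne_zero.2 Real.pi_ne_zero
  rw [stripFormula]
  generalize Complex.sin (Real.pi * σ) = x at *
  generalize Complex.cos (Real.pi * σ) = y at *
  have hx : x ≠ 0 := fun h => hsin (by rw [h]; ring)
  have hy : y ≠ 0 := fun h => hsin (by rw [h]; ring)
  generalize (1 - 2 * σ) = v at *
  field_simp at hX ⊢
  linear_combination hX

theorem cos_pi_mul_ne_zero {σ : ℂ} (h0 : 0 < σ.re) (h1 : σ.re < 1 / 2) :
    Complex.cos (Real.pi * σ) ≠ 0 := by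
  intro h
  apply sin_two_pi_mul_ne_zero h0 h1
  rw [show 2 * (Real.pi : ℂ) * σ = 2 * (Real.pi * σ) by ring, Complex.sin_two_mul, h, mul_zero]

theorem stripFormula_eq {σ : ℂ} (h0 : 0 < σ.re) (h1 : σ.re < 1 / 2) :
    stripFormula σ = -(shadowZeta (2 * σ) / (2 * Complex.cos (Real.pi * σ))) +
      Complex.sin (Real.pi * σ) / Real.pi * zetaLogDerivMellin σ := by
  have hne : (1 - 2 * σ) ≠ 0 := by
    intro h
    have := congrArg Complex.re h
    simp at this
    linarith
  rw [stripFormula, zetaLogDerivDerivMellin_eq h0 h1]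
  field_simp
  ring

theorem stripFormula_eq_leftFormula {σ : ℂ} (h0 : 0 < σ.re) (h1 : σ.re < 1 / 2) :
    stripFormula σ = leftFormula σ := by
  have hsin := sin_two_pi_mul_ne_zero h0 h1
  have hs2 : Complex.sin (2 * Real.pi * σ) =
      2 * Complex.sin (Real.pi * σ) * Complex.cos (Real.pi * σ) := by
    rw [← Complex.sin_two_mul]; congr 1; ring
  rw [stripFormula_eq h0 h1, zetaLogDerivMellin_eq h0 h1, leftFormula]
  rw [hs2] at hsin ⊢
  have hpi : (Real.pi : ℂ) ≠ 0 := Complex.ofReal_ne_zero.2 Real.pi_ne_zero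
  generalize Complex.sin (Real.pi * σ) = x at *
  generalize Complex.cos (Real.pi * σ) = y at *
  have hx : x ≠ 0 := fun h => hsin (by rw [h]; ring)
  have hy : y ≠ 0 := fun h => hsin (by rw [h]; ring)
  field_simp
  ring

open Classical in
/-- The three formulas for the continuation of `∑ τ ^ (-2σ)`, glued along `Re σ = 1/2`. -/
noncomputable def gluedZeta (σ : ℂ) : ℂ :=
  if 1 / 2 < σ.re then zeroSeries σ else if σ.re < 1 / 2 then leftFormula σ else stripFormula σ

theorem gluedZeta_of_lt {σ : ℂ} (h : 1 / 2 < σ.re) : gluedZeta σ = zeroSeries σ := if_pos h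

theorem gluedZeta_of_gt {σ : ℂ} (h : σ.re < 1 / 2) : gluedZeta σ = leftFormula σ := by
  rw [gluedZeta, if_neg h.not_gt, if_pos h]

/-- The strip formula is meromorphic across Re σ = 1/2, where the two other pieces meet. -/
theorem gluedZeta_eq_stripFormula {σ : ℂ} (h0 : 0 < σ.re) (h1 : σ.re < 1) :
    gluedZeta σ = stripFormula σ := by
  rcases lt_trichotomy σ.re (1 / 2) with h | h | h
  · rw [gluedZeta_of_gt h, stripFormula_eq_leftFormula h0 h]
  · rw [gluedZeta, if_neg h.not_gt, if_neg h.not_lt]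
  · rw [gluedZeta_of_lt h, zeroSeries_eq_stripFormula h h1]

theorem isOpen_re_lt (c : ℝ) : IsOpen {s : ℂ | s.re < c} :=
  isOpen_lt Complex.continuous_re continuous_const

theorem isOpen_lt_re (c : ℝ) : IsOpen {s : ℂ | c < s.re} :=
  isOpen_lt continuous_const Complex.continuous_re

theorem analyticAt_zeroSeries {σ : ℂ} (h : 1 / 2 < σ.re) : AnalyticAt ℂ zeroSeries σ :=
  DifferentiableOn.analyticAt (s := {s : ℂ | 1 / 2 < s.re})
    (fun _ hs => (differentiableAt_zeroSeries hs).differentiableWithinAt)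
    ((isOpen_lt_re _).mem_nhds h)

theorem analyticAt_reducedIntegral {σ : ℂ} (h : σ.re < 1 / 2) : AnalyticAt ℂ reducedIntegral σ :=
  DifferentiableOn.analyticAt (s := {s : ℂ | s.re < 1 / 2})
    (fun _ hs => (differentiableAt_reducedIntegral hs).differentiableWithinAt)
    ((isOpen_re_lt _).mem_nhds h)

theorem analyticAt_zetaLogDerivDerivMellin {σ : ℂ} (h0 : 0 < σ.re) (h1 : σ.re < 1) :
    AnalyticAt ℂ zetaLogDerivDerivMellin σ :=
  DifferentiableOn.analyticAt (s := {s : ℂ | 0 < s.re} ∩ {s : ℂ | s.re < 1})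
    (fun _ hs => (integrableOn_cpow_mul_deriv_zetaLogDeriv hs.1 hs.2).2.differentiableWithinAt)
    (((isOpen_lt_re _).inter (isOpen_re_lt _)).mem_nhds ⟨h0, h1⟩)

theorem meromorphicAt_shadowZeta_two_mul (σ : ℂ) :
    MeromorphicAt (fun s => shadowZeta (2 * s)) σ :=
  (meromorphicAt_shadowZeta (2 * σ)).comp_analyticAt (g := fun s => 2 * s)
    (analyticAt_const.mul analyticAt_id)

theorem analyticAt_sin_pi_mul (σ : ℂ) : AnalyticAt ℂ (fun s => Complex.sin (Real.pi * s)) σ :=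
  (show Differentiable ℂ fun s => Complex.sin (Real.pi * s) by fun_prop).analyticAt σ

theorem analyticAt_cos_pi_mul (σ : ℂ) : AnalyticAt ℂ (fun s => Complex.cos (Real.pi * s)) σ :=
  (show Differentiable ℂ fun s => Complex.cos (Real.pi * s) by fun_prop).analyticAt σ

theorem analyticAt_two_cpow_mul_cos (σ : ℂ) :
    AnalyticAt ℂ (fun s => (2 : ℂ) ^ (2 * s) * Complex.cos (2 * Real.pi * s)) σ := by
  have h : Differentiable ℂ fun s : ℂ => (2 : ℂ) ^ (2 * s) * Complex.cos (2 * Real.pi * s) := by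
    have h1 : Differentiable ℂ fun s : ℂ => (2 : ℂ) ^ (2 * s) :=
      (differentiable_id.const_mul 2).const_cpow (Or.inl two_ne_zero)
    exact h1.mul (by fun_prop)
  exact h.analyticAt σ

theorem meromorphicAt_stripFormula {σ : ℂ} (h0 : 0 < σ.re) (h1 : σ.re < 1) :
    MeromorphicAt stripFormula σ :=
  (((meromorphicAt_shadowZeta_two_mul σ).div
    (analyticAt_const.mul (analyticAt_cos_pi_mul σ)).meromorphicAt).neg).sub
    (((analyticAt_sin_pi_mul σ).meromorphicAt.div (MeromorphicAt.const _ σ)).mul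
      ((analyticAt_zetaLogDerivDerivMellin h0 h1).meromorphicAt.div
        (analyticAt_const.sub (analyticAt_const.mul analyticAt_id)).meromorphicAt))

theorem meromorphicAt_leftFormula {σ : ℂ} (h : σ.re < 1 / 2) : MeromorphicAt leftFormula σ :=
  (((meromorphicAt_shadowZeta_two_mul σ).neg.add
    (analyticAt_two_cpow_mul_cos σ).meromorphicAt).div
    (analyticAt_const.mul (analyticAt_cos_pi_mul σ)).meromorphicAt).add
    (((analyticAt_sin_pi_mul σ).meromorphicAt.div (MeromorphicAt.const _ σ)).mul
      (analyticAt_reducedIntegral h).meromorphicAt)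

theorem analyticAt_leftFormula {σ : ℂ} (h : σ.re < 1 / 2) (hcos : Complex.cos (Real.pi * σ) ≠ 0) :
    AnalyticAt ℂ leftFormula σ := by
  have h1 : AnalyticAt ℂ (fun s => shadowZeta (2 * s)) σ := by
    refine AnalyticAt.comp (g := shadowZeta) (analyticAt_shadowZeta ?_)
      (analyticAt_const.mul analyticAt_id)
    intro h2
    have := congrArg Complex.re h2
    simp at this
    linarith
  have hpi : (Real.pi : ℂ) ≠ 0 := Complex.ofReal_ne_zero.2 Real.pi_ne_zero
  exact ((h1.neg.add (analyticAt_two_cpow_mul_cos σ)).div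
    (analyticAt_const.mul (analyticAt_cos_pi_mul σ)) (mul_ne_zero two_ne_zero hcos)).add
    (((analyticAt_sin_pi_mul σ).div analyticAt_const hpi).mul (analyticAt_reducedIntegral h))

theorem eventuallyEq_gluedZeta_zeroSeries {σ : ℂ} (h : 1 / 2 < σ.re) :
    zeroSeries =ᶠ[𝓝 σ] gluedZeta := by
  filter_upwards [(isOpen_lt_re _).mem_nhds h] with s hs
  exact (gluedZeta_of_lt hs).symm

theorem eventuallyEq_gluedZeta_leftFormula {σ : ℂ} (h : σ.re < 1 / 2) :
    leftFormula =ᶠ[𝓝 σ] gluedZeta := by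
  filter_upwards [(isOpen_re_lt _).mem_nhds h] with s hs
  exact (gluedZeta_of_gt hs).symm

theorem meromorphicAt_gluedZeta (σ : ℂ) : MeromorphicAt gluedZeta σ := by
  rcases lt_trichotomy σ.re (1 / 2) with h | h | h
  · exact (meromorphicAt_leftFormula h).congr
      ((eventuallyEq_gluedZeta_leftFormula h).filter_mono nhdsWithin_le_nhds)
  · have h0 : 0 < σ.re := by linarith
    have h1 : σ.re < 1 := by linarith
    refine (meromorphicAt_stripFormula h0 h1).congr (EventuallyEq.filter_mono ?_ nhdsWithin_le_nhds)
    filter_upwards [(isOpen_lt_re _).mem_nhds h0, (isOpen_re_lt _).mem_nhds h1] with s hs0 hs1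
    exact (gluedZeta_eq_stripFormula hs0 hs1).symm
  · exact (analyticAt_zeroSeries h).meromorphicAt.congr
      ((eventuallyEq_gluedZeta_zeroSeries h).filter_mono nhdsWithin_le_nhds)

/-- The meromorphic continuation of `∑ τ ^ (-2σ)`. -/
noncomputable def superzeta : ℂ → ℂ := toMeromorphicNFOn gluedZeta Set.univ

theorem isMeromorphicContinuation_superzeta :
    IsMeromorphicContinuation zeroSeriesTerm (1 / 2) superzeta := by
  refine ⟨meromorphicNFOn_toMeromorphicNFOn _ _, fun s hs => ?_⟩
  rw [superzeta, toMeromorphicNFOn_eq_of_analyticAt (fun σ _ => meromorphicAt_gluedZeta σ)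
    ((analyticAt_zeroSeries hs).congr (eventuallyEq_gluedZeta_zeroSeries hs)), gluedZeta_of_lt hs]
  exact hasSum_zeroSeriesTerm hs

/-- Where cos(πσ) ≠ 0 the left formula is analytic, since 2σ ≠ 1, and passing to normal form leaves
its value unchanged. -/
theorem superzeta_eq_leftFormula {σ : ℂ} (h : σ.re < 1 / 2)
    (hcos : Complex.cos (Real.pi * σ) ≠ 0) : superzeta σ = leftFormula σ := by
  rw [superzeta, toMeromorphicNFOn_eq_of_analyticAt (fun σ _ => meromorphicAt_gluedZeta σ)
    ((analyticAt_leftFormula h hcos).congr (eventuallyEq_gluedZeta_leftFormula h)),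
    gluedZeta_of_gt h]

/-! ### The ray formulas and the regularised formula. -/

/-- Used with ι = ±i: because sin(2πσ)/(2 cos(πσ)) = sin(πσ), the sine part of the exponential
cancels the half residue. -/
theorem two_cpow_mul_exp_div_eq {σ : ℂ} (hcos : Complex.cos (Real.pi * σ) ≠ 0) (ι : ℂ) (b p : ℂ) :
    (b + 2 ^ (2 * σ) * (Complex.cos (2 * Real.pi * σ) - ι * Complex.sin (2 * Real.pi * σ))) /
      (2 * Complex.cos (Real.pi * σ)) +
      Complex.sin (Real.pi * σ) / Real.pi * (p + Real.pi * ι * 2 ^ (2 * σ)) =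
    (b + 2 ^ (2 * σ) * Complex.cos (2 * Real.pi * σ)) / (2 * Complex.cos (Real.pi * σ)) +
      Complex.sin (Real.pi * σ) / Real.pi * p := by
  have hs2 : Complex.sin (2 * Real.pi * σ) =
      2 * Complex.sin (Real.pi * σ) * Complex.cos (Real.pi * σ) := by
    rw [← Complex.sin_two_mul]; congr 1; ring
  have hpi : (Real.pi : ℂ) ≠ 0 := Complex.ofReal_ne_zero.2 Real.pi_ne_zero
  rw [hs2]
  generalize Complex.cos (Real.pi * σ) = y at *
  generalize Complex.sin (Real.pi * σ) = x at *
  field_simp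
  ring

theorem superzeta_eq_integral_rayPullback {σ : ℂ} (h : σ.re < 1 / 2)
    (hcos : Complex.cos (Real.pi * σ) ≠ 0) {θ : ℝ} (h0 : 0 < θ) (h1 : θ ≤ sectorAngle) :
    superzeta σ = (-shadowZeta (2 * σ) +
          2 ^ (2 * σ) * Complex.exp (-(2 * Real.pi * Complex.I * σ))) /
          (2 * Complex.cos (Real.pi * σ)) +
        Complex.sin (Real.pi * σ) / Real.pi *
          ∫ r in Set.Ioi (0 : ℝ), rayPullback (mellinIntegrand σ) θ r ∧
    superzeta σ = (-shadowZeta (2 * σ) +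
          2 ^ (2 * σ) * Complex.exp (2 * Real.pi * Complex.I * σ)) /
          (2 * Complex.cos (Real.pi * σ)) +
        Complex.sin (Real.pi * σ) / Real.pi *
          ∫ r in Set.Ioi (0 : ℝ), rayPullback (mellinIntegrand σ) (-θ) r := by
  have hi := integral_rayPullback_mellinIntegrand h h0 h1
  have e1 : Complex.exp (2 * Real.pi * Complex.I * σ) = Complex.cos (2 * Real.pi * σ) -
      -Complex.I * Complex.sin (2 * Real.pi * σ) := by
    rw [show 2 * (Real.pi : ℂ) * Complex.I * σ = 2 * Real.pi * σ * Complex.I by ring,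
      Complex.exp_mul_I]
    ring
  have e2 : Complex.exp (-(2 * Real.pi * Complex.I * σ)) = Complex.cos (2 * Real.pi * σ) -
      Complex.I * Complex.sin (2 * Real.pi * σ) := by
    rw [show -(2 * (Real.pi : ℂ) * Complex.I * σ) = -(2 * Real.pi * σ) * Complex.I by ring,
      Complex.exp_mul_I, Complex.cos_neg, Complex.sin_neg]
    ring
  have e3 : reducedIntegral σ - Real.pi * Complex.I * 2 ^ (2 * σ) =
      reducedIntegral σ + Real.pi * -Complex.I * 2 ^ (2 * σ) := by ring
  rw [hi.1.2, hi.2.2, e1, e2, e3, two_cpow_mul_exp_div_eq hcos, two_cpow_mul_exp_div_eq hcos,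
    superzeta_eq_leftFormula h hcos]
  exact ⟨rfl, rfl⟩

theorem regularMellinIntegrand_eq {σ : ℂ} {t : ℝ} (ht : 0 < t) (hne : t ≠ 1 / 2) :
    regularMellinIntegrand σ t = (t : ℂ) ^ (-2 * σ) * zetaLogDeriv t := by
  have h0 : |(0 : ℝ)| ≤ sectorAngle := by simpa using sectorAngle_pos.le
  have h1 := ofReal_mul_exp_ne_half (θ := 0) ht.le hne
  have h2 := riemannZeta₁_ne_zero_of_abs_le_sectorAngle ht.le h0
  simp only [Complex.ofReal_zero, zero_mul, Complex.exp_zero, mul_one] at h1 h2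
  rw [regularMellinIntegrand, zetaLogDeriv_eq h1 h2]

theorem regularMellinIntegrand_ae_eq (σ : ℂ) :
    (fun t : ℝ => regularMellinIntegrand σ t) =ᵐ[volume.restrict (Set.Ioi 0)]
      fun t : ℝ => (t : ℂ) ^ (-2 * σ) * zetaLogDeriv t := by
  filter_upwards [ae_restrict_mem measurableSet_Ioi, ae_restrict_of_ae ae_ne_half] with t ht hne
  exact regularMellinIntegrand_eq ht hne

theorem superzeta_eq_integral_regularMellinIntegrand {σ : ℂ} (h0 : 0 < σ.re) (h1 : σ.re < 1 / 2) :
    superzeta σ = -(shadowZeta (2 * σ) / (2 * Complex.cos (Real.pi * σ))) +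
      Complex.sin (Real.pi * σ) / Real.pi *
        ∫ t in Set.Ioi (0 : ℝ), regularMellinIntegrand σ t := by
  rw [superzeta_eq_leftFormula h1 (cos_pi_mul_ne_zero h0 h1), ← stripFormula_eq_leftFormula h0 h1,
    stripFormula_eq h0 h1, integral_congr_ae (regularMellinIntegrand_ae_eq σ)]
  rfl

/-! ### The exact strip of absolute convergence. -/

/-- Near 0 the factor `zetaLogDeriv` is bounded away from zero, so the integrand dominates a
multiple of 1/t. -/
theorem not_integrableOn_of_one_half_le_re {σ : ℂ} (h : 1 / 2 ≤ σ.re) :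
    ¬IntegrableOn (fun t : ℝ => (t : ℂ) ^ (-2 * σ) * zetaLogDeriv t) (Set.Ioi 0) := by
  intro hint
  have hc : ContinuousAt (fun t : ℝ => ‖zetaLogDeriv t‖) 0 := by
    have h0 : AnalyticAt ℂ zetaLogDeriv ((0 : ℝ) : ℂ) := analyticAt_zetaLogDeriv_ofReal le_rfl
    exact (ContinuousAt.comp (f := fun t : ℝ => (t : ℂ)) h0.continuousAt (by fun_prop)).norm
  set c : ℝ := ‖zetaLogDeriv 0‖ / 2 with hcdef
  have hc0 : 0 < c := half_pos (norm_pos_iff.2 zetaLogDeriv_zero_ne_zero)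
  have hev : ∀ᶠ t : ℝ in 𝓝 0, c < ‖zetaLogDeriv t‖ := by
    refine hc.eventually (lt_mem_nhds ?_)
    simp only [Complex.ofReal_zero]
    exact half_lt_self (norm_pos_iff.2 zetaLogDeriv_zero_ne_zero)
  obtain ⟨ε, hε, hball⟩ := Metric.eventually_nhds_iff.1 hev
  set ρ : ℝ := min (ε / 2) 1 with hρ
  have hρ0 : 0 < ρ := by positivity
  have h1 : IntegrableOn (fun t : ℝ => t ^ (-1 : ℝ)) (Set.Ioo 0 ρ) := by
    have h2 : IntegrableOn (fun t : ℝ => c⁻¹ * ‖(t : ℂ) ^ (-2 * σ) * zetaLogDeriv t‖)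
        (Set.Ioo 0 ρ) := (hint.mono_set Set.Ioo_subset_Ioi_self).norm.const_mul _
    refine Integrable.mono' h2 ?_ ?_
    · refine ContinuousOn.aestronglyMeasurable (fun t ht => ?_) measurableSet_Ioo
      exact (Real.continuousAt_rpow_const t _ (Or.inl ht.1.ne')).continuousWithinAt
    · filter_upwards [ae_restrict_mem measurableSet_Ioo] with t ht
      have ht1 : t ≤ 1 := (ht.2.trans_le (min_le_right _ _)).le
      have ht2 : c < ‖zetaLogDeriv t‖ := by
        apply hball
        rw [Real.dist_0_eq_abs, abs_of_pos ht.1]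
        linarith [ht.2.trans_le (min_le_left (ε / 2) 1)]
      have hre : (-2 * σ).re = -(2 * σ.re) := by simp
      rw [Real.norm_of_nonneg (by have := ht.1; positivity), norm_mul,
        Complex.norm_cpow_eq_rpow_re_of_pos ht.1, hre, ← div_eq_inv_mul, le_div_iff₀ hc0]
      have h3 := Real.rpow_le_rpow_of_exponent_ge ht.1 ht1 (by linarith : -(2 * σ.re) ≤ -1)
      have h4 : 0 ≤ t ^ (-1 : ℝ) := by have := ht.1; positivity
      calc _ ≤ t ^ (-(2 * σ.re)) * c := by gcongr
        _ ≤ _ := by gcongr; exact h4.trans h3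
  rw [intervalIntegral.integrableOn_Ioo_rpow_iff hρ0] at h1
  linarith

theorem exists_one_div_le_norm_zetaLogDeriv : ∃ T : ℝ, 4 ≤ T ∧ ∀ t : ℝ, T ≤ t →
    (2 * t)⁻¹ ≤ ‖zetaLogDeriv t‖ := by
  obtain ⟨C, hC, h⟩ := exists_norm_logDeriv_zeta_sector_le
  obtain ⟨D, hD, hexp⟩ := exists_exp_neg_mul_rpow_le 2
  -- For t ≥ 2CD the exponential part is at most CD/t² ≤ 1/(2t), half of the lower bound 1/t for the
  -- polar term.
  refine ⟨max 4 (2 * C * D), le_max_left _ _, fun t ht => ?_⟩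
  have h4 : 4 ≤ t := (le_max_left _ _).trans ht
  have hT : 2 * C * D ≤ t := (le_max_right _ _).trans ht
  have ht0 : 0 < t := by linarith
  have h0 : |(0 : ℝ)| ≤ sectorAngle := by simpa using sectorAngle_pos.le
  have h1 := ofReal_mul_exp_ne_half (θ := 0) ht0.le (by linarith)
  have h2 := riemannZeta₁_ne_zero_of_abs_le_sectorAngle ht0.le h0
  have h3 := h t h4 0 h0
  simp only [Complex.ofReal_zero, zero_mul, Complex.exp_zero, mul_one] at h1 h2 h3
  rw [zetaLogDeriv_eq h1 h2]
  have h5 : ‖1 / ((t : ℂ) - 1 / 2)‖ = (t - 1 / 2)⁻¹ := by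
    rw [show (t : ℂ) - 1 / 2 = ((t - 1 / 2 : ℝ) : ℂ) by push_cast; ring, norm_div, norm_one,
      Complex.norm_real, Real.norm_of_nonneg (by linarith), one_div]
  have h6 := norm_sub_le_norm_add (1 / ((t : ℂ) - 1 / 2))
    (deriv riemannZeta (1 / 2 + t) / riemannZeta (1 / 2 + t))
  rw [add_comm (1 / ((t : ℂ) - 1 / 2)), h5] at h6
  have h7 : C * Real.exp (-(1 / 4) * t) ≤ (2 * t)⁻¹ := by
    have h8 := hexp t (by linarith)
    rw [Real.rpow_two] at h8
    rw [inv_eq_one_div, le_div_iff₀ (by positivity)]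
    have h9 : t * (C * Real.exp (-(1 / 4) * t) * (2 * t)) ≤ t * 1 := by nlinarith
    exact le_of_mul_le_mul_left h9 ht0
  have h10 : t⁻¹ ≤ (t - 1 / 2)⁻¹ := by
    gcongr
    · linarith
    · linarith
  have h11 : (2 * t)⁻¹ + (2 * t)⁻¹ = t⁻¹ := by field_simp; norm_num
  linarith

/-- For Re σ ≤ 0 the weight is at least 1 in modulus at large t, so the 1/t tail of the polar term
survives. -/
theorem not_integrableOn_of_re_le_zero {σ : ℂ} (h : σ.re ≤ 0) :
    ¬IntegrableOn (fun t : ℝ => (t : ℂ) ^ (-2 * σ) * zetaLogDeriv t) (Set.Ioi 0) := by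
  intro hint
  obtain ⟨T, hT, hb⟩ := exists_one_div_le_norm_zetaLogDeriv
  have hT0 : 0 < T := by linarith
  have h1 : IntegrableOn (fun t : ℝ => t⁻¹) (Set.Ioi T) := by
    have h2 : IntegrableOn (fun t : ℝ => 2 * ‖(t : ℂ) ^ (-2 * σ) * zetaLogDeriv t‖)
        (Set.Ioi T) := (hint.mono_set (Set.Ioi_subset_Ioi hT0.le)).norm.const_mul _
    refine Integrable.mono' h2 measurable_inv.aestronglyMeasurable ?_
    filter_upwards [ae_restrict_mem measurableSet_Ioi] with t ht
    have htT : T < t := ht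
    have ht0 : 0 < t := by linarith
    have hre : (-2 * σ).re = -(2 * σ.re) := by simp
    rw [Real.norm_of_nonneg (by positivity), norm_mul, Complex.norm_cpow_eq_rpow_re_of_pos ht0, hre]
    have h3 : 1 ≤ t ^ (-(2 * σ.re)) := Real.one_le_rpow (by linarith) (by linarith)
    have h4 := hb t htT.le
    have h5 : (2 * t)⁻¹ ≤ t ^ (-(2 * σ.re)) * ‖zetaLogDeriv t‖ :=
      h4.trans (le_mul_of_one_le_left (norm_nonneg _) h3)
    have h11 : 2 * (2 * t)⁻¹ = t⁻¹ := by field_simp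
    linarith
  exact not_integrableOn_Ioi_inv h1

theorem integrableOn_regularMellinIntegrand_iff (σ : ℂ) :
    IntegrableOn (fun t : ℝ => regularMellinIntegrand σ t) (Set.Ioi 0) ↔
      0 < σ.re ∧ σ.re < 1 / 2 := by
  rw [IntegrableOn, integrable_congr (regularMellinIntegrand_ae_eq σ)]
  constructor
  · intro h
    refine ⟨?_, ?_⟩
    · by_contra! h0
      exact not_integrableOn_of_re_le_zero h0 h
    · by_contra! h0
      exact not_integrableOn_of_one_half_le_re h0 h
  · rintro ⟨h0, h1⟩
    exact (integral_rayPullback_cpow_mul_zetaLogDeriv h0 h1 le_rfl sectorAngle_pos.le).1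

theorem mainTheorem1 :
    ∃ Z bZ : ℂ → ℂ,
      IsMeromorphicContinuation zeroSeriesTerm (1 / 2) Z ∧
      IsMeromorphicContinuation shadowSeriesTerm 1 bZ ∧
      (∀ s : ℂ, s ≠ 1 →
        bZ s = 2 ^ s * (((1 - 2 ^ (-s)) * riemannZeta s + dirichletBeta s) / 2 - 1)) ∧
      -- integrals along the rays of small angle `ε` and `-ε`
      (∃ ε₀ : ℝ, 0 < ε₀ ∧ ∀ ε : ℝ, 0 < ε → ε < ε₀ → ∀ σ : ℂ, σ.re < 1 / 2 →
        IntegrableOn (rayPullback (mellinIntegrand σ) ε) (Set.Ioi 0) ∧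
        IntegrableOn (rayPullback (mellinIntegrand σ) (-ε)) (Set.Ioi 0) ∧
        (Complex.cos (Real.pi * σ) ≠ 0 →
          Z σ = (-bZ (2 * σ) + 2 ^ (2 * σ) * Complex.exp (-(2 * Real.pi * Complex.I * σ))) /
                (2 * Complex.cos (Real.pi * σ)) +
              Complex.sin (Real.pi * σ) / Real.pi *
                ∫ r in Set.Ioi (0 : ℝ), rayPullback (mellinIntegrand σ) ε r ∧
          Z σ = (-bZ (2 * σ) + 2 ^ (2 * σ) * Complex.exp (2 * Real.pi * Complex.I * σ)) /
                (2 * Complex.cos (Real.pi * σ)) +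
              Complex.sin (Real.pi * σ) / Real.pi *
                ∫ r in Set.Ioi (0 : ℝ), rayPullback (mellinIntegrand σ) (-ε) r)) ∧
      -- principal value integral on the positive half-line
      (∀ σ : ℂ, σ.re < 1 / 2 →
        ∃ P : ℂ, HasPrincipalValue (fun t : ℝ => mellinIntegrand σ t) (1 / 2) P ∧
          (Complex.cos (Real.pi * σ) ≠ 0 →
            Z σ = (-bZ (2 * σ) + 2 ^ (2 * σ) * Complex.cos (2 * Real.pi * σ)) /
                (2 * Complex.cos (Real.pi * σ)) +
              Complex.sin (Real.pi * σ) / Real.pi * P)) ∧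
      -- regular integrand
      (∀ σ : ℂ,
        IntegrableOn (fun t : ℝ => regularMellinIntegrand σ t) (Set.Ioi 0) ↔
          0 < σ.re ∧ σ.re < 1 / 2) ∧
      (∀ σ : ℂ, 0 < σ.re → σ.re < 1 / 2 →
        Z σ = -(bZ (2 * σ) / (2 * Complex.cos (Real.pi * σ))) +
          Complex.sin (Real.pi * σ) / Real.pi *
            ∫ t in Set.Ioi (0 : ℝ), regularMellinIntegrand σ t) := by
  refine ⟨superzeta, shadowZeta, isMeromorphicContinuation_superzeta,
    isMeromorphicContinuation_shadowZeta, fun s hs => shadowZeta_eq hs,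
    ⟨sectorAngle, sectorAngle_pos, fun ε h0 h1 σ hσ => ?_⟩, fun σ hσ => ?_,
    integrableOn_regularMellinIntegrand_iff, fun σ h0 h1 =>
      superzeta_eq_integral_regularMellinIntegrand h0 h1⟩
  · have hi := integral_rayPullback_mellinIntegrand hσ h0 h1.le
    refine ⟨hi.1.1, ?_, fun hcos => ?_⟩
    · exact_mod_cast hi.2.1
    · exact_mod_cast superzeta_eq_integral_rayPullback hσ hcos h0 h1.le
  · exact ⟨reducedIntegral σ, hasPrincipalValue_mellinIntegrand hσ, fun hcos =>
      superzeta_eq_leftFormula hσ hcos⟩
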